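/- Let $\{A_j^{(i)} : i\in\mathbb Z, j\in\mathbb N\}$ be i.i.d. nonnegative integer-valued random variables with mean $\mu_A\in(0,1)$ and variance $\sigma_A^2\in(0,\infty)$, independent of the i.i.d. nonnegative integer-valued random variables $\{B_i : i\in\mathbb Z\}$, and suppose that $B_0$ is regularly varying with tail index $\alpha\in(1,2)$, i.e. $\lim_{x\to\infty}P(B_0>qx)/P(B_0>x)=q^{-\alpha}$ for all $q>0$; put $\mu_B=E[B_0]$. Let $(X_i)_{i\in\mathbb Z}$ be a strongly stationary process of nonnegative integer-valued random variables with $$X_i=\sum_{j=1}^{X_{i-1}}A_j^{(i)}+B_i,\qquad i\in\mathbb Z,$$ and put $M_i=X_i-\mu_AX_{i-1}-\mu_B$ and $V_k=(X_k^{3/2},X_kM_{k+1})$, $k\in\mathbb Z$. Write $a\vee b=\max\{a,b\}$, and equip $\mathbb R^2$ with the maximum norm, so that $\|V_0\|=X_0^{3/2}\vee X_0|M_1|$. A random vector $W$ in a finite-dimensional normed space is called regularly varying with tail index $\beta$ if there is a probability measure $s$ on the unit sphere such that, for each $u>0$, $P(\|W\|>ux,\ W/\|W\|\in\cdot)/P(\|W\|>x)$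 converges weakly to $u^{-\beta}s$ as $x\to\infty$; a process is jointly regularly varying with tail index $\beta$ if all its finite-dimensional distributions are regularly varying with tail index $\beta$. A process $(T_k)_{k\ge0}$ (resp. $(T_k)_{k\in\mathbb Z}$) is called a forward (resp. whole) tail process of $(V_k)_{k\in\mathbb Z}$, with index $\beta$, if $P(\|T_0\|>y)=y^{-\beta}$ for $y\ge1$ and, as $x\to\infty$, the conditional law of $(x^{-1}V_k)_{k\ge0}$ (resp. $(x^{-1}V_k)_{k\in\mathbb Z}$) given $\|V_0\|>x$ converges to the law of $(T_k)$ in the sense of finite-dimensional distributions. Then the following hold. 1. There are random variables $\tilde Y,\tilde Z_0,\tilde Z_1,\dots$ such that $\tilde Z_k$, $k\ge1$, are i.i.d. $N(0,\sigma_A^2)$, the pair $(\tilde Y,\tilde Z_0)$ is independent of $(\tilde Z_k)_{k\ge1}$, and, with $Z_0\sim N(0,\sigma_A^2)$, for all $y,v_0\in\mathbb R$, $$P(\tilde Y>y,\ \tilde Z_0>v_0)=\frac{E\bigl[\bigl(y\vee(1\vee|Z_0|)^{-1}\bigr)^{-2\alpha/3}\mathbf 1_{(v_0,\infty)}(Z_0)\bigr]}{E\bigl[(1\vee|Z_0|)^{2\alpha/3}\bigr]}.$$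 2. For all such variables, as $x\to\infty$, in the sense of finite-dimensional distributions, $$\mathcal L\Bigl(\bigl(\tfrac1x(X_k^{3/2},X_kM_{k+1})\bigr)_{k\ge0}\,\Big|\,X_0^{3/2}\vee X_0|M_1|>x\Bigr)\longrightarrow\mathcal L\Bigl(\bigl(\mu_A^{3k/2}\tilde Y,\ \mu_A^{3k/2}\tilde Y\tilde Z_k\bigr)_{k\ge0}\Bigr),$$ and $(\mu_A^{3k/2}\tilde Y,\mu_A^{3k/2}\tilde Y\tilde Z_k)_{k\ge0}$ is a forward tail process, with index $2\alpha/3$, of $(X_k^{3/2},X_kM_{k+1})_{k\in\mathbb Z}$. 3. The process $(X_k^{3/2},X_kM_{k+1})_{k\in\mathbb Z}$ is strongly stationary and jointly regularly varying with tail index $2\alpha/3$. 4. There is a (whole) tail process $(T_k)_{k\in\mathbb Z}$, with index $2\alpha/3$, of $(X_k^{3/2},X_kM_{k+1})_{k\in\mathbb Z}$. -/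

import Mathlib

open MeasureTheory ProbabilityTheory Filter Topology BoundedContinuousFunction

noncomputable section

namespace GWTail

/-- Weak convergence of (finite) measures: integrals of bounded continuous functions converge. -/
def TendstoWeakly {ι E : Type*} [TopologicalSpace E] [MeasurableSpace E]
    (μ : ι → Measure E) (l : Filter ι) (ν : Measure E) : Prop :=
  ∀ f : E →ᵇ ℝ, Tendsto (fun i => ∫ e, f e ∂(μ i)) l (𝓝 (∫ e, f e ∂ν))

/-- Strong stationarity of a process indexed by `ℤ`: its law on the product space is invariant
under all shifts of time. -/
def IsStronglyStationary {Ω E : Type*} [MeasurableSpace Ω] [MeasurableSpace E]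
    (P : Measure Ω) (V : ℤ → Ω → E) : Prop :=
  ∀ h : ℤ, P.map (fun ω k => V (k + h) ω) = P.map (fun ω k => V k ω)

/-- `ℒ((x⁻¹ W k)_{k} | S x)` converges as `x → ∞` to the law of `(T k)_k`, in the sense of finite
dimensional distributions. -/
def CondFidiTendsto {ι Ω Ω' E : Type*} [MeasurableSpace Ω] [MeasurableSpace Ω']
    [NormedAddCommGroup E] [NormedSpace ℝ E] [MeasurableSpace E]
    (P : Measure Ω) (W : ι → Ω → E) (S : ℝ → Set Ω)
    (Q : Measure Ω') (T : ι → Ω' → E) : Prop :=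
  ∀ I : Finset ι,
    TendstoWeakly
      (fun x : ℝ => (P[|S x]).map (fun ω (k : I) => x⁻¹ • W k ω))
      atTop
      (Q.map (fun ω' (k : I) => T k ω'))

/-- `T` is a forward tail process, with index `β`, of the process `V`. -/
structure IsForwardTailProcess {Ω Ω' E : Type*} [MeasurableSpace Ω] [MeasurableSpace Ω']
    [NormedAddCommGroup E] [NormedSpace ℝ E] [MeasurableSpace E]
    (P : Measure Ω) (V : ℤ → Ω → E) (β : ℝ) (Q : Measure Ω') (T : ℕ → Ω' → E) : Prop where
  measurable : ∀ k, Measurable (T k)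
  pareto : ∀ y : ℝ, 1 ≤ y → Q.real {ω' | y < ‖T 0 ω'‖} = y ^ (-β)
  tendsto : CondFidiTendsto P (fun k : ℕ => V (k : ℤ)) (fun x => {ω | x < ‖V 0 ω‖}) Q T

/-- `T` is a (whole, i.e. two-sided) tail process, with index `β`, of the process `V`. -/
structure IsTailProcess {Ω Ω' E : Type*} [MeasurableSpace Ω] [MeasurableSpace Ω']
    [NormedAddCommGroup E] [NormedSpace ℝ E] [MeasurableSpace E]
    (P : Measure Ω) (V : ℤ → Ω → E) (β : ℝ) (Q : Measure Ω') (T : ℤ → Ω' → E) : Prop where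
  measurable : ∀ k, Measurable (T k)
  pareto : ∀ y : ℝ, 1 ≤ y → Q.real {ω' | y < ‖T 0 ω'‖} = y ^ (-β)
  tendsto : CondFidiTendsto P V (fun x => {ω | x < ‖V 0 ω‖}) Q T

/-- A random element `W` of a (finite dimensional) normed space is regularly varying with tail
index `β`: there is a probability measure `s` on the unit sphere such that
`P(‖W‖ > u x, W / ‖W‖ ∈ ·) / P(‖W‖ > x)` converges weakly to `u ^ (-β) • s`
as `x → ∞`, for every `u > 0`. -/
def IsRegularlyVarying {Ω E : Type*} [MeasurableSpace Ω]
    [NormedAddCommGroup E] [NormedSpace ℝ E] [MeasurableSpace E]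
    (P : Measure Ω) (W : Ω → E) (β : ℝ) : Prop :=
  ∃ s : Measure E, IsProbabilityMeasure s ∧ s (Metric.sphere (0 : E) 1)ᶜ = 0 ∧
    ∀ u : ℝ, 0 < u →
      TendstoWeakly
        (fun x : ℝ => (P {ω | x < ‖W ω‖})⁻¹ •
          (P.restrict {ω | u * x < ‖W ω‖}).map (fun ω => ‖W ω‖⁻¹ • W ω))
        atTop
        (ENNReal.ofReal (u ^ (-β)) • s)

/-- A process is jointly regularly varying with tail index `β`: all its finite dimensional
distributions are regularly varying with tail index `β`. -/
def IsJointlyRegularlyVarying {Ω E : Type*} [MeasurableSpace Ω]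
    [NormedAddCommGroup E] [NormedSpace ℝ E] [MeasurableSpace E]
    (P : Measure Ω) (V : ℤ → Ω → E) (β : ℝ) : Prop :=
  ∀ I : Finset ℤ, I.Nonempty → IsRegularlyVarying P (fun ω (k : I) => V k ω) β

/-- `X` is a strongly stationary Galton–Watson process with immigration, indexed by `ℤ`.
`A i j` is the number of offspring in generation `i` of the `(j + 1)`-th individual of
generation `i - 1`, and `B i` is the number of immigrants in generation `i`. -/
structure IsStationaryGWI {Ω : Type*} [MeasurableSpace Ω] (P : Measure Ω)
    (A : ℤ → ℕ → Ω → ℕ) (B : ℤ → Ω → ℕ) (X : ℤ → Ω → ℕ) : Prop where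
  measurable_A : ∀ i j, Measurable (A i j)
  measurable_B : ∀ i, Measurable (B i)
  measurable_X : ∀ i, Measurable (X i)
  /-- all the offspring and immigration variables together are independent -/
  indep : iIndepFun (Sum.elim (fun p : ℤ × ℕ => A p.1 p.2) B) P
  identDistrib_A : ∀ i j, IdentDistrib (A i j) (A 0 0) P P
  identDistrib_B : ∀ i, IdentDistrib (B i) (B 0) P P
  recursion : ∀ i, ∀ᵐ ω ∂P, X i ω = ∑ j ∈ Finset.range (X (i - 1) ω), A i j ω + B i ω
  stationary : IsStronglyStationary P X

/-- The offspring mean `μ_A`. -/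
def offspringMean {Ω : Type*} [MeasurableSpace Ω] (P : Measure Ω) (A : ℤ → ℕ → Ω → ℕ) : ℝ :=
  ∫ ω, (A 0 0 ω : ℝ) ∂P

/-- The offspring variance `σ_A²`. -/
def offspringVar {Ω : Type*} [MeasurableSpace Ω] (P : Measure Ω) (A : ℤ → ℕ → Ω → ℕ) : ℝ :=
  variance (fun ω => (A 0 0 ω : ℝ)) P

/-- The immigration mean `μ_B`. -/
def immigrationMean {Ω : Type*} [MeasurableSpace Ω] (P : Measure Ω) (B : ℤ → Ω → ℕ) : ℝ :=
  ∫ ω, (B 0 ω : ℝ) ∂P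

/-- `M_k = X_k - μ_A X_{k-1} - μ_B`. -/
def innovation {Ω : Type*} [MeasurableSpace Ω] (P : Measure Ω) (A : ℤ → ℕ → Ω → ℕ)
    (B : ℤ → Ω → ℕ) (X : ℤ → Ω → ℕ) (k : ℤ) (ω : Ω) : ℝ :=
  (X k ω : ℝ) - offspringMean P A * (X (k - 1) ω : ℝ) - immigrationMean P B

/-- The process `(X_k ^ (3/2), X_k M_{k+1})_{k ∈ ℤ}`. The norm of `ℝ × ℝ` is the maximum norm. -/
def pairProcess {Ω : Type*} [MeasurableSpace Ω] (P : Measure Ω) (A : ℤ → ℕ → Ω → ℕ)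
    (B : ℤ → Ω → ℕ) (X : ℤ → Ω → ℕ) (k : ℤ) (ω : Ω) : ℝ × ℝ :=
  ((X k ω : ℝ) ^ (3 / 2 : ℝ), (X k ω : ℝ) * innovation P A B X (k + 1) ω)

/-- The variables `Y` and `Z k`, `k ≥ 0`, that describe the forward tail process, for tail
index `α` and Gaussian variance `v`: the pair `(Y, Z 0)` has the explicit joint survival function
below, the `Z k`, `k ≥ 1`, are i.i.d. `N(0, v)`, and the two are independent. -/
structure IsTailDriver {Ω' : Type*} [MeasurableSpace Ω'] (Q : Measure Ω') (α v : ℝ)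
    (Y : Ω' → ℝ) (Z : ℕ → Ω' → ℝ) : Prop where
  measurable_Y : Measurable Y
  measurable_Z : ∀ k, Measurable (Z k)
  survival : ∀ y v₀ : ℝ,
    Q.real {ω' | y < Y ω' ∧ v₀ < Z 0 ω'} =
      (∫ z, (max y (max 1 |z|)⁻¹) ^ (-(2 * α / 3)) * (Set.Ioi v₀).indicator 1 z
          ∂(gaussianReal 0 v.toNNReal)) /
        ∫ z, (max 1 |z|) ^ (2 * α / 3) ∂(gaussianReal 0 v.toNNReal)
  gaussian : ∀ k, 1 ≤ k → Q.map (Z k) = gaussianReal 0 v.toNNReal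
  indep_Z : iIndepFun (fun k : ℕ => Z (k + 1)) Q
  indep_pair : IndepFun (fun ω' => (Y ω', Z 0 ω')) (fun ω' (k : ℕ) => Z (k + 1) ω') Q

/-- The process `(m ^ (3k/2) Y, m ^ (3k/2) Y Z_k)_{k ≥ 0}`. -/
def forwardTail {Ω' : Type*} (m : ℝ) (Y : Ω' → ℝ) (Z : ℕ → Ω' → ℝ) (k : ℕ) (ω' : Ω') : ℝ × ℝ :=
  (m ^ (3 * (k : ℝ) / 2) * Y ω', m ^ (3 * (k : ℝ) / 2) * Y ω' * Z k ω')

end GWTail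

end

open GWTail

/-! Write β = 2α/3, m for the offspring mean and σ² for the offspring variance. The heavy tail comes
from immigration alone. In X_{i+1} = m X_i + S_i + B_{i+1} the centred offspring sum S_i of
generation i has second moment σ² E[X_i], hence a tail O(x⁻²), which is negligible against P(B_0 >
x) because α < 2. Iterating this equation in law gives P(X_0 > x) ~ P(B_0 > x)/(1 - m^α), so X_0 has
tail index α and X_0^{3/2} has index β (`tendsto_tail_ratio`, `regVar_X`). The argument needs X_i to
be independent of the environment after time i and to have finite mean. Neither is assumed. Both
follow from coalescence: the path started from 0 individuals at time i - n agrees with X at time i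
with probability tending to 1 (`tendsto_ne_gwPath`, `indepFun_future`, `lintegral_X_le`).

Given X_s = n large, X_{s+k}/n is close to m^k, and by the central limit theorem M_{s+k+1}/√n is
close to m^{k/2} z_{s+k} with independent z ~ N(0, σ²). Both coordinates of the pair process thus
live on the scale n^{3/2} and decay like m^{3k/2} (`tendstoInDistribution_normPath`). The
environment after time s is independent of X_s, so size and fluctuations decouple in the limit
(`tendsto_mixture`). Conversely, the pair can hardly be of order x while X_s^{3/2} is much smaller
than x (`small_generation`). For X_s S_s this is a Chebyshev bound with a truncated third moment of
X_s, and for X_s (B_{s+1} - E B_0) a Markov bound of an order between β and α.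

These facts give a vague limit of all finite-dimensional laws. A functional f vanishing near 0 is
telescoped by erasing the coordinates one by one, starting with the earliest. Each difference
involves only times ≥ κ and is small when coordinate κ is small, so it can be computed given that
generation κ is large. The pieces fit together into one infinite measure `limitMeasure` on triples
(u, r, z): r is a size with tail r^{-β}, z the Gaussian sequence, and u decides how far the large
cluster reaches into the past. At time k the limit is r m^{3k/2} (1, z_k) if u ≤ m^{-αk}, and 0
otherwise.

Joint regular variation and the tail processes are then conditional statements given φ > 1 for a
homogeneous Lipschitz φ (`tendstoWeakly_gauge`). Given a large value at time 0 one has u ≤ 1, so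
nothing is cut off at times k ≥ 0. The forward process is therefore explicit, and its driving
variables are identified through their joint survival function. -/

open scoped ENNReal

set_option linter.unusedSectionVars false

namespace GWTail

/-! ### Regularly varying functions -/

/-- `g` is regularly varying at infinity with index `-α`. -/
def RegVar (g : ℝ → ℝ) (α : ℝ) : Prop :=
  ∀ q : ℝ, 0 < q → Tendsto (fun x => g (q * x) / g x) atTop (𝓝 (q ^ (-α)))

theorem RegVar.pos {g : ℝ → ℝ} {α : ℝ} (h : RegVar g α) (hanti : Antitone g)
    (hnn : ∀ x, 0 ≤ g x) (x : ℝ) : 0 < g x := by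
  have h1 := h 1 one_pos
  simp only [one_mul, Real.one_rpow] at h1
  have h2 : ∀ᶠ y in atTop, (0 : ℝ) < g y / g y := h1.eventually (lt_mem_nhds one_pos)
  obtain ⟨y, hy, hxy⟩ := (h2.and (eventually_ge_atTop x)).exists
  have : g y ≠ 0 := fun h0 => by simp [h0] at hy
  exact lt_of_lt_of_le (lt_of_le_of_ne (hnn y) this.symm) (hanti hxy)

/-- Every t ≥ t₀ is reached from [t₀, 2t₀] by finitely many doublings, and r M + C ≤ M makes the
bound M stable under each of them. A single asymptotic estimate at ratio 2 thus becomes a bound on a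
whole half-line, which replaces Potter's bounds below. -/
theorem doubling_bound {F : ℝ → ℝ} {r C M t₀ : ℝ} (ht₀ : 0 < t₀) (hr : 0 ≤ r)
    (hrec : ∀ t, t₀ ≤ t → F (2 * t) ≤ r * F t + C) (hM : r * M + C ≤ M)
    (hinit : ∀ t, t₀ ≤ t → t ≤ 2 * t₀ → F t ≤ M) :
    ∀ t, t₀ ≤ t → F t ≤ M := by
  have key : ∀ n : ℕ, ∀ t, t₀ ≤ t → t ≤ 2 ^ (n + 1) * t₀ → F t ≤ M := by
    intro n
    induction n with
    | zero => intro t h1 h2; exact hinit t h1 (by simpa using h2)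
    | succ n ih =>
      intro t h1 h2
      by_cases h3 : t ≤ 2 * t₀
      · exact hinit t h1 h3
      · have h4 : t₀ ≤ t / 2 := by linarith
        have h5 := hrec (t / 2) h4
        have h6 := ih (t / 2) h4 (by rw [pow_succ] at h2; linarith)
        rw [show 2 * (t / 2) = t by ring] at h5
        nlinarith [mul_le_mul_of_nonneg_left h6 hr]
  intro t ht
  obtain ⟨n, hn⟩ := pow_unbounded_of_one_lt (t / t₀) (one_lt_two)
  refine key n t ht ?_
  rw [div_lt_iff₀ ht₀] at hn
  have : (2 : ℝ) ^ n * t₀ ≤ 2 ^ (n + 1) * t₀ := by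
    gcongr <;> norm_num
  linarith

theorem RegVar.eventually_le_mul {g : ℝ → ℝ} {α q c : ℝ} (h : RegVar g α) (hpos : ∀ x, 0 < g x)
    (hq : 0 < q) (hc : q ^ (-α) < c) : ∀ᶠ x in atTop, g (q * x) ≤ c * g x := by
  filter_upwards [(h q hq).eventually (gt_mem_nhds hc)] with x hx
  exact ((div_lt_iff₀ (hpos x)).1 hx).le

theorem RegVar.eventually_mul_le {g : ℝ → ℝ} {α q c : ℝ} (h : RegVar g α) (hpos : ∀ x, 0 < g x)
    (hq : 0 < q) (hc : c < q ^ (-α)) : ∀ᶠ x in atTop, c * g x ≤ g (q * x) := by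
  filter_upwards [(h q hq).eventually (lt_mem_nhds hc)] with x hx
  exact ((lt_div_iff₀ (hpos x)).1 hx).le

theorem exists_pos_forall_ge_of_eventually {p : ℝ → Prop} (h : ∀ᶠ x in atTop, p x) :
    ∃ t₀ : ℝ, 0 < t₀ ∧ ∀ t, t₀ ≤ t → p t := by
  obtain ⟨a, ha⟩ := eventually_atTop.1 h
  exact ⟨max a 1, by positivity, fun t ht => ha t (le_trans (le_max_left _ _) ht)⟩

/-- A regularly varying tail decays faster than any power of smaller order. -/
theorem RegVar.upper_bound {g : ℝ → ℝ} {α p : ℝ} (h : RegVar g α) (hanti : Antitone g)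
    (hnn : ∀ x, 0 ≤ g x) (hp : p < α) (hp0 : 0 ≤ p) :
    ∃ C t₀ : ℝ, 0 < C ∧ 0 < t₀ ∧ ∀ t, t₀ ≤ t → g t ≤ C * t ^ (-p) := by
  have hpos := h.pos hanti hnn
  obtain ⟨t₀, ht₀, hrec⟩ := exists_pos_forall_ge_of_eventually
    (h.eventually_le_mul hpos (q := 2) (c := 2 ^ (-p)) two_pos
      (Real.rpow_lt_rpow_of_exponent_lt one_lt_two (by linarith)))
  -- Since p < α, doubling t multiplies g by at most 2^{-p}, so t^p g(t) does not increase.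
  -- Monotonicity of g bounds it on the initial interval.
  have hb := doubling_bound (F := fun t => t ^ p * g t) (r := 1) (C := 0)
    (M := (2 * t₀) ^ p * g t₀) ht₀ zero_le_one ?_ (by simp) ?_
  · refine ⟨(2 * t₀) ^ p * g t₀, t₀, mul_pos (by positivity) (hpos _), ht₀, fun t ht => ?_⟩
    have ht' : 0 < t := ht₀.trans_le ht
    have h1 : t ^ p * g t ≤ _ := hb t ht
    rw [Real.rpow_neg ht'.le, ← div_eq_mul_inv, le_div_iff₀ (by positivity)]
    linarith
  · intro t ht
    have ht' : 0 < t := ht₀.trans_le ht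
    have h1 := hrec t ht
    have h2 : (2 : ℝ) ^ p * 2 ^ (-p) = 1 := by
      rw [← Real.rpow_add two_pos]; simp
    have h3 : 0 < t ^ p := by positivity
    have h4 : (0 : ℝ) < 2 ^ p := by positivity
    simp only [one_mul, add_zero]
    rw [Real.mul_rpow two_pos.le ht'.le]
    calc 2 ^ p * t ^ p * g (2 * t) ≤ 2 ^ p * t ^ p * (2 ^ (-p) * g t) := by gcongr
      _ = (2 ^ p * 2 ^ (-p)) * (t ^ p * g t) := by ring
      _ = _ := by rw [h2, one_mul]
  · intro t h1 h2
    have : 0 ≤ g t := hnn t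
    have ht' : 0 < t := ht₀.trans_le h1
    exact mul_le_mul (Real.rpow_le_rpow ht'.le h2 hp0) (hanti h1) this (by positivity)

/-- A regularly varying tail decays slower than any power of larger order. -/
theorem RegVar.lower_bound {g : ℝ → ℝ} {α p : ℝ} (h : RegVar g α) (hanti : Antitone g)
    (hnn : ∀ x, 0 ≤ g x) (hp : α < p) (hp0 : 0 ≤ p) :
    ∃ c t₀ : ℝ, 0 < c ∧ 0 < t₀ ∧ ∀ t, t₀ ≤ t → c * t ^ (-p) ≤ g t := by
  have hpos := h.pos hanti hnn
  obtain ⟨t₀, ht₀, hrec⟩ := exists_pos_forall_ge_of_eventually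
    (h.eventually_mul_le hpos (q := 2) (c := 2 ^ (-p)) two_pos
      (Real.rpow_lt_rpow_of_exponent_lt one_lt_two (by linarith)))
  -- The sign turns a lower bound into an upper one: for p > α the function t^p g(t) does not
  -- decrease under doubling.
  have hb := doubling_bound (F := fun t => -(t ^ p * g t)) (r := 1) (C := 0)
    (M := -(t₀ ^ p * g (2 * t₀))) ht₀ zero_le_one ?_ (by simp) ?_
  · refine ⟨t₀ ^ p * g (2 * t₀), t₀, mul_pos (by positivity) (hpos _), ht₀, fun t ht => ?_⟩
    have ht' : 0 < t := ht₀.trans_le ht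
    have h1 : -(t ^ p * g t) ≤ _ := hb t ht
    rw [Real.rpow_neg ht'.le, ← div_eq_mul_inv, div_le_iff₀ (by positivity)]
    linarith
  · intro t ht
    have ht' : 0 < t := ht₀.trans_le ht
    have h1 := hrec t ht
    have h2 : (2 : ℝ) ^ p * 2 ^ (-p) = 1 := by
      rw [← Real.rpow_add two_pos]; simp
    have h3 : 0 < t ^ p := by positivity
    have h4 : (0 : ℝ) < 2 ^ p := by positivity
    simp only [one_mul, add_zero, neg_le_neg_iff]
    rw [Real.mul_rpow two_pos.le ht'.le]
    calc t ^ p * g t = (2 ^ p * 2 ^ (-p)) * (t ^ p * g t) := by rw [h2, one_mul]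
      _ = 2 ^ p * t ^ p * (2 ^ (-p) * g t) := by ring
      _ ≤ 2 ^ p * t ^ p * g (2 * t) := by gcongr
  · intro t h1 h2
    have ht' : 0 < t := ht₀.trans_le h1
    rw [neg_le_neg_iff]
    exact mul_le_mul (Real.rpow_le_rpow ht₀.le h1 hp0) (hanti h2) (hnn _) (by positivity)

/-- A power of larger order is negligible with respect to a regularly varying tail. -/
theorem RegVar.tendsto_rpow_div {g : ℝ → ℝ} {α p : ℝ} (h : RegVar g α) (hanti : Antitone g)
    (hnn : ∀ x, 0 ≤ g x) (hα : 0 ≤ α) (hp : α < p) :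
    Tendsto (fun x => x ^ (-p) / g x) atTop (𝓝 0) := by
  obtain ⟨c, t₀, hc, ht₀, hb⟩ := h.lower_bound hanti hnn (p := (α + p) / 2) (by linarith)
    (by linarith)
  have hlim : Tendsto (fun x : ℝ => c⁻¹ * x ^ (-((p - α) / 2))) atTop (𝓝 0) := by
    simpa using (tendsto_rpow_neg_atTop (y := (p - α) / 2) (by linarith)).const_mul c⁻¹
  refine tendsto_of_tendsto_of_tendsto_of_le_of_le' tendsto_const_nhds hlim ?_ ?_
  · filter_upwards [eventually_gt_atTop 0] with x hx
    exact div_nonneg (by positivity) (hnn _)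
  · filter_upwards [eventually_ge_atTop t₀] with x hx
    have hx0 : 0 < x := ht₀.trans_le hx
    rw [div_le_iff₀ (h.pos hanti hnn x)]
    calc x ^ (-p) = c⁻¹ * x ^ (-((p - α) / 2)) * (c * x ^ (-((α + p) / 2))) := by
          rw [show c⁻¹ * x ^ (-((p - α) / 2)) * (c * x ^ (-((α + p) / 2))) =
            (c⁻¹ * c) * (x ^ (-((p - α) / 2)) * x ^ (-((α + p) / 2))) by ring,
            inv_mul_cancel₀ hc.ne', one_mul, ← Real.rpow_add hx0]
          congr 1; ring
      _ ≤ _ := by gcongr; exact hb x hx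

/-- Truncated moment of order three, in terms of the tail. -/
theorem RegVar.truncated_bound {g m : ℝ → ℝ} {α : ℝ} (h : RegVar g α) (hanti : Antitone g)
    (hnn : ∀ x, 0 ≤ g x) (hα : α < 2) (hm0 : ∀ t, 0 ≤ m t) (hm : ∀ t, 0 < t → m t ≤ t ^ 3)
    (hrec : ∀ t, 0 < t → m (2 * t) ≤ m t + 8 * t ^ 3 * g t) :
    ∃ C t₀ : ℝ, 0 < C ∧ 0 < t₀ ∧ ∀ t, t₀ ≤ t → m t ≤ C * (t ^ 3 * g t) := by
  have hpos := h.pos hanti hnn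
  -- The constant 1/4 = 2⁻² is below 2^{-α} because α < 2. It makes t³ g(t) at least double when t
  -- doubles.
  obtain ⟨t₀, ht₀, hrec'⟩ := exists_pos_forall_ge_of_eventually
    (h.eventually_mul_le hpos (q := 2) (c := 4⁻¹) two_pos (by
      rw [show (4⁻¹ : ℝ) = 2 ^ (-2 : ℝ) by rw [Real.rpow_neg two_pos.le]; norm_num]
      exact Real.rpow_lt_rpow_of_exponent_lt one_lt_two (by linarith)))
  -- Dividing m(2t) ≤ m(t) + 8t³g(t) by 2t³g(t) halves the old ratio and adds 4. The fixed point of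
  -- this map is 8, and 1/g(2t₀) covers the initial interval.
  have hb := doubling_bound (F := fun t => m t / (t ^ 3 * g t)) (r := 2⁻¹) (C := 4)
    (M := max (1 / g (2 * t₀)) 8) ht₀ (by norm_num) ?_ ?_ ?_
  · refine ⟨max (1 / g (2 * t₀)) 8, t₀, by positivity, ht₀, fun t ht => ?_⟩
    have ht' : 0 < t := ht₀.trans_le ht
    exact (div_le_iff₀ (mul_pos (by positivity) (hpos t))).1 (hb t ht)
  · intro t ht
    have ht' : 0 < t := ht₀.trans_le ht
    have h1 := hrec t ht'
    have h2 := hrec' t ht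
    have hg := hpos t
    have hg2 := hpos (2 * t)
    have h3 : 0 < t ^ 3 := by positivity
    rw [div_le_iff₀ (mul_pos (by positivity) hg2)]
    calc m (2 * t) ≤ (m t + 8 * t ^ 3 * g t) := h1
      _ = (2⁻¹ * (m t / (t ^ 3 * g t)) + 4) * (2 * t ^ 3 * g t) := by
        field_simp
        ring
      _ ≤ (2⁻¹ * (m t / (t ^ 3 * g t)) + 4) * ((2 * t) ^ 3 * g (2 * t)) := by
        refine mul_le_mul_of_nonneg_left (by nlinarith) ?_
        have := hm0 t
        positivity
  · have := le_max_right (1 / g (2 * t₀)) 8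
    linarith
  · intro t h1 h2
    have ht' : 0 < t := ht₀.trans_le h1
    refine le_trans ?_ (le_max_left _ _)
    rw [div_le_div_iff₀ (mul_pos (by positivity) (hpos t)) (hpos _)]
    have := hm t ht'
    have h3 : 0 < t ^ 3 := by positivity
    have := hanti h2
    have := hpos (2 * t₀)
    have := hpos t
    nlinarith

/-- Tail of the solution of a distributional fixed point equation `X = m X + B + N`, in which `N`
is negligible. -/
theorem tendsto_tail_ratio {g b : ℝ → ℝ} {e : ℝ → ℝ → ℝ} {α m : ℝ} (h : RegVar b α)
    (hanti : Antitone b) (hnn : ∀ x, 0 ≤ b x) (hα : 0 < α) (hm0 : 0 < m) (hm1 : m < 1)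
    (hg : Tendsto g atTop (𝓝 0)) (hg0 : ∀ x, 0 ≤ g x)
    (he : ∀ ε, 0 < ε → Tendsto (fun x => e ε x / b x) atTop (𝓝 0))
    (hup : ∀ ε, 0 < ε → ε < 1 → ∀ x, 0 < x →
      g x ≤ g ((1 - ε) / m * x) + b ((1 - ε) * x) + e ε x)
    (hlow : ∀ ε, 0 < ε → ∀ x, 0 < x →
      g ((1 + ε) / m * x) + b ((1 + ε) * x) - e ε x ≤ g x) :
    Tendsto (fun x => g x / b x) atTop (𝓝 (1 / (1 - m ^ α))) := by
  have hpos := h.pos hanti hnn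
  have hmα : m ^ α < 1 := Real.rpow_lt_one hm0.le hm1 hα
  have hmα0 : 0 < m ^ α := Real.rpow_pos_of_pos hm0 _
  have hminv : (1 / m) ^ (-α) = m ^ α := by
    rw [Real.rpow_neg (by positivity), ← Real.inv_rpow (by positivity)]; simp
  rw [tendsto_order]
  constructor
  · intro K hK
    -- The quotient is the sum of the geometric series produced by iterating the lower inequality.
    -- As ε → 0 it tends to the claimed constant, because (1/m)^{-α} = m^α; hence some ε > 0 already
    -- gives more than K.
    have hcont : Tendsto (fun ε : ℝ => ((1 + ε) ^ (-α) - ε) / (1 - (((1 + ε) / m) ^ (-α) - ε)))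
        (𝓝 0) (𝓝 (1 / (1 - m ^ α))) := by
      have : ContinuousAt
          (fun ε : ℝ => ((1 + ε) ^ (-α) - ε) / (1 - (((1 + ε) / m) ^ (-α) - ε))) 0 := by
        refine ContinuousAt.div (ContinuousAt.sub (ContinuousAt.rpow_const (by fun_prop) (by simp))
          (by fun_prop)) (ContinuousAt.sub (by fun_prop) (ContinuousAt.sub
            (ContinuousAt.rpow_const (by fun_prop) (by left; simp; positivity)) (by fun_prop))) ?_
        simp only [add_zero, sub_zero, hminv]
        linarith
      have h2 := this.tendsto
      simpa only [add_zero, sub_zero, hminv, Real.one_rpow] using h2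
    have hr0 : ∀ᶠ ε in 𝓝 (0 : ℝ), 0 < ((1 + ε) / m) ^ (-α) - ε ∧ ((1 + ε) / m) ^ (-α) - ε < 1 := by
      have : ContinuousAt (fun ε : ℝ => ((1 + ε) / m) ^ (-α) - ε) 0 :=
        ContinuousAt.sub (ContinuousAt.rpow_const (by fun_prop) (by left; simp; positivity))
          (by fun_prop)
      have h2 := this.tendsto
      simp only [add_zero, sub_zero, hminv] at h2
      exact (h2.eventually (lt_mem_nhds hmα0)).and (h2.eventually (gt_mem_nhds hmα))
    obtain ⟨ε, ⟨hε1, hr0, hr1⟩, hε0⟩ := (((hcont.eventually (lt_mem_nhds hK)).and hr0).filter_mono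
      nhdsWithin_le_nhds |>.and (self_mem_nhdsWithin (s := Set.Ioi (0 : ℝ)))).exists
    have hε0 : 0 < ε := hε0
    set q := (1 + ε) / m with hq
    set r := q ^ (-α) - ε with hr
    set c := (1 + ε) ^ (-α) - ε with hc
    have hq1 : 1 < q := by rw [hq, lt_div_iff₀ hm0]; linarith
    obtain ⟨x₀, hx₀, hx⟩ := exists_pos_forall_ge_of_eventually
      ((h.eventually_mul_le hpos (q := q) (c := r) (by linarith) (by linarith)).and
        ((h.eventually_mul_le hpos (q := 1 + ε) (c := c + ε / 2) (by linarith) (by linarith)).and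
          ((he ε hε0).eventually (gt_mem_nhds (half_pos hε0)))))
    have step : ∀ x, x₀ ≤ x → g (q * x) + c * b x ≤ g x := by
      intro x hxx
      obtain ⟨_, h2, h3⟩ := hx x hxx
      rw [div_lt_iff₀ (hpos x)] at h3
      have := hlow ε hε0 x (hx₀.trans_le hxx)
      linarith
    -- Each step replaces g(qx) by its own lower bound and b(qx) by r b(x), which requires a
    -- nonnegative coefficient. If c < 0, the target K is negative and nonnegativity of g suffices.
    have iter : ∀ n : ℕ, ∀ x, x₀ ≤ x → c * (∑ i ∈ Finset.range n, r ^ i) * b x ≤ g x ∨ c < 0 := by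
      intro n
      induction n with
      | zero => intro x _; left; simpa using hg0 x
      | succ n ih =>
        intro x hxx
        by_cases hc0 : c < 0
        · right; exact hc0
        left
        push Not at hc0
        have hqx : x₀ ≤ q * x := by nlinarith
        have h1 := (ih (q * x) hqx).resolve_right (by linarith)
        have h2 := step x hxx
        have h3 := (hx x hxx).1
        rw [Finset.sum_range_succ', pow_zero]
        have h4 : ∑ i ∈ Finset.range n, r ^ (i + 1) = r * ∑ i ∈ Finset.range n, r ^ i := by
          rw [Finset.mul_sum]; exact Finset.sum_congr rfl fun i _ => by ring
        rw [h4]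
        have h5 : 0 ≤ c * ∑ i ∈ Finset.range n, r ^ i :=
          mul_nonneg hc0 (Finset.sum_nonneg fun i _ => by positivity)
        nlinarith [mul_le_mul_of_nonneg_left h3 h5]
    filter_upwards [eventually_ge_atTop x₀] with x hxx
    refine hε1.trans_le ?_
    rw [le_div_iff₀ (hpos x)]
    by_cases hc0 : c < 0
    · have : c / (1 - r) ≤ 0 := div_nonpos_of_nonpos_of_nonneg hc0.le (by linarith)
      nlinarith [hg0 x, hpos x]
    · have hlim : Tendsto (fun n : ℕ => c * (∑ i ∈ Finset.range n, r ^ i) * b x) atTop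
          (𝓝 (c * (1 - r)⁻¹ * b x)) :=
        ((hasSum_geometric_of_lt_one hr0.le hr1).tendsto_sum_nat.const_mul c).mul_const _
      rw [div_eq_mul_inv]
      exact le_of_tendsto' hlim fun n => (iter n x hxx).resolve_right hc0
  · intro K hK
    have hcont : Tendsto (fun ε : ℝ => ((1 - ε) ^ (-α) + ε) / (1 - (((1 - ε) / m) ^ (-α) + ε)))
        (𝓝 0) (𝓝 (1 / (1 - m ^ α))) := by
      have : ContinuousAt
          (fun ε : ℝ => ((1 - ε) ^ (-α) + ε) / (1 - (((1 - ε) / m) ^ (-α) + ε))) 0 := by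
        refine ContinuousAt.div (ContinuousAt.add (ContinuousAt.rpow_const (by fun_prop) (by simp))
          (by fun_prop)) (ContinuousAt.sub (by fun_prop) (ContinuousAt.add
            (ContinuousAt.rpow_const (by fun_prop) (by left; simp; positivity)) (by fun_prop))) ?_
        simp only [add_zero, sub_zero, hminv]
        linarith
      have h2 := this.tendsto
      simpa only [add_zero, sub_zero, hminv, Real.one_rpow] using h2
    have hr0 : ∀ᶠ ε in 𝓝 (0 : ℝ), 0 < ((1 - ε) / m) ^ (-α) + ε ∧ ((1 - ε) / m) ^ (-α) + ε < 1 := by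
      have : ContinuousAt (fun ε : ℝ => ((1 - ε) / m) ^ (-α) + ε) 0 :=
        ContinuousAt.add (ContinuousAt.rpow_const (by fun_prop) (by left; simp; positivity))
          (by fun_prop)
      have h2 := this.tendsto
      simp only [add_zero, sub_zero, hminv] at h2
      exact (h2.eventually (lt_mem_nhds hmα0)).and (h2.eventually (gt_mem_nhds hmα))
    -- This keeps (1 - ε)/m > 1, so the iterated argument escapes to infinity.
    have hεm : ∀ᶠ ε in 𝓝 (0 : ℝ), ε < 1 - m := gt_mem_nhds (by linarith)
    obtain ⟨ε, ⟨⟨hε1, hr0, hr1⟩, hεm⟩, hε0⟩ :=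
      ((((hcont.eventually (gt_mem_nhds hK)).and hr0).and hεm).filter_mono
      nhdsWithin_le_nhds |>.and (self_mem_nhdsWithin (s := Set.Ioi (0 : ℝ)))).exists
    have hε0 : 0 < ε := hε0
    set q := (1 - ε) / m with hq
    set r := q ^ (-α) + ε with hr
    set c := (1 - ε) ^ (-α) + ε with hc
    have hq1 : 1 < q := by rw [hq, lt_div_iff₀ hm0]; linarith
    have hc0 : 0 < c := by
      have : 0 < (1 - ε) ^ (-α) := Real.rpow_pos_of_pos (by linarith) _
      linarith
    obtain ⟨x₀, hx₀, hx⟩ := exists_pos_forall_ge_of_eventually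
      ((h.eventually_le_mul hpos (q := q) (c := r) (by linarith) (by linarith)).and
        ((h.eventually_le_mul hpos (q := 1 - ε) (c := c - ε / 2) (by linarith) (by linarith)).and
          ((he ε hε0).eventually (gt_mem_nhds (half_pos hε0)))))
    have step : ∀ x, x₀ ≤ x → g x ≤ g (q * x) + c * b x := by
      intro x hxx
      obtain ⟨_, h2, h3⟩ := hx x hxx
      rw [div_lt_iff₀ (hpos x)] at h3
      have := hup ε hε0 (by linarith) x (hx₀.trans_le hxx)
      linarith
    -- The constant c/(1 - r) is a fixed point of a ↦ r a + c, so no partial sums are needed. The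
    -- remaining term g(qⁿx) vanishes as n → ∞.
    have iter : ∀ n : ℕ, ∀ x, x₀ ≤ x → g x ≤ g (q ^ n * x) + c * (1 - r)⁻¹ * b x := by
      intro n
      induction n with
      | zero =>
        intro x _
        have : 0 < c * (1 - r)⁻¹ * b x :=
          mul_pos (mul_pos hc0 (inv_pos.2 (by linarith))) (hpos x)
        simp only [pow_zero, one_mul]; linarith
      | succ n ih =>
        intro x hxx
        have hqx : x₀ ≤ q * x := by nlinarith
        have h1 := ih (q * x) hqx
        have h2 := step x hxx
        have h3 := (hx x hxx).1
        have h5 : 0 ≤ c * (1 - r)⁻¹ := mul_nonneg hc0.le (inv_nonneg.2 (by linarith))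
        have h6 : c * (1 - r)⁻¹ * r + c = c * (1 - r)⁻¹ := by
          have : 1 - r ≠ 0 := by linarith
          field_simp; ring
        have h7 := mul_le_mul_of_nonneg_left h3 h5
        have h8 : c * (1 - r)⁻¹ * (r * b x) + c * b x = c * (1 - r)⁻¹ * b x := by
          linear_combination b x * h6
        rw [pow_succ, mul_assoc]
        linarith
    filter_upwards [eventually_ge_atTop x₀] with x hxx
    refine lt_of_le_of_lt ?_ hε1
    rw [div_le_iff₀ (hpos x)]
    have hx0 : 0 < x := hx₀.trans_le hxx
    have hlim : Tendsto (fun n : ℕ => g (q ^ n * x) + c * (1 - r)⁻¹ * b x) atTop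
        (𝓝 (0 + c * (1 - r)⁻¹ * b x)) := by
      refine Tendsto.add_const _ (hg.comp ?_)
      exact (tendsto_pow_atTop_atTop_of_one_lt hq1).atTop_mul_const hx0
    rw [zero_add] at hlim
    rw [div_eq_mul_inv]
    exact ge_of_tendsto' hlim fun n => iter n x hxx

theorem RegVar.of_tendsto_ratio {g b : ℝ → ℝ} {α c : ℝ} (h : RegVar b α) (hb : ∀ x, 0 < b x)
    (hc : 0 < c) (hg : Tendsto (fun x => g x / b x) atTop (𝓝 c)) : RegVar g α := by
  intro q hq
  have h1 : Tendsto (fun x => g (q * x) / b (q * x)) atTop (𝓝 c) :=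
    hg.comp (tendsto_id.const_mul_atTop hq)
  have h2 := (h1.mul (h q hq)).div hg hc.ne'
  rw [mul_comm, mul_div_assoc, div_self hc.ne', mul_one] at h2
  refine h2.congr fun x => ?_
  have h3 := (hb x).ne'
  have h4 := (hb (q * x)).ne'
  simp only [Pi.div_apply]
  rw [div_mul_div_cancel₀ h4, div_div_div_cancel_right₀ h3]

/-! ### Integration over independent variables -/

/-- Tonelli on the product law takes the place of conditioning: U is frozen at its value while W is
integrated on its own. Working with `∫⁻` spares all integrability questions. -/
theorem lintegral_of_indepFun {Ω α β : Type*} [MeasurableSpace Ω] [MeasurableSpace α]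
    [MeasurableSpace β] {P : Measure Ω} [IsProbabilityMeasure P] {U : Ω → α} {W : Ω → β}
    (h : IndepFun U W P) (hU : Measurable U) (hW : Measurable W) {F : α × β → ℝ≥0∞}
    (hF : Measurable F) :
    ∫⁻ ω, F (U ω, W ω) ∂P = ∫⁻ ω, ∫⁻ ω', F (U ω, W ω') ∂P ∂P := by
  have h1 := (indepFun_iff_map_prod_eq_prod_map_map hU.aemeasurable hW.aemeasurable).1 h
  calc ∫⁻ ω, F (U ω, W ω) ∂P = ∫⁻ p, F p ∂(P.map fun ω => (U ω, W ω)) := by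
        rw [lintegral_map hF (hU.prodMk hW)]
    _ = ∫⁻ u, ∫⁻ w, F (u, w) ∂(P.map W) ∂(P.map U) := by
        rw [h1, lintegral_prod _ hF.aemeasurable]
    _ = ∫⁻ ω, ∫⁻ w, F (U ω, w) ∂(P.map W) ∂P := by
        rw [lintegral_map hF.lintegral_prod_right' hU]
    _ = _ := by
        refine lintegral_congr fun ω => ?_
        rw [lintegral_map (by fun_prop) hW]

/-! ### Random sums -/

theorem measurable_sum_range {Ω : Type*} [MeasurableSpace Ω] {β : Type*} [AddCommMonoid β]
    [MeasurableSpace β] [MeasurableAdd₂ β] {a : ℕ → Ω → β} {N : Ω → ℕ} (ha : ∀ j, Measurable (a j))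
    (hN : Measurable N) : Measurable fun ω => ∑ j ∈ Finset.range (N ω), a j ω := by
  have : Measurable fun p : ℕ × Ω => ∑ j ∈ Finset.range p.1, a j p.2 :=
    measurable_from_prod_countable_right fun n => by
      simpa using Finset.measurable_fun_sum (Finset.range n) fun j _ => ha j
  exact this.comp (hN.prodMk measurable_id)

theorem measurable_sum_Ico_eval {β : Type*} [AddCommMonoid β]
    [MeasurableSpace β] [MeasurableAdd₂ β] {f : ℕ → β} :
    Measurable fun p : (ℕ × ℕ) × (ℕ → ℕ) => ∑ j ∈ Finset.Ico p.1.1 p.1.2, f (p.2 j) :=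
  measurable_from_prod_countable_right fun n => by
    refine Finset.measurable_fun_sum (Finset.Ico n.1 n.2) fun j _ => ?_
    exact (measurable_of_countable f).comp (measurable_pi_apply j)

/-- A sequence of i.i.d. square integrable counts, with mean `m` and variance `v`. -/
structure IsIIDCounts {Ω : Type*} [MeasurableSpace Ω] (P : Measure Ω) (a : ℕ → Ω → ℕ)
    (m v : ℝ) : Prop where
  measurable : ∀ j, Measurable (a j)
  indep : iIndepFun a P
  identDistrib : ∀ j, IdentDistrib (a j) (a 0) P P
  memLp : ∀ j, MemLp (fun ω => (a j ω : ℝ)) 2 P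
  mean : ∀ j, ∫ ω, (a j ω : ℝ) ∂P = m
  var : ∀ j, variance (fun ω => (a j ω : ℝ)) P = v

section IIDCounts

variable {Ω : Type*} [MeasurableSpace Ω] {P : Measure Ω} [IsProbabilityMeasure P]
  {a : ℕ → Ω → ℕ} {m v : ℝ}

theorem IsIIDCounts.measurable_seq (h : IsIIDCounts P a m v) : Measurable fun ω j => a j ω :=
  measurable_pi_lambda _ h.measurable

theorem IsIIDCounts.lintegral_eq (h : IsIIDCounts P a m v) (j : ℕ) :
    ∫⁻ ω, (a j ω : ℝ≥0∞) ∂P = ENNReal.ofReal m := by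
  rw [← h.mean j, ofReal_integral_eq_lintegral_ofReal ((h.memLp j).integrable (by norm_num))
    (Eventually.of_forall fun ω => Nat.cast_nonneg _)]
  simp

/-- Intervals `Ico n₁ n₂` rather than initial segments are used because the later estimates compare
two sums over the same row. Only the summands between the two lengths survive. -/
theorem IsIIDCounts.lintegral_sum_Ico (h : IsIIDCounts P a m v) (n₁ n₂ : ℕ) :
    ∫⁻ ω, (∑ j ∈ Finset.Ico n₁ n₂, (a j ω : ℝ≥0∞)) ∂P = ((n₂ - n₁ : ℕ) : ℝ≥0∞) * ENNReal.ofReal m := by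
  rw [lintegral_finsetSum]
  · simp [h.lintegral_eq]
  · intro j _
    exact (measurable_of_countable (fun n : ℕ => (n : ℝ≥0∞))).comp (h.measurable j)

theorem IsIIDCounts.lintegral_sq_sum_Ico (h : IsIIDCounts P a m v) (n₁ n₂ : ℕ) :
    ∫⁻ ω, ENNReal.ofReal ((∑ j ∈ Finset.Ico n₁ n₂, ((a j ω : ℝ) - m)) ^ 2) ∂P =
      ((n₂ - n₁ : ℕ) : ℝ≥0∞) * ENNReal.ofReal v := by
  have hL : ∀ j, MemLp (fun ω => (a j ω : ℝ) - m) 2 P := fun j => (h.memLp j).sub (memLp_const m)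
  have hmean : ∀ j, ∫ ω, ((a j ω : ℝ) - m) ∂P = 0 := fun j => by
    rw [integral_sub ((h.memLp j).integrable (by norm_num)) (integrable_const _), h.mean j]
    simp
  have hvar : variance (∑ j ∈ Finset.Ico n₁ n₂, fun ω => ((a j ω : ℝ) - m)) P =
      ((n₂ - n₁ : ℕ) : ℝ) * v := by
    rw [IndepFun.variance_sum (fun j _ => hL j)]
    · rw [Finset.sum_congr rfl (g := fun _ => v)]
      · simp
      · intro j _
        have := variance_sub_const (X := fun ω => (a j ω : ℝ))
          (((h.memLp j).aestronglyMeasurable)) m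
        rw [this, h.var j]
    · intro i _ j _ hij
      exact (h.indep.indepFun hij).comp (φ := fun n : ℕ => (n : ℝ) - m)
        (ψ := fun n : ℕ => (n : ℝ) - m) (measurable_of_countable _) (measurable_of_countable _)
  have hint : ∫ ω, (∑ j ∈ Finset.Ico n₁ n₂, fun ω => ((a j ω : ℝ) - m)) ω ∂P = 0 := by
    simp only [Finset.sum_apply]
    rw [integral_finsetSum _ fun j _ => (hL j).integrable (by norm_num)]
    simp [hmean]
  have hS : MemLp (∑ j ∈ Finset.Ico n₁ n₂, fun ω => ((a j ω : ℝ) - m)) 2 P :=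
    memLp_finsetSum' _ fun j _ => hL j
  rw [variance_of_integral_eq_zero hS.aemeasurable hint] at hvar
  have h3 : ∫ ω, (∑ j ∈ Finset.Ico n₁ n₂, ((a j ω : ℝ) - m)) ^ 2 ∂P = ((n₂ - n₁ : ℕ) : ℝ) * v := by
    simpa using hvar
  rw [← ofReal_integral_eq_lintegral_ofReal, h3, ENNReal.ofReal_mul (by positivity),
    ENNReal.ofReal_natCast]
  · simpa using hS.integrable_sq
  · exact Eventually.of_forall fun ω => sq_nonneg _

/-- Wald's identity for the first moment. -/
theorem IsIIDCounts.lintegral_random_sum (h : IsIIDCounts P a m v) {N₁ N₂ : Ω → ℕ}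
    (h₁ : Measurable N₁) (h₂ : Measurable N₂)
    (hi : IndepFun (fun ω => (N₁ ω, N₂ ω)) (fun ω j => a j ω) P) :
    ∫⁻ ω, (∑ j ∈ Finset.Ico (N₁ ω) (N₂ ω), (a j ω : ℝ≥0∞)) ∂P =
      (∫⁻ ω, ((N₂ ω - N₁ ω : ℕ) : ℝ≥0∞) ∂P) * ENNReal.ofReal m := by
  rw [lintegral_of_indepFun hi (h₁.prodMk h₂) h.measurable_seq
    (F := fun p => ∑ j ∈ Finset.Ico p.1.1 p.1.2, (p.2 j : ℝ≥0∞)) measurable_sum_Ico_eval]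
  simp only [h.lintegral_sum_Ico]
  rw [lintegral_mul_const]
  exact (measurable_of_countable (fun p : ℕ × ℕ => ((p.2 - p.1 : ℕ) : ℝ≥0∞))).comp (h₁.prodMk h₂)

/-- Wald's identity for the second moment. -/
theorem IsIIDCounts.lintegral_sq_random_sum (h : IsIIDCounts P a m v) {N₁ N₂ : Ω → ℕ}
    (h₁ : Measurable N₁) (h₂ : Measurable N₂)
    (hi : IndepFun (fun ω => (N₁ ω, N₂ ω)) (fun ω j => a j ω) P) :
    ∫⁻ ω, ENNReal.ofReal ((∑ j ∈ Finset.Ico (N₁ ω) (N₂ ω), ((a j ω : ℝ) - m)) ^ 2) ∂P =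
      (∫⁻ ω, ((N₂ ω - N₁ ω : ℕ) : ℝ≥0∞) ∂P) * ENNReal.ofReal v := by
  rw [lintegral_of_indepFun hi (h₁.prodMk h₂) h.measurable_seq
    (F := fun p => ENNReal.ofReal ((∑ j ∈ Finset.Ico p.1.1 p.1.2, ((p.2 j : ℝ) - m)) ^ 2))
    ((measurable_sum_Ico_eval (f := fun n : ℕ => (n : ℝ) - m)).pow_const 2).ennreal_ofReal]
  simp only [h.lintegral_sq_sum_Ico]
  rw [lintegral_mul_const]
  exact (measurable_of_countable (fun p : ℕ × ℕ => ((p.2 - p.1 : ℕ) : ℝ≥0∞))).comp (h₁.prodMk h₂)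

end IIDCounts

/-! ### Galton–Watson paths -/

/-- The Galton–Watson path with offspring numbers `a` and immigration numbers `b` that starts at
time `s` with `n` individuals, after `k` generations. -/
def gwPath (a : ℤ → ℕ → ℕ) (b : ℤ → ℕ) (s : ℤ) (n : ℕ) : ℕ → ℕ
  | 0 => n
  | k + 1 => ∑ j ∈ Finset.range (gwPath a b s n k), a (s + k + 1) j + b (s + k + 1)

/-- All starting sizes use the same offspring variables, so a smaller path is embedded in a larger
one. Coalescence then becomes a first-moment estimate for a difference of natural numbers. -/
theorem gwPath_mono (a : ℤ → ℕ → ℕ) (b : ℤ → ℕ) (s : ℤ) {n n' : ℕ} (h : n ≤ n') (k : ℕ) :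
    gwPath a b s n k ≤ gwPath a b s n' k := by
  induction k with
  | zero => exact h
  | succ k ih =>
    simp only [gwPath]
    gcongr

theorem measurable_gwPath {Ω : Type*} [MeasurableSpace Ω] {A : ℤ → ℕ → Ω → ℕ} {B : ℤ → Ω → ℕ}
    {s : ℤ} {n : Ω → ℕ} (hn : Measurable n) {k : ℕ}
    (hA : ∀ i j, s < i → i ≤ s + k → Measurable (A i j))
    (hB : ∀ i, s < i → i ≤ s + k → Measurable (B i)) :
    Measurable fun ω => gwPath (fun i j => A i j ω) (fun i => B i ω) s (n ω) k := by
  induction k with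
  | zero => exact hn
  | succ k ih =>
    simp only [gwPath]
    push_cast at hA hB
    exact (measurable_sum_range (fun j => hA _ j (by omega) (by omega))
      (ih (fun i j h1 h2 => hA i j h1 (by omega)) fun i h1 h2 => hB i h1 (by omega))).add
        (hB _ (by omega) (by omega))

/-- The information carried by the offspring and immigration numbers whose time satisfies `p`. -/
def envSigma {Ω : Type*} (A : ℤ → ℕ → Ω → ℕ) (B : ℤ → Ω → ℕ) (p : ℤ → Prop) : MeasurableSpace Ω :=
  ⨆ i ∈ {i : (ℤ × ℕ) ⊕ ℤ | p (Sum.elim Prod.fst id i)},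
    (inferInstance : MeasurableSpace ℕ).comap (Sum.elim (fun p : ℤ × ℕ => A p.1 p.2) B i)

theorem measurable_envSigma_left {Ω : Type*} {A : ℤ → ℕ → Ω → ℕ} {B : ℤ → Ω → ℕ} {p : ℤ → Prop}
    {i : ℤ} (hi : p i) (j : ℕ) : Measurable[envSigma A B p] (A i j) := by
  have h : (inferInstance : MeasurableSpace ℕ).comap (A i j) ≤ envSigma A B p :=
    le_iSup₂_of_le (f := fun (i : (ℤ × ℕ) ⊕ ℤ)
      (_ : i ∈ {i : (ℤ × ℕ) ⊕ ℤ | p (Sum.elim Prod.fst id i)}) =>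
      (inferInstance : MeasurableSpace ℕ).comap (Sum.elim (fun p : ℤ × ℕ => A p.1 p.2) B i))
      (Sum.inl (i, j)) hi le_rfl
  exact fun t ht => h _ ⟨t, ht, rfl⟩

theorem measurable_envSigma_right {Ω : Type*} {A : ℤ → ℕ → Ω → ℕ} {B : ℤ → Ω → ℕ} {p : ℤ → Prop}
    {i : ℤ} (hi : p i) : Measurable[envSigma A B p] (B i) := by
  have h : (inferInstance : MeasurableSpace ℕ).comap (B i) ≤ envSigma A B p :=
    le_iSup₂_of_le (f := fun (i : (ℤ × ℕ) ⊕ ℤ)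
      (_ : i ∈ {i : (ℤ × ℕ) ⊕ ℤ | p (Sum.elim Prod.fst id i)}) =>
      (inferInstance : MeasurableSpace ℕ).comap (Sum.elim (fun p : ℤ × ℕ => A p.1 p.2) B i))
      (Sum.inr i) hi le_rfl
  exact fun t ht => h _ ⟨t, ht, rfl⟩

theorem measurable_gwPath_envSigma {Ω : Type*} {A : ℤ → ℕ → Ω → ℕ} {B : ℤ → Ω → ℕ} (s : ℤ) (n : ℕ)
    (k : ℕ) : Measurable[envSigma A B (· ≤ s + k)]
      fun ω => gwPath (fun i j => A i j ω) (fun i => B i ω) s n k := by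
  let σ : MeasurableSpace Ω := envSigma A B (· ≤ s + k)
  have hn : Measurable fun _ : Ω => n := measurable_const
  have hA : ∀ i j, s < i → i ≤ s + k → Measurable (A i j) := fun i j _ h =>
    measurable_envSigma_left (p := (· ≤ s + k)) h j
  have hB : ∀ i, s < i → i ≤ s + k → Measurable (B i) := fun i _ h =>
    measurable_envSigma_right (p := (· ≤ s + k)) h
  exact measurable_gwPath (n := fun _ => n) hn hA hB

theorem measurable_offspring_envSigma {Ω : Type*} {A : ℤ → ℕ → Ω → ℕ} {B : ℤ → Ω → ℕ} (i : ℤ) :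
    Measurable[envSigma A B (i ≤ ·)] fun ω j => A i j ω := by
  let σ : MeasurableSpace Ω := envSigma A B (i ≤ ·)
  exact measurable_pi_lambda _ fun j => measurable_envSigma_left (p := (i ≤ ·)) le_rfl j

section Stationary

variable {Ω : Type*} [MeasurableSpace Ω] {P : Measure Ω} [IsProbabilityMeasure P]
    {A : ℤ → ℕ → Ω → ℕ} {B : ℤ → Ω → ℕ} {X : ℤ → Ω → ℕ}

theorem IsStationaryGWI.envSigma_le (hX : IsStationaryGWI P A B X) (p : ℤ → Prop) :
    envSigma A B p ≤ ‹MeasurableSpace Ω› := by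
  refine iSup₂_le fun i _ => ?_
  rintro _ ⟨t, ht, rfl⟩
  rcases i with ⟨i, j⟩ | i
  · exact hX.measurable_A i j ht
  · exact hX.measurable_B i ht

theorem IsStationaryGWI.indep_envSigma (hX : IsStationaryGWI P A B X) {p q : ℤ → Prop}
    (hpq : ∀ i, p i → ¬ q i) : Indep (envSigma A B p) (envSigma A B q) P := by
  refine indep_iSup_of_disjoint ?_ hX.indep.iIndep ?_
  · rintro i _ ⟨t, ht, rfl⟩
    rcases i with ⟨i, j⟩ | i
    · exact hX.measurable_A i j ht
    · exact hX.measurable_B i ht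
  · exact Set.disjoint_left.2 fun i hi hi' => hpq _ hi hi'

theorem IsStationaryGWI.indepFun_of_envSigma (hX : IsStationaryGWI P A B X) {p q : ℤ → Prop}
    (hpq : ∀ i, p i → ¬ q i) {α β : Type*} [MeasurableSpace α] [MeasurableSpace β] {U : Ω → α}
    {W : Ω → β} (hU : Measurable[envSigma A B p] U) (hW : Measurable[envSigma A B q] W) :
    IndepFun U W P :=
  indep_of_indep_of_le_left (indep_of_indep_of_le_right (hX.indep_envSigma hpq) hW.comap_le)
    hU.comap_le

theorem IsStationaryGWI.isIIDCounts (hX : IsStationaryGWI P A B X)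
    (hA : MemLp (fun ω => (A 0 0 ω : ℝ)) 2 P) (i : ℤ) :
    IsIIDCounts P (A i) (offspringMean P A) (offspringVar P A) where
  measurable := hX.measurable_A i
  indep := hX.indep.precomp (g := fun j : ℕ => Sum.inl (i, j)) fun j j' h => by simpa using h
  identDistrib j := (hX.identDistrib_A i j).trans (hX.identDistrib_A i 0).symm
  memLp j := by
    have := (hX.identDistrib_A i j).comp (u := fun n : ℕ => (n : ℝ)) (measurable_of_countable _)
    exact this.memLp_iff.2 hA
  mean j := by
    have := (hX.identDistrib_A i j).comp (u := fun n : ℕ => (n : ℝ)) (measurable_of_countable _)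
    exact this.integral_eq
  var j := by
    have := (hX.identDistrib_A i j).comp (u := fun n : ℕ => (n : ℝ)) (measurable_of_countable _)
    exact this.variance_eq

theorem IsStationaryGWI.measurable_path (hX : IsStationaryGWI P A B X) (s : ℤ) (n : ℕ) (k : ℕ) :
    Measurable fun ω => gwPath (fun i j => A i j ω) (fun i => B i ω) s n k :=
  (measurable_gwPath_envSigma s n k).mono (hX.envSigma_le _) le_rfl

/-- The process follows the Galton–Watson path started from any of its values. -/
theorem IsStationaryGWI.ae_eq_gwPath (hX : IsStationaryGWI P A B X) :
    ∀ᵐ ω ∂P, ∀ (s : ℤ) (k : ℕ),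
      X (s + k) ω = gwPath (fun i j => A i j ω) (fun i => B i ω) s (X s ω) k := by
  filter_upwards [ae_all_iff.2 hX.recursion] with ω hω s k
  induction k with
  | zero => simp [gwPath]
  | succ k ih =>
    have := hω (s + k + 1)
    rw [add_sub_cancel_right, ih] at this
    rw [gwPath, ← this]
    push_cast
    rw [add_assoc]

theorem IsStationaryGWI.identDistrib_X (hX : IsStationaryGWI P A B X) (i : ℤ) :
    IdentDistrib (X i) (X 0) P P where
  aemeasurable_fst := (hX.measurable_X i).aemeasurable
  aemeasurable_snd := (hX.measurable_X 0).aemeasurable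
  map_eq := by
    have h := congrArg (fun μ => μ.map fun f : ℤ → ℕ => f 0) (hX.stationary i)
    rw [Measure.map_map (measurable_pi_apply 0)
        (measurable_pi_lambda _ fun k => hX.measurable_X _),
      Measure.map_map (measurable_pi_apply 0)
        (measurable_pi_lambda _ fun k => hX.measurable_X _)] at h
    simpa [Function.comp_def] using h

end Stationary

/-! ### Coalescence, independence of the future, and finite mean -/

section Stationary

variable {Ω : Type*} [MeasurableSpace Ω] {P : Measure Ω} [IsProbabilityMeasure P]
    {A : ℤ → ℕ → Ω → ℕ} {B : ℤ → Ω → ℕ} {X : ℤ → Ω → ℕ}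

/-- Two paths driven by the same environment coalesce geometrically fast. -/
theorem IsStationaryGWI.lintegral_gwPath_sub (hX : IsStationaryGWI P A B X)
    (hA : MemLp (fun ω => (A 0 0 ω : ℝ)) 2 P) (s : ℤ) (n k : ℕ) :
    ∫⁻ ω, ((gwPath (fun i j => A i j ω) (fun i => B i ω) s n k -
      gwPath (fun i j => A i j ω) (fun i => B i ω) s 0 k : ℕ) : ℝ≥0∞) ∂P =
        n * ENNReal.ofReal (offspringMean P A) ^ k := by
  induction k with
  | zero => simp [gwPath]
  | succ k ih =>
    have hW := (hX.isIIDCounts hA (s + k + 1)).lintegral_random_sum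
      (hX.measurable_path s 0 k) (hX.measurable_path s n k)
      (hX.indepFun_of_envSigma (p := (· ≤ s + k)) (q := (s + k + 1 ≤ ·))
        (fun i h => by omega)
        ((measurable_gwPath_envSigma s 0 k).prodMk (measurable_gwPath_envSigma s n k))
        (measurable_offspring_envSigma _))
    rw [ih] at hW
    rw [pow_succ, ← mul_assoc, ← hW]
    refine lintegral_congr fun ω => ?_
    simp only [gwPath]
    -- The immigrants cancel. What remains is the offspring of the surplus individuals, to which
    -- Wald's identity applies.
    rw [Nat.add_sub_add_right,
      ← Finset.sum_range_add_sum_Ico _ (gwPath_mono _ _ s (Nat.zero_le n) k),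
      Nat.add_sub_cancel_left]
    push_cast
    rfl

/-- The paths started from zero have uniformly bounded means. -/
theorem IsStationaryGWI.lintegral_gwPath_zero_le (hX : IsStationaryGWI P A B X)
    (hA : MemLp (fun ω => (A 0 0 ω : ℝ)) 2 P) (hμ : offspringMean P A ∈ Set.Ioo (0 : ℝ) 1)
    (s : ℤ) (k : ℕ) :
    ∫⁻ ω, (gwPath (fun i j => A i j ω) (fun i => B i ω) s 0 k : ℝ≥0∞) ∂P ≤
      (∫⁻ ω, (B 0 ω : ℝ≥0∞) ∂P) * ENNReal.ofReal (1 - offspringMean P A)⁻¹ := by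
  have hcast : Measurable fun n : ℕ => (n : ℝ≥0∞) := measurable_of_countable _
  induction k with
  | zero => simp [gwPath]
  | succ k ih =>
    have hW := (hX.isIIDCounts hA (s + k + 1)).lintegral_random_sum (N₁ := fun _ => 0)
      measurable_const (hX.measurable_path s 0 k)
      (hX.indepFun_of_envSigma (p := (· ≤ s + k)) (q := (s + k + 1 ≤ ·))
        (fun i h => by omega)
        (Measurable.prodMk (@measurable_const _ _ _ (envSigma A B (· ≤ s + k)) 0)
          (measurable_gwPath_envSigma s 0 k))
        (measurable_offspring_envSigma _))
    have hB : ∫⁻ ω, (B (s + k + 1) ω : ℝ≥0∞) ∂P = ∫⁻ ω, (B 0 ω : ℝ≥0∞) ∂P :=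
      ((hX.identDistrib_B (s + k + 1)).comp hcast).lintegral_eq
    simp only [← Finset.range_eq_Ico, Nat.sub_zero] at hW
    have h1 : ∫⁻ ω, (gwPath (fun i j => A i j ω) (fun i => B i ω) s 0 (k + 1) : ℝ≥0∞) ∂P =
        (∫⁻ ω, (gwPath (fun i j => A i j ω) (fun i => B i ω) s 0 k : ℝ≥0∞) ∂P) *
          ENNReal.ofReal (offspringMean P A) + ∫⁻ ω, (B 0 ω : ℝ≥0∞) ∂P := by
      rw [← hW, ← hB, ← lintegral_add_right _ (show Measurable fun ω =>
        (B (s + k + 1) ω : ℝ≥0∞) from hcast.comp (hX.measurable_B _))]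
      refine lintegral_congr fun ω => ?_
      simp [gwPath]
    rw [h1]
    set b := ∫⁻ ω, (B 0 ω : ℝ≥0∞) ∂P
    set m := offspringMean P A
    -- The bound reproduces itself because (1 - m)⁻¹ m + 1 = (1 - m)⁻¹.
    calc _ ≤ b * ENNReal.ofReal (1 - m)⁻¹ * ENNReal.ofReal m + b * 1 := by rw [mul_one]; gcongr
      _ = b * (ENNReal.ofReal ((1 - m)⁻¹ * m + 1)) := by
        have h1 : 0 < 1 - m := by linarith [hμ.2]
        rw [ENNReal.ofReal_add (mul_nonneg (inv_nonneg.2 h1.le) hμ.1.le) zero_le_one,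
          ENNReal.ofReal_mul (inv_nonneg.2 h1.le), mul_add, mul_assoc]
        simp
      _ = _ := by
        have h1 : 1 - m ≠ 0 := by linarith [hμ.2]
        congr 2
        field_simp
        ring

/-- If X_{i-n} ≤ K, the path from X_{i-n} lies between those from 0 and from K, and these differ at
time i with probability at most K mⁿ. If X_{i-n} > K, stationarity makes the probability independent
of n. Choosing K and then n finishes the proof, and X_i is thereby approximated by functions of the
environment up to time i. -/
theorem IsStationaryGWI.tendsto_ne_gwPath (hX : IsStationaryGWI P A B X)
    (hA : MemLp (fun ω => (A 0 0 ω : ℝ)) 2 P) (hμ : offspringMean P A ∈ Set.Ioo (0 : ℝ) 1)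
    (i : ℤ) :
    Tendsto (fun n : ℕ => P {ω | X i ω ≠
      gwPath (fun i j => A i j ω) (fun i => B i ω) (i - n) 0 n}) atTop (𝓝 0) := by
  have hbound : ∀ K n : ℕ, P {ω | X i ω ≠
      gwPath (fun i j => A i j ω) (fun i => B i ω) (i - n) 0 n} ≤
      P {ω | K < X 0 ω} + K * ENNReal.ofReal (offspringMean P A) ^ n := by
    intro K n
    have h1 : P {ω | K < X (i - n) ω} = P {ω | K < X 0 ω} :=
      (hX.identDistrib_X (i - n)).measure_mem_eq (s := Set.Ioi K) measurableSet_Ioi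
    rw [← h1, ← hX.lintegral_gwPath_sub hA (i - n) K n]
    set D : Ω → ℕ := fun ω => gwPath (fun i j => A i j ω) (fun i => B i ω) (i - n) K n -
      gwPath (fun i j => A i j ω) (fun i => B i ω) (i - n) 0 n with hD
    have hDm : Measurable D := (hX.measurable_path _ _ _).sub (hX.measurable_path _ _ _)
    have h2 : P {ω | 1 ≤ D ω} ≤ ∫⁻ ω, (D ω : ℝ≥0∞) ∂P := by
      have := mul_meas_ge_le_lintegral (μ := P)
        ((measurable_of_countable (fun n : ℕ => (n : ℝ≥0∞))).comp hDm) 1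
      simpa using this
    refine le_trans ?_ (add_le_add le_rfl h2)
    refine le_trans (measure_mono_ae ?_) (measure_union_le _ _)
    filter_upwards [hX.ae_eq_gwPath] with ω hω hne
    have h3 := hω (i - n) n
    rw [sub_add_cancel] at h3
    by_cases hK : K < X (i - n) ω
    · exact Or.inl hK
    · right
      push Not at hK
      have h4 := gwPath_mono (fun i j => A i j ω) (fun i => B i ω) (i - n) hK n
      have h5 := gwPath_mono (fun i j => A i j ω) (fun i => B i ω) (i - n)
        (Nat.zero_le (X (i - n) ω)) n
      change X i ω ≠ _ at hne
      rw [h3] at hne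
      change 1 ≤ D ω
      simp only [hD]
      omega
  have hK0 : Tendsto (fun K : ℕ => P {ω | K < X 0 ω}) atTop (𝓝 0) := by
    have : (⋂ K : ℕ, {ω | K < X 0 ω}) = ∅ := by
      ext ω
      simp only [Set.mem_iInter, Set.mem_ofPred_eq, Set.mem_empty_iff_false, iff_false, not_forall]
      exact ⟨X 0 ω, lt_irrefl _⟩
    rw [← measure_empty (μ := P), ← this]
    refine tendsto_measure_iInter_atTop
      (fun K => ((hX.measurable_X 0) (measurableSet_Ioi (a := K))).nullMeasurableSet) ?_
      ⟨0, measure_ne_top _ _⟩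
    intro K K' hKK ω hω
    exact lt_of_le_of_lt hKK hω
  rw [ENNReal.tendsto_nhds_zero]
  intro ε hε
  obtain ⟨K, hK⟩ := ((ENNReal.tendsto_nhds_zero.1 hK0) (ε / 2) (ENNReal.half_pos hε.ne')).exists
  have hgeo : Tendsto (fun n : ℕ => (K : ℝ≥0∞) * ENNReal.ofReal (offspringMean P A) ^ n) atTop
      (𝓝 0) := by
    have := ENNReal.Tendsto.const_mul (a := (K : ℝ≥0∞))
      (ENNReal.tendsto_pow_atTop_nhds_zero_of_lt_one (r := ENNReal.ofReal (offspringMean P A))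
        (by simpa using hμ.2)) (Or.inr (by simp))
    simpa using this
  filter_upwards [(ENNReal.tendsto_nhds_zero.1 hgeo) (ε / 2) (ENNReal.half_pos hε.ne')] with n hn
  calc _ ≤ _ := hbound K n
    _ ≤ ε / 2 + ε / 2 := add_le_add hK hn
    _ = ε := ENNReal.add_halves ε

/-- The stationary process is non-anticipating. -/
theorem IsStationaryGWI.indepFun_future (hX : IsStationaryGWI P A B X)
    (hA : MemLp (fun ω => (A 0 0 ω : ℝ)) 2 P) (hμ : offspringMean P A ∈ Set.Ioo (0 : ℝ) 1)
    (i : ℤ) {β : Type*} [MeasurableSpace β] {W : Ω → β} (hW : Measurable[envSigma A B (i < ·)] W) :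
    IndepFun (X i) W P := by
  rw [indepFun_iff_measure_inter_preimage_eq_mul]
  intro s t hs ht
  have hne := hX.tendsto_ne_gwPath hA hμ i
  set Y : ℕ → Ω → ℕ := fun n ω => gwPath (fun i j => A i j ω) (fun i => B i ω) (i - n) 0 n with hY
  -- Exchanging X_i for the path started from zero changes any probability by at most the
  -- probability that they differ. The product formula, exact for the path, therefore passes to the
  -- limit.
  have hlim : ∀ T : Set Ω, Tendsto (fun n => P (Y n ⁻¹' s ∩ T)) atTop (𝓝 (P (X i ⁻¹' s ∩ T))) := by
    intro T
    have h0 : P (X i ⁻¹' s ∩ T) ≠ ∞ := measure_ne_top _ _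
    have hlow : Tendsto (fun n => P (X i ⁻¹' s ∩ T) - P {ω | X i ω ≠ Y n ω}) atTop
        (𝓝 (P (X i ⁻¹' s ∩ T))) := by
      simpa using ENNReal.Tendsto.sub tendsto_const_nhds hne (Or.inl h0)
    have hup : Tendsto (fun n => P (X i ⁻¹' s ∩ T) + P {ω | X i ω ≠ Y n ω}) atTop
        (𝓝 (P (X i ⁻¹' s ∩ T))) := by
      simpa using tendsto_const_nhds.add hne
    refine tendsto_of_tendsto_of_tendsto_of_le_of_le hlow hup (fun n => ?_) fun n => ?_
    · rw [tsub_le_iff_right]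
      refine le_trans (measure_mono ?_) (measure_union_le _ _)
      intro ω hω
      by_cases h : X i ω = Y n ω
      · left; exact ⟨by simpa [← h] using hω.1, hω.2⟩
      · right; exact h
    · refine le_trans (measure_mono ?_) (measure_union_le _ _)
      intro ω hω
      by_cases h : X i ω = Y n ω
      · left; exact ⟨by simpa [h] using hω.1, hω.2⟩
      · right; exact h
  have h1 := hlim (W ⁻¹' t)
  have h2 := hlim Set.univ
  simp only [Set.inter_univ] at h2
  have h3 : ∀ n, P (Y n ⁻¹' s ∩ W ⁻¹' t) = P (Y n ⁻¹' s) * P (W ⁻¹' t) := by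
    intro n
    have hYm : Measurable[envSigma A B (· ≤ i)] (Y n) := by
      have := measurable_gwPath_envSigma (A := A) (B := B) (i - n) 0 n
      rwa [sub_add_cancel] at this
    exact (indepFun_iff_measure_inter_preimage_eq_mul.1
      (hX.indepFun_of_envSigma (p := (· ≤ i)) (q := (i < ·)) (fun j h => by omega) hYm hW)) s t hs ht
  simp only [h3] at h1
  exact tendsto_nhds_unique h1 (ENNReal.Tendsto.mul_const h2 (Or.inr (measure_ne_top _ _)))

/-- Finiteness of the stationary mean is a conclusion. The truncation min(X_i, L) is at most the
zero-started path plus L on the event that they differ; n → ∞ removes that event, and L → ∞ follows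
by monotone convergence. -/
theorem IsStationaryGWI.lintegral_X_le (hX : IsStationaryGWI P A B X)
    (hA : MemLp (fun ω => (A 0 0 ω : ℝ)) 2 P) (hμ : offspringMean P A ∈ Set.Ioo (0 : ℝ) 1) (i : ℤ) :
    ∫⁻ ω, (X i ω : ℝ≥0∞) ∂P ≤
      (∫⁻ ω, (B 0 ω : ℝ≥0∞) ∂P) * ENNReal.ofReal (1 - offspringMean P A)⁻¹ := by
  have hcast : Measurable fun n : ℕ => (n : ℝ≥0∞) := measurable_of_countable _
  have hne := hX.tendsto_ne_gwPath hA hμ i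
  set M := (∫⁻ ω, (B 0 ω : ℝ≥0∞) ∂P) * ENNReal.ofReal (1 - offspringMean P A)⁻¹
  have hL : ∀ L : ℕ, ∫⁻ ω, ((min (X i ω) L : ℕ) : ℝ≥0∞) ∂P ≤ M := by
    intro L
    have hlim : Tendsto (fun n : ℕ => M + L * P {ω | X i ω ≠
      gwPath (fun i j => A i j ω) (fun i => B i ω) (i - n) 0 n}) atTop (𝓝 (M + L * 0)) :=
      tendsto_const_nhds.add (ENNReal.Tendsto.const_mul hne (Or.inr (by simp)))
    rw [mul_zero, add_zero] at hlim
    refine ge_of_tendsto' hlim fun n => ?_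
    have hms : MeasurableSet {ω | X i ω ≠
        gwPath (fun i j => A i j ω) (fun i => B i ω) (i - n) 0 n} :=
      (measurableSet_eq_fun (hX.measurable_X i) (hX.measurable_path _ _ _)).compl
    calc ∫⁻ ω, ((min (X i ω) L : ℕ) : ℝ≥0∞) ∂P
        ≤ ∫⁻ ω, ((gwPath (fun i j => A i j ω) (fun i => B i ω) (i - n) 0 n : ℝ≥0∞) +
          Set.indicator {ω | X i ω ≠
            gwPath (fun i j => A i j ω) (fun i => B i ω) (i - n) 0 n} (fun _ => (L : ℝ≥0∞)) ω) ∂P := by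
          refine lintegral_mono fun ω => ?_
          by_cases h : X i ω = gwPath (fun i j => A i j ω) (fun i => B i ω) (i - n) 0 n
          · simp only [← h, ne_eq]
            refine le_trans ?_ le_self_add
            exact_mod_cast min_le_left _ _
          · rw [Set.indicator_of_mem (by exact h)]
            refine le_trans ?_ le_add_self
            exact_mod_cast min_le_right _ _
      _ = ∫⁻ ω, (gwPath (fun i j => A i j ω) (fun i => B i ω) (i - n) 0 n : ℝ≥0∞) ∂P + L * P {ω | X i ω ≠
            gwPath (fun i j => A i j ω) (fun i => B i ω) (i - n) 0 n} := by
          rw [lintegral_add_right _ (measurable_const.indicator hms),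
            lintegral_indicator_const hms]
      _ ≤ _ := by
          gcongr
          exact hX.lintegral_gwPath_zero_le hA hμ _ _
  have hlim : Tendsto (fun L : ℕ => ∫⁻ ω, ((min (X i ω) L : ℕ) : ℝ≥0∞) ∂P) atTop
      (𝓝 (∫⁻ ω, (X i ω : ℝ≥0∞) ∂P)) := by
    refine lintegral_tendsto_of_tendsto_of_monotone
      (fun L => (hcast.comp ((hX.measurable_X i).min measurable_const)).aemeasurable) ?_ ?_
    · refine Eventually.of_forall fun ω L L' h => ?_
      simp only
      gcongr
    · refine Eventually.of_forall fun ω => tendsto_const_nhds.congr' ?_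
      filter_upwards [eventually_ge_atTop (X i ω)] with L hL
      rw [min_eq_left hL]
  exact le_of_tendsto' hlim hL

end Stationary

/-! ### Tails and moments -/

/-- The tail of a count. -/
noncomputable def tailFn {Ω : Type*} [MeasurableSpace Ω] (P : Measure Ω) (N : Ω → ℕ) (x : ℝ) : ℝ :=
  P.real {ω | x < (N ω : ℝ)}

section Tail

variable {Ω : Type*} [MeasurableSpace Ω] {P : Measure Ω} [IsProbabilityMeasure P]

theorem tailFn_nonneg (N : Ω → ℕ) (x : ℝ) : 0 ≤ tailFn P N x := measureReal_nonneg

theorem tailFn_antitone (N : Ω → ℕ) : Antitone (tailFn P N) := fun x y hxy =>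
  measureReal_mono (fun _ hω => lt_of_le_of_lt hxy hω)

theorem measurableSet_tail {N : Ω → ℕ} (hN : Measurable N) (x : ℝ) :
    MeasurableSet {ω | x < (N ω : ℝ)} :=
  hN (MeasurableSet.of_discrete (s := {n : ℕ | x < (n : ℝ)}))

theorem tendsto_tailFn {N : Ω → ℕ} (hN : Measurable N) : Tendsto (tailFn P N) atTop (𝓝 0) := by
  have h : Tendsto (fun x : ℝ => P {ω | x < (N ω : ℝ)}) atTop (𝓝 (P (⋂ x : ℝ, {ω | x < (N ω : ℝ)}))) :=
    tendsto_measure_iInter_atTop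
      (fun x => (measurableSet_tail hN x).nullMeasurableSet)
      (fun x y hxy ω hω => lt_of_le_of_lt hxy hω) ⟨0, measure_ne_top _ _⟩
  have h0 : (⋂ x : ℝ, {ω | x < (N ω : ℝ)}) = ∅ := by
    ext ω
    simp only [Set.mem_iInter, Set.mem_ofPred_eq, Set.mem_empty_iff_false, iff_false, not_forall]
    exact ⟨N ω, lt_irrefl _⟩
  rw [h0, measure_empty] at h
  exact (ENNReal.tendsto_toReal ENNReal.zero_ne_top).comp h

theorem tailFn_congr {N N' : Ω → ℕ} (h : IdentDistrib N N' P P) : tailFn P N = tailFn P N' := by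
  ext x
  simp only [tailFn, Measure.real]
  exact congrArg _ (h.measure_mem_eq (s := {n : ℕ | x < (n : ℝ)}) MeasurableSet.of_discrete)

/-- Moments of order smaller than the tail index are finite. -/
theorem lintegral_rpow_lt_top {N : Ω → ℕ} (hN : Measurable N) {α p : ℝ}
    (h : RegVar (tailFn P N) α) (hp0 : 0 < p) (hp : p < α) :
    ∫⁻ ω, ENNReal.ofReal ((N ω : ℝ) ^ p) ∂P < ∞ := by
  -- The exponent (p + α)/2 lies strictly between p and α: it is below the tail index, so the bound
  -- is available, and above p, so t^{p-1} times the bound is integrable at infinity.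
  obtain ⟨C, t₀, hC, ht₀, hb⟩ := h.upper_bound (p := (p + α) / 2) (tailFn_antitone N)
    (tailFn_nonneg N) (by linarith) (by linarith)
  have hNm : Measurable fun ω => (N ω : ℝ) := (measurable_of_countable _).comp hN
  rw [lintegral_rpow_eq_lintegral_meas_lt_mul P (Eventually.of_forall fun ω => Nat.cast_nonneg _)
    hNm.aemeasurable hp0]
  refine ENNReal.mul_lt_top ENNReal.ofReal_lt_top ?_
  rw [← Set.Ioc_union_Ioi_eq_Ioi ht₀.le]
  refine lt_of_le_of_lt (lintegral_union_le _ _ _) (ENNReal.add_lt_top.2 ⟨?_, ?_⟩)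
  · have hi : IntegrableOn (fun t : ℝ => t ^ (p - 1)) (Set.Ioc 0 t₀) := by
      have := intervalIntegral.intervalIntegrable_rpow' (a := 0) (b := t₀) (r := p - 1) (by linarith)
      rwa [intervalIntegrable_iff_integrableOn_Ioc_of_le ht₀.le] at this
    refine lt_of_le_of_lt (lintegral_mono fun t => ?_) hi.lintegral_lt_top
    calc _ ≤ 1 * ENNReal.ofReal (t ^ (p - 1)) := by gcongr; exact prob_le_one
      _ = _ := one_mul _
  · have hi : IntegrableOn (fun t : ℝ => C * t ^ (-((p + α) / 2) + (p - 1))) (Set.Ioi t₀) :=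
      (integrableOn_Ioi_rpow_of_lt (by linarith) ht₀).const_mul C
    refine lt_of_le_of_lt (setLIntegral_mono_ae' measurableSet_Ioi
      (Eventually.of_forall fun t ht => ?_)) hi.lintegral_lt_top
    have ht' : t₀ < t := ht
    have ht0 : 0 < t := ht₀.trans ht'
    rw [Real.rpow_add ht0, ← mul_assoc, ENNReal.ofReal_mul (by positivity)]
    gcongr
    rw [← ENNReal.ofReal_toReal (measure_ne_top P {a | t < (N a : ℝ)})]
    exact ENNReal.ofReal_le_ofReal (hb t ht'.le)

theorem lintegral_natCast_lt_top {N : Ω → ℕ} (hN : Measurable N) {α : ℝ}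
    (h : RegVar (tailFn P N) α) (hα : 1 < α) : ∫⁻ ω, (N ω : ℝ≥0∞) ∂P < ∞ := by
  simpa using lintegral_rpow_lt_top hN h one_pos hα

theorem measureReal_lt_abs_le {S : Ω → ℝ} (hS : Measurable S) {K c : ℝ} (hc : 0 < c) (hK : 0 ≤ K)
    (h : ∫⁻ ω, ENNReal.ofReal (S ω ^ 2) ∂P ≤ ENNReal.ofReal K) :
    P.real {ω | c < |S ω|} ≤ K / c ^ 2 := by
  have h1 := meas_ge_le_lintegral_div (μ := P) ((hS.pow_const 2).ennreal_ofReal).aemeasurable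
    (ε := ENNReal.ofReal (c ^ 2)) (by simpa using hc.ne') ENNReal.ofReal_ne_top
  have h2 : P {ω | c < |S ω|} ≤ ENNReal.ofReal (K / c ^ 2) := by
    rw [ENNReal.ofReal_div_of_pos (by positivity)]
    refine le_trans (measure_mono ?_) (h1.trans (by gcongr))
    intro ω (hω : c < |S ω|)
    change ENNReal.ofReal (c ^ 2) ≤ ENNReal.ofReal (S ω ^ 2)
    rw [← sq_abs (S ω)]
    gcongr
  exact ENNReal.toReal_le_of_le_ofReal (by positivity) h2

end Tail

/-! ### Regular variation of the stationary marginal -/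

section Stationary

variable {Ω : Type*} [MeasurableSpace Ω] {P : Measure Ω} [IsProbabilityMeasure P]
    {A : ℤ → ℕ → Ω → ℕ} {B : ℤ → Ω → ℕ} {X : ℤ → Ω → ℕ}

/-- The centered sum of the offspring numbers of the individuals of generation `i`. -/
noncomputable def offspringNoise (P : Measure Ω) (A : ℤ → ℕ → Ω → ℕ) (X : ℤ → Ω → ℕ) (i : ℤ) (ω : Ω) : ℝ :=
  ∑ j ∈ Finset.range (X i ω), ((A (i + 1) j ω : ℝ) - offspringMean P A)

theorem IsStationaryGWI.measurable_offspringNoise (hX : IsStationaryGWI P A B X) (i : ℤ) :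
    Measurable (offspringNoise P A X i) :=
  measurable_sum_range (a := fun j ω => ((A (i + 1) j ω : ℝ) - offspringMean P A))
    (fun j => (measurable_of_countable (fun n : ℕ => (n : ℝ) - offspringMean P A)).comp
      (hX.measurable_A _ j)) (hX.measurable_X i)

theorem IsStationaryGWI.ae_succ_eq (hX : IsStationaryGWI P A B X) (i : ℤ) :
    ∀ᵐ ω ∂P, (X (i + 1) ω : ℝ) =
      offspringMean P A * X i ω + offspringNoise P A X i ω + B (i + 1) ω := by
  filter_upwards [hX.recursion (i + 1)] with ω hω
  rw [hω, add_sub_cancel_right]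
  simp [offspringNoise, Finset.sum_sub_distrib, mul_comm]

theorem measurable_offspring_future (i : ℤ) :
    Measurable[envSigma A B (i < ·)] fun ω j => A (i + 1) j ω := by
  let σ : MeasurableSpace Ω := envSigma A B (i < ·)
  exact measurable_pi_lambda _ fun j => measurable_envSigma_left (p := (i < ·)) (lt_add_one i) j

/-- X_1 = m X_0 + S + B_1, where X_1 and X_0 have the same law. The noise S has a finite second
moment, hence a tail o(P(B_0 > x)) as α < 2; and X_0 is independent of B_1, so both being large is
of smaller order than P(B_0 > x). `tendsto_tail_ratio` solves the resulting approximate functional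
equation for the tail. -/
theorem IsStationaryGWI.regVar_X (hX : IsStationaryGWI P A B X) {α : ℝ}
    (hA : MemLp (fun ω => (A 0 0 ω : ℝ)) 2 P) (hμ : offspringMean P A ∈ Set.Ioo (0 : ℝ) 1)
    (hα : α ∈ Set.Ioo (1 : ℝ) 2) (hB : RegVar (tailFn P (B 0)) α) :
    RegVar (tailFn P (X 0)) α := by
  set m := offspringMean P A with hm
  have hm0 : 0 < m := hμ.1
  have hm1 : m < 1 := hμ.2
  have hbpos := hB.pos (tailFn_antitone _) (tailFn_nonneg _)
  set S := offspringNoise P A X 0 with hS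
  have hSm : Measurable S := hX.measurable_offspringNoise 0
  obtain ⟨K, hK0, hK⟩ : ∃ K : ℝ, 0 ≤ K ∧ ∫⁻ ω, ENNReal.ofReal (S ω ^ 2) ∂P ≤ ENNReal.ofReal K := by
    have hfin : (∫⁻ ω, (X 0 ω : ℝ≥0∞) ∂P) * ENNReal.ofReal (offspringVar P A) ≠ ∞ := by
      refine ENNReal.mul_ne_top (ne_top_of_le_ne_top ?_ (hX.lintegral_X_le hA hμ 0))
        ENNReal.ofReal_ne_top
      exact ENNReal.mul_ne_top (lintegral_natCast_lt_top (hX.measurable_B 0) hB hα.1).ne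
        ENNReal.ofReal_ne_top
    refine ⟨((∫⁻ ω, (X 0 ω : ℝ≥0∞) ∂P) * ENNReal.ofReal (offspringVar P A)).toReal,
      ENNReal.toReal_nonneg, ?_⟩
    · rw [ENNReal.ofReal_toReal hfin]
      have hind : IndepFun (fun ω => (0, X 0 ω)) (fun ω j => A 1 j ω) P :=
        (hX.indepFun_future hA hμ 0 (measurable_offspring_future (B := B) 0)).comp
          (φ := fun n : ℕ => (0, n)) (measurable_of_countable _) measurable_id
      have := (hX.isIIDCounts hA 1).lintegral_sq_random_sum (N₁ := fun _ => 0) measurable_const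
        (hX.measurable_X 0) hind
      simp only [← Finset.range_eq_Ico, Nat.sub_zero] at this
      rw [← this]
      rfl
  have hind : IndepFun (X 0) (B 1) P := hX.indepFun_future hA hμ 0
    (measurable_envSigma_right (p := ((0 : ℤ) < ·)) one_pos)
  have hb1 : tailFn P (B 1) = tailFn P (B 0) := tailFn_congr (hX.identDistrib_B 1)
  have hx1 : tailFn P (X 1) = tailFn P (X 0) := tailFn_congr (hX.identDistrib_X 1)
  have hprod : ∀ s t : ℝ, P.real ({ω | s < (X 0 ω : ℝ)} ∩ {ω | t < (B 1 ω : ℝ)}) =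
      tailFn P (X 0) s * tailFn P (B 0) t := by
    intro s t
    rw [← hb1]
    simp only [tailFn, Measure.real]
    rw [← ENNReal.toReal_mul]
    exact congrArg _ (hind.measure_inter_preimage_eq_mul {n : ℕ | s < (n : ℝ)} {n : ℕ | t < (n : ℝ)}
      MeasurableSet.of_discrete MeasurableSet.of_discrete)
  -- The error e(ε, x) collects the two atypical events: a noise exceeding εx/2, and both m X_0 and
  -- B_1 exceeding εx/2.
  have hlim := tendsto_tail_ratio (g := tailFn P (X 0)) (b := tailFn P (B 0)) (α := α) (m := m)
    (e := fun ε x => P.real {ω | ε * x / 2 < |S ω|} +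
      tailFn P (X 0) (ε * x / 2 / m) * tailFn P (B 0) (ε * x / 2))
    hB (tailFn_antitone _) (tailFn_nonneg _) (by linarith [hα.1]) hm0 hm1
    (tendsto_tailFn (hX.measurable_X 0)) (tailFn_nonneg _) ?_ ?_ ?_
  · refine hB.of_tendsto_ratio hbpos ?_ hlim
    have : m ^ α < 1 := Real.rpow_lt_one hm0.le hm1 (by linarith [hα.1])
    exact one_div_pos.2 (by linarith)
  · intro ε hε
    have h1 : Tendsto (fun x : ℝ => P.real {ω | ε * x / 2 < |S ω|} / tailFn P (B 0) x) atTop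
        (𝓝 0) := by
      have hz : Tendsto (fun x : ℝ => K / (ε / 2) ^ 2 * (x ^ (-2 : ℝ) / tailFn P (B 0) x)) atTop
          (𝓝 0) := by
        simpa using (hB.tendsto_rpow_div (tailFn_antitone _) (tailFn_nonneg _) (by linarith [hα.1])
          hα.2).const_mul (K / (ε / 2) ^ 2)
      refine tendsto_of_tendsto_of_tendsto_of_le_of_le' tendsto_const_nhds hz
        (Eventually.of_forall fun x => div_nonneg measureReal_nonneg (tailFn_nonneg _ _)) ?_
      filter_upwards [eventually_gt_atTop 0] with x hx
      rw [← mul_div_assoc]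
      refine div_le_div_of_nonneg_right ?_ (tailFn_nonneg _ _)
      refine (measureReal_lt_abs_le hSm (by positivity) hK0 hK).trans (le_of_eq ?_)
      rw [Real.rpow_neg hx.le]
      norm_num
      field_simp
    have h2 : Tendsto (fun x : ℝ => tailFn P (X 0) (ε * x / 2 / m) *
        (tailFn P (B 0) (ε / 2 * x) / tailFn P (B 0) x)) atTop (𝓝 (0 * (ε / 2) ^ (-α))) := by
      refine Tendsto.mul ((tendsto_tailFn (hX.measurable_X 0)).comp ?_) (hB _ (by positivity))
      have : (fun x : ℝ => ε * x / 2 / m) = fun x => (ε / 2 / m) * x := by ext x; ring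
      rw [this]
      exact tendsto_id.const_mul_atTop (by positivity)
    rw [zero_mul] at h2
    have h3 := h1.add h2
    rw [add_zero] at h3
    refine h3.congr fun x => ?_
    rw [show ε / 2 * x = ε * x / 2 by ring]
    ring
  · intro ε hε hε1 x hx
    -- Outside these events one of m X_0 and B_1 is at most εx/2, the other at most (1 - ε)x and the
    -- noise at most εx/2, so the sum cannot exceed x.
    have hsub : P.real {ω | x < (X 1 ω : ℝ)} ≤
        P.real ({ω | (1 - ε) / m * x < (X 0 ω : ℝ)} ∪ {ω | (1 - ε) * x < (B 1 ω : ℝ)} ∪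
          ({ω | ε * x / 2 < |S ω|} ∪
            ({ω | ε * x / 2 / m < (X 0 ω : ℝ)} ∩ {ω | ε * x / 2 < (B 1 ω : ℝ)}))) := by
      refine ENNReal.toReal_mono (measure_ne_top _ _) (measure_mono_ae ?_)
      filter_upwards [hX.ae_succ_eq 0] with ω hω hlt
      change x < (X 1 ω : ℝ) at hlt
      rw [zero_add] at hω
      by_contra hcon
      obtain ⟨h12, h34⟩ := not_or.1 hcon
      obtain ⟨h1, h2⟩ := not_or.1 h12
      obtain ⟨h3, h4⟩ := not_or.1 h34
      replace h1 : (X 0 ω : ℝ) ≤ (1 - ε) / m * x := not_lt.1 h1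
      replace h2 : (B 1 ω : ℝ) ≤ (1 - ε) * x := not_lt.1 h2
      replace h3 : |S ω| ≤ ε * x / 2 := not_lt.1 h3
      replace h4 : (X 0 ω : ℝ) ≤ ε * x / 2 / m ∨ (B 1 ω : ℝ) ≤ ε * x / 2 :=
        (not_and_or.1 h4).imp not_lt.1 not_lt.1
      have h3' := (abs_le.1 h3).2
      rw [div_mul_eq_mul_div, le_div_iff₀ hm0] at h1
      rw [le_div_iff₀ hm0] at h4
      have : (X 1 ω : ℝ) = m * X 0 ω + S ω + B 1 ω := hω
      rcases h4 with h4 | h4 <;> nlinarith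
    have e1 := hprod (ε * x / 2 / m) (ε * x / 2)
    rw [← hx1] at e1 ⊢
    refine hsub.trans ?_
    refine (measureReal_union_le _ _).trans (add_le_add (measureReal_union_le _ _ |>.trans ?_)
      ((measureReal_union_le _ _).trans (by rw [e1])))
    rw [← hb1, hx1]; rfl
  · intro ε hε x hx
    set U := {ω | (1 + ε) / m * x < (X 0 ω : ℝ)}
    set V := {ω | (1 + ε) * x < (B 1 ω : ℝ)}
    have hsub : P.real (U ∪ V) ≤ P.real ({ω | x < (X 1 ω : ℝ)} ∪ {ω | ε * x / 2 < |S ω|}) := by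
      refine ENNReal.toReal_mono (measure_ne_top _ _) (measure_mono_ae ?_)
      filter_upwards [hX.ae_succ_eq 0] with ω hω hlt
      rw [zero_add] at hω
      by_contra hcon
      obtain ⟨h5, h6⟩ := not_or.1 hcon
      replace h5 : (X 1 ω : ℝ) ≤ x := not_lt.1 h5
      have h3' := (abs_le.1 (show |S ω| ≤ ε * x / 2 from not_lt.1 h6)).1
      have : (X 1 ω : ℝ) = m * X 0 ω + S ω + B 1 ω := hω
      have hb0 : (0 : ℝ) ≤ B 1 ω := Nat.cast_nonneg _
      have hx0 : (0 : ℝ) ≤ m * X 0 ω := by positivity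
      have hex : 0 < ε * x := by positivity
      rcases hlt with hlt | hlt
      · change (1 + ε) / m * x < (X 0 ω : ℝ) at hlt
        rw [div_mul_eq_mul_div, div_lt_iff₀ hm0] at hlt
        nlinarith
      · change (1 + ε) * x < (B 1 ω : ℝ) at hlt
        nlinarith
    have hUV : P.real (U ∩ V) ≤ tailFn P (X 0) (ε * x / 2 / m) * tailFn P (B 0) (ε * x / 2) := by
      rw [← hprod]
      refine measureReal_mono (Set.inter_subset_inter ?_ ?_)
      · intro ω hω
        refine lt_of_le_of_lt ?_ (show (1 + ε) / m * x < (X 0 ω : ℝ) from hω)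
        rw [div_mul_eq_mul_div]
        gcongr
        nlinarith
      · intro ω hω
        refine lt_of_le_of_lt ?_ (show (1 + ε) * x < (B 1 ω : ℝ) from hω)
        nlinarith
    -- Inclusion–exclusion separates the two tails; the intersection is absorbed by the product term
    -- of the error.
    have hincl := measureReal_union_add_inter (μ := P) (s := U)
      (measurableSet_tail (hX.measurable_B 1) ((1 + ε) * x))
    have h4 := measureReal_union_le (μ := P) {ω | x < (X 1 ω : ℝ)} {ω | ε * x / 2 < |S ω|}
    have e2 : P.real U = tailFn P (X 0) ((1 + ε) / m * x) := rfl
    have e3 : P.real V = tailFn P (B 0) ((1 + ε) * x) := by rw [← hb1]; rfl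
    have e4 : P.real {ω | x < (X 1 ω : ℝ)} = tailFn P (X 0) x := by rw [← hx1]; rfl
    change P.real (U ∪ V) + P.real (U ∩ V) = _ at hincl
    linarith

end Stationary

/-! ### The contribution of small generations -/

theorem tendsto_rpow_two_thirds : Tendsto (fun x : ℝ => x ^ (2 / 3 : ℝ)) atTop atTop :=
  tendsto_rpow_atTop (by norm_num)

theorem lt_rpow_three_halves_iff {x y : ℝ} (hx : 0 ≤ x) (hy : 0 ≤ y) :
    x < y ^ (3 / 2 : ℝ) ↔ x ^ (2 / 3 : ℝ) < y := by
  have h : x = (x ^ (2 / 3 : ℝ)) ^ (3 / 2 : ℝ) := by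
    rw [← Real.rpow_mul hx]; norm_num
  conv_lhs => rw [h]
  exact Real.rpow_lt_rpow_iff (by positivity) hy (by norm_num)

/-- Passing from X to X^{3/2} divides the index α by 3/2. -/
theorem regVar_comp_rpow {g : ℝ → ℝ} {α : ℝ} (h : RegVar g α) {q : ℝ} (hq : 0 < q) :
    Tendsto (fun x : ℝ => g ((q * x) ^ (2 / 3 : ℝ)) / g (x ^ (2 / 3 : ℝ))) atTop
      (𝓝 (q ^ (-(2 * α / 3)))) := by
  have h1 := (h (q ^ (2 / 3 : ℝ)) (by positivity)).comp tendsto_rpow_two_thirds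
  rw [← Real.rpow_mul hq.le, show 2 / 3 * -α = -(2 * α / 3) by ring] at h1
  refine h1.congr' ?_
  filter_upwards [eventually_ge_atTop 0] with x hx
  simp [Real.mul_rpow hq.le hx]

section Tail

variable {Ω : Type*} [MeasurableSpace Ω] {P : Measure Ω} [IsProbabilityMeasure P]

/-- Markov's inequality of order p, the moment of the product factorising by independence. It is
applied to X_i |B_{i+1} - E B_0|. -/
theorem measureReal_lt_mul_le {U W : Ω → ℝ} (hU : Measurable U) (hW : Measurable W)
    (hU0 : ∀ ω, 0 ≤ U ω) (hW0 : ∀ ω, 0 ≤ W ω) (hind : IndepFun U W P) {p : ℝ} (hp : 0 < p)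
    (hUp : ∫⁻ ω, ENNReal.ofReal (U ω ^ p) ∂P < ∞) (hWp : ∫⁻ ω, ENNReal.ofReal (W ω ^ p) ∂P < ∞) :
    ∃ K : ℝ, 0 ≤ K ∧ ∀ y : ℝ, 0 < y → P.real {ω | y < U ω * W ω} ≤ K * y ^ (-p) := by
  set K := (∫⁻ ω, ENNReal.ofReal (U ω ^ p) ∂P) * ∫⁻ ω, ENNReal.ofReal (W ω ^ p) ∂P with hK
  have hKt : K ≠ ∞ := ENNReal.mul_ne_top hUp.ne hWp.ne
  have hUm : Measurable fun ω => ENNReal.ofReal (U ω ^ p) := (hU.pow_const p).ennreal_ofReal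
  have hWm : Measurable fun ω => ENNReal.ofReal (W ω ^ p) := (hW.pow_const p).ennreal_ofReal
  have hprod : ∫⁻ ω, ENNReal.ofReal (U ω ^ p) * ENNReal.ofReal (W ω ^ p) ∂P = K :=
    lintegral_mul_eq_lintegral_mul_lintegral_of_indepFun hUm hWm
      (hind.comp (φ := fun u : ℝ => ENNReal.ofReal (u ^ p)) (ψ := fun u : ℝ => ENNReal.ofReal (u ^ p))
        (by fun_prop) (by fun_prop))
  refine ⟨K.toReal, ENNReal.toReal_nonneg, fun y hy => ?_⟩
  have h1 := meas_ge_le_lintegral_div (μ := P) (hUm.mul hWm).aemeasurable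
    (ε := ENNReal.ofReal (y ^ p)) (by simpa using Real.rpow_pos_of_pos hy p) ENNReal.ofReal_ne_top
  refine ENNReal.toReal_le_of_le_ofReal (by positivity) ?_
  rw [Real.rpow_neg hy.le, ← div_eq_mul_inv, ENNReal.ofReal_div_of_pos (by positivity),
    ENNReal.ofReal_toReal hKt, ← hprod]
  refine le_trans (measure_mono ?_) h1
  intro ω (hω : y < U ω * W ω)
  change ENNReal.ofReal (y ^ p) ≤ ENNReal.ofReal (U ω ^ p) * ENNReal.ofReal (W ω ^ p)
  rw [← ENNReal.ofReal_mul (Real.rpow_nonneg (hU0 ω) _), ← Real.mul_rpow (hU0 ω) (hW0 ω)]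
  exact ENNReal.ofReal_le_ofReal (Real.rpow_le_rpow hy.le hω.le hp.le)

theorem lintegral_abs_sub_rpow_lt_top {N : Ω → ℕ} {p : ℝ} (hp : 0 < p) (c : ℝ)
    (h : ∫⁻ ω, ENNReal.ofReal ((N ω : ℝ) ^ p) ∂P < ∞) :
    ∫⁻ ω, ENNReal.ofReal (|(N ω : ℝ) - c| ^ p) ∂P < ∞ := by
  have hle : ∀ ω, ENNReal.ofReal (|(N ω : ℝ) - c| ^ p) ≤
      ENNReal.ofReal (2 ^ p) * ENNReal.ofReal ((N ω : ℝ) ^ p) + ENNReal.ofReal (2 ^ p * |c| ^ p) := by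
    intro ω
    rw [← ENNReal.ofReal_mul (by positivity), ← ENNReal.ofReal_add (by positivity) (by positivity)]
    refine ENNReal.ofReal_le_ofReal ?_
    have h1 : |(N ω : ℝ) - c| ≤ 2 * max (N ω : ℝ) |c| := by
      have := abs_sub (N ω : ℝ) c
      rw [abs_of_nonneg (Nat.cast_nonneg (N ω) : (0 : ℝ) ≤ N ω)] at this
      linarith [le_max_left (N ω : ℝ) |c|, le_max_right (N ω : ℝ) |c|]
    calc |(N ω : ℝ) - c| ^ p ≤ (2 * max (N ω : ℝ) |c|) ^ p :=
          Real.rpow_le_rpow (abs_nonneg _) h1 hp.le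
      _ = 2 ^ p * (max (N ω : ℝ) |c|) ^ p := Real.mul_rpow two_pos.le (by positivity)
      _ ≤ 2 ^ p * ((N ω : ℝ) ^ p + |c| ^ p) := by
          gcongr
          have a1 : (0 : ℝ) ≤ (N ω : ℝ) ^ p := by positivity
          have a2 : (0 : ℝ) ≤ |c| ^ p := by positivity
          rcases max_choice (N ω : ℝ) |c| with h | h <;> rw [h] <;> linarith
      _ = _ := by ring
  refine lt_of_le_of_lt (lintegral_mono hle) ?_
  rw [lintegral_add_right _ measurable_const, lintegral_const_mul' _ _ ENNReal.ofReal_ne_top]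
  simp only [lintegral_const, measure_univ, mul_one]
  exact ENNReal.add_lt_top.2 ⟨ENNReal.mul_lt_top ENNReal.ofReal_lt_top h, ENNReal.ofReal_lt_top⟩

/-- The third moment of a count, truncated at level `t`. -/
noncomputable def truncMoment (P : Measure Ω) (N : Ω → ℕ) (t : ℝ) : ℝ :=
  ∫ ω, {ω | (N ω : ℝ) ≤ t}.indicator (fun ω => (N ω : ℝ) ^ 3) ω ∂P

theorem truncMoment_nonneg (N : Ω → ℕ) (t : ℝ) : 0 ≤ truncMoment P N t :=
  integral_nonneg fun ω => Set.indicator_nonneg (fun ω _ => by positivity) ω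

theorem indicator_cube_le (N : Ω → ℕ) {t : ℝ} (ht : 0 ≤ t) (ω : Ω) :
    {ω | (N ω : ℝ) ≤ t}.indicator (fun ω => (N ω : ℝ) ^ 3) ω ≤ t ^ 3 := by
  by_cases h : (N ω : ℝ) ≤ t
  · rw [Set.indicator_of_mem (by exact h)]
    gcongr
  · rw [Set.indicator_of_notMem (by exact h)]
    positivity

theorem measurable_indicator_cube {N : Ω → ℕ} (hN : Measurable N) (t : ℝ) :
    Measurable ({ω | (N ω : ℝ) ≤ t}.indicator fun ω => (N ω : ℝ) ^ 3) :=
  (((measurable_of_countable fun n : ℕ => (n : ℝ)).comp hN).pow_const 3).indicator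
    (hN (MeasurableSet.of_discrete (s := {n : ℕ | (n : ℝ) ≤ t})))

theorem integrable_indicator_cube {N : Ω → ℕ} (hN : Measurable N) {t : ℝ} (ht : 0 ≤ t) :
    Integrable ({ω | (N ω : ℝ) ≤ t}.indicator fun ω => (N ω : ℝ) ^ 3) P := by
  refine Integrable.of_bound (measurable_indicator_cube hN t).aestronglyMeasurable (t ^ 3)
    (Eventually.of_forall fun ω => ?_)
  rw [Real.norm_of_nonneg (Set.indicator_nonneg (fun ω _ => by positivity) ω)]
  exact indicator_cube_le N ht ω

theorem truncMoment_le (N : Ω → ℕ) {t : ℝ} (ht : 0 ≤ t) : truncMoment P N t ≤ t ^ 3 := by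
  have h := integral_mono_of_nonneg (μ := P) (Eventually.of_forall fun ω =>
    Set.indicator_nonneg (s := {ω | (N ω : ℝ) ≤ t}) (f := fun ω => (N ω : ℝ) ^ 3)
      (fun ω _ => by positivity) ω)
    (integrable_const (t ^ 3)) (Eventually.of_forall (indicator_cube_le N ht))
  rw [truncMoment]
  simpa using h

/-- Values in (t, 2t] contribute at most (2t)³ P(N > t). This is the recursion required by
`RegVar.truncated_bound`. -/
theorem truncMoment_two_mul_le {N : Ω → ℕ} (hN : Measurable N) {t : ℝ} (ht : 0 < t) :
    truncMoment P N (2 * t) ≤ truncMoment P N t + 8 * t ^ 3 * tailFn P N t := by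
  have h1 : 8 * t ^ 3 * tailFn P N t = ∫ ω, {ω | t < (N ω : ℝ)}.indicator (fun _ => 8 * t ^ 3) ω ∂P := by
    rw [integral_indicator_const _ (measurableSet_tail hN t)]
    simp [tailFn, mul_comm]
  have hi2 : Integrable ({ω | t < (N ω : ℝ)}.indicator (fun _ : Ω => 8 * t ^ 3)) P :=
    (integrable_const _).indicator (measurableSet_tail hN t)
  rw [h1, truncMoment, truncMoment, ← integral_add (integrable_indicator_cube hN ht.le) hi2]
  refine integral_mono (integrable_indicator_cube hN (by linarith))
    ((integrable_indicator_cube hN ht.le).add hi2) fun ω => ?_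
  simp only
  by_cases h : (N ω : ℝ) ≤ t
  · rw [Set.indicator_of_mem (show ω ∈ {ω | (N ω : ℝ) ≤ 2 * t} from by
      change (N ω : ℝ) ≤ 2 * t; linarith), Set.indicator_of_mem (by exact h),
      Set.indicator_of_notMem (by exact not_lt.2 h), add_zero]
  · rw [Set.indicator_of_notMem (show ω ∉ {ω | (N ω : ℝ) ≤ t} from h), zero_add,
      Set.indicator_of_mem (show ω ∈ {ω | t < (N ω : ℝ)} from not_le.1 h)]
    exact (indicator_cube_le N (t := 2 * t) (by linarith) ω).trans (le_of_eq (by ring))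

end Tail

section Stationary

variable {Ω : Type*} [MeasurableSpace Ω] {P : Measure Ω} [IsProbabilityMeasure P]
    {A : ℤ → ℕ → Ω → ℕ} {B : ℤ → Ω → ℕ} {X : ℤ → Ω → ℕ}

theorem IsStationaryGWI.ae_innovation_eq (hX : IsStationaryGWI P A B X) (i : ℤ) :
    ∀ᵐ ω ∂P, innovation P A B X (i + 1) ω =
      offspringNoise P A X i ω + ((B (i + 1) ω : ℝ) - immigrationMean P B) := by
  filter_upwards [hX.ae_succ_eq i] with ω hω
  rw [innovation, hω, add_sub_cancel_right]
  ring

/-- Given X_i = n ≤ t, the noise has variance n σ², and the prefactor n² turns it into n³ σ²: a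
third moment of X_i, which is kept finite by the truncation. -/
theorem IsStationaryGWI.lintegral_sq_truncated (hX : IsStationaryGWI P A B X)
    (hA : MemLp (fun ω => (A 0 0 ω : ℝ)) 2 P) (hμ : offspringMean P A ∈ Set.Ioo (0 : ℝ) 1)
    (i : ℤ) {t : ℝ} (ht : 0 ≤ t) :
    ∫⁻ ω, ENNReal.ofReal (({ω | (X i ω : ℝ) ≤ t}.indicator (fun ω => (X i ω : ℝ)) ω *
      offspringNoise P A X i ω) ^ 2) ∂P =
      ENNReal.ofReal (offspringVar P A * truncMoment P (X i) t) := by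
  have hind : IndepFun (X i) (fun ω j => A (i + 1) j ω) P :=
    hX.indepFun_future hA hμ i (measurable_offspring_future (B := B) i)
  have hiid := hX.isIIDCounts hA (i + 1)
  set c : ℕ → ℝ := fun n => {n : ℕ | (n : ℝ) ≤ t}.indicator (fun n => (n : ℝ)) n with hc
  have hF : Measurable fun p : ℕ × (ℕ → ℕ) =>
      ENNReal.ofReal ((c p.1 * ∑ j ∈ Finset.range p.1, ((p.2 j : ℝ) - offspringMean P A)) ^ 2) :=
    measurable_from_prod_countable_right fun n => by
      have hs : Measurable fun y : ℕ → ℕ =>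
          ∑ j ∈ Finset.range n, ((y j : ℝ) - offspringMean P A) :=
        Finset.measurable_fun_sum _ fun j _ =>
          (measurable_of_countable (fun n : ℕ => (n : ℝ) - offspringMean P A)).comp
            (measurable_pi_apply j)
      exact ((hs.const_mul (c n)).pow_const 2).ennreal_ofReal
  have h1 := lintegral_of_indepFun hind (hX.measurable_X i) hiid.measurable_seq hF
  have h2 : ∀ n : ℕ, ∫⁻ ω, ENNReal.ofReal
      ((c n * ∑ j ∈ Finset.range n, ((A (i + 1) j ω : ℝ) - offspringMean P A)) ^ 2) ∂P =
      ENNReal.ofReal (c n ^ 2 * (n * offspringVar P A)) := by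
    intro n
    have := hiid.lintegral_sq_sum_Ico 0 n
    simp only [← Finset.range_eq_Ico, Nat.sub_zero] at this
    simp only [mul_pow, ENNReal.ofReal_mul (sq_nonneg (c n))]
    rw [lintegral_const_mul' _ _ ENNReal.ofReal_ne_top, this, ENNReal.ofReal_mul (Nat.cast_nonneg n)]
    simp
  simp only [h2] at h1
  calc _ = ∫⁻ ω, ENNReal.ofReal ((c (X i ω) * ∑ j ∈ Finset.range (X i ω),
        ((A (i + 1) j ω : ℝ) - offspringMean P A)) ^ 2) ∂P := rfl
    _ = _ := h1
    _ = ∫⁻ ω, ENNReal.ofReal (offspringVar P A *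
        {ω | (X i ω : ℝ) ≤ t}.indicator (fun ω => (X i ω : ℝ) ^ 3) ω) ∂P := by
      refine lintegral_congr fun ω => ?_
      congr 1
      by_cases h : (X i ω : ℝ) ≤ t
      · rw [hc]
        simp only
        rw [Set.indicator_of_mem (by exact h), Set.indicator_of_mem (by exact h)]
        ring
      · rw [hc]
        simp only
        rw [Set.indicator_of_notMem (by exact h), Set.indicator_of_notMem (by exact h)]
        ring
    _ = _ := by
      rw [truncMoment, ← integral_const_mul, ofReal_integral_eq_lintegral_ofReal
        ((integrable_indicator_cube (hX.measurable_X i) ht).const_mul _)]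
      exact Eventually.of_forall fun ω => mul_nonneg (variance_nonneg _ _)
        (Set.indicator_nonneg (fun ω _ => by positivity) ω)

theorem norm_pairProcess (k : ℤ) (ω : Ω) : ‖ pairProcess P A B X k ω‖ =
    max ((X k ω : ℝ) ^ (3 / 2 : ℝ)) ((X k ω : ℝ) * |innovation P A B X (k + 1) ω|) := by
  rw [pairProcess, Prod.norm_def]
  simp only [Real.norm_eq_abs, abs_mul]
  rw [abs_of_nonneg (Real.rpow_nonneg (Nat.cast_nonneg _) _), abs_of_nonneg (Nat.cast_nonneg _)]

/-- Values of the process that are large although the generation is small are negligible. -/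
theorem IsStationaryGWI.small_generation (hX : IsStationaryGWI P A B X) {α : ℝ}
    (hA : MemLp (fun ω => (A 0 0 ω : ℝ)) 2 P) (hμ : offspringMean P A ∈ Set.Ioo (0 : ℝ) 1)
    (hα : α ∈ Set.Ioo (1 : ℝ) 2) (hB : RegVar (tailFn P (B 0)) α) (i : ℤ) {ε η : ℝ} (hε : 0 < ε)
    (hη : 0 < η) :
    ∃ δ₀ : ℝ, 0 < δ₀ ∧ ∀ δ : ℝ, 0 < δ → δ < δ₀ → ∀ᶠ x : ℝ in atTop,
      P.real {ω | ε * x < ‖ pairProcess P A B X i ω‖ ∧ (X i ω : ℝ) ^ (3 / 2 : ℝ) ≤ δ * x} ≤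
        η * tailFn P (X 0) (x ^ (2 / 3 : ℝ)) := by
  have hg : RegVar (tailFn P (X 0)) α := hX.regVar_X hA hμ hα hB
  have hgpos := hg.pos (tailFn_antitone _) (tailFn_nonneg _)
  have hgi : tailFn P (X i) = tailFn P (X 0) := tailFn_congr (hX.identDistrib_X i)
  have hbi : tailFn P (B (i + 1)) = tailFn P (B 0) := tailFn_congr (hX.identDistrib_B (i + 1))
  set β := 2 * α / 3 with hβ
  have hβ2 : β < 2 := by rw [hβ]; linarith [hα.2]
  have hβ0 : 0 < β := by rw [hβ]; linarith [hα.1]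
  set v := offspringVar P A
  have hv0 : 0 ≤ v := variance_nonneg _ _
  -- the third moment bound
  obtain ⟨C, t₀, hC, ht₀, htr⟩ := hg.truncated_bound (m := truncMoment P (X i))
    (tailFn_antitone _) (tailFn_nonneg _) hα.2 (truncMoment_nonneg _)
    (fun t ht => truncMoment_le _ ht.le)
    (fun t ht => by rw [← hgi]; exact truncMoment_two_mul_le (hX.measurable_X i) ht)
  -- the contribution of the immigrants
  set p := (β + α) / 2 with hp
  -- Both sides of β < p < α matter: p < α makes the moments finite, and p > β makes x^{-p}
  -- negligible against P(X_0^{3/2} > x).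
  have hpα : p < α := by rw [hp, hβ]; linarith [hα.1]
  have hβp : β < p := by rw [hp, hβ]; linarith [hα.1]
  have hp0 : 0 < p := hβ0.trans hβp
  have hXcast : Measurable fun ω => (X i ω : ℝ) := (measurable_of_countable _).comp (hX.measurable_X i)
  have hWm : Measurable fun ω => |(B (i + 1) ω : ℝ) - immigrationMean P B| :=
    (measurable_of_countable (fun n : ℕ => |(n : ℝ) - immigrationMean P B|)).comp
      (hX.measurable_B (i + 1))
  obtain ⟨K, hK0, hK⟩ := measureReal_lt_mul_le (P := P) (U := fun ω => (X i ω : ℝ))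
    (W := fun ω => |(B (i + 1) ω : ℝ) - immigrationMean P B|) hXcast hWm
    (fun ω => Nat.cast_nonneg _) (fun ω => abs_nonneg _)
    ((hX.indepFun_future hA hμ i (measurable_envSigma_right (p := (i < ·)) (lt_add_one i))).comp
      (φ := fun n : ℕ => (n : ℝ)) (ψ := fun n : ℕ => |(n : ℝ) - immigrationMean P B|)
      (measurable_of_countable _) (measurable_of_countable _)) hp0
    (lintegral_rpow_lt_top (hX.measurable_X i) (by rw [hgi]; exact hg) hp0 hpα)
    (lintegral_abs_sub_rpow_lt_top hp0 _
      (lintegral_rpow_lt_top (hX.measurable_B _) (by rw [hbi]; exact hB) hp0 hpα))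
  have hKlim : Tendsto (fun x : ℝ => K * (ε / 2) ^ (-p) *
      (x ^ (-p) / tailFn P (X 0) (x ^ (2 / 3 : ℝ)))) atTop (𝓝 0) := by
    have h1 := (hg.tendsto_rpow_div (p := 3 * p / 2) (tailFn_antitone _) (tailFn_nonneg _)
      (by linarith [hα.1]) (by rw [hβ] at hβp; linarith)).comp tendsto_rpow_two_thirds
    have h2 := h1.const_mul (K * (ε / 2) ^ (-p))
    rw [mul_zero] at h2
    refine h2.congr' ?_
    filter_upwards [eventually_ge_atTop 0] with x hx
    simp only [Function.comp]
    rw [← Real.rpow_mul hx, show 2 / 3 * -(3 * p / 2) = -p by ring]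
  -- the choice of the threshold
  have hδlim : Tendsto (fun δ : ℝ => 8 * v * C / ε ^ 2 * δ ^ (2 - β)) (𝓝 0) (𝓝 0) := by
    have : ContinuousAt (fun δ : ℝ => 8 * v * C / ε ^ 2 * δ ^ (2 - β)) 0 :=
      ContinuousAt.mul (by fun_prop) (ContinuousAt.rpow_const (by fun_prop) (Or.inr (by linarith)))
    have h2 := this.tendsto
    rwa [Real.zero_rpow (by linarith), mul_zero] at h2
  obtain ⟨δ₁, hδ₁, hδ₁'⟩ := Metric.eventually_nhds_iff.1
    (hδlim.eventually (gt_mem_nhds (half_pos hη)))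
  -- With δ < ε the first coordinate, at most δx, cannot be what makes the norm exceed εx, so X_i
  -- |M_{i+1}| is.
  refine ⟨min δ₁ ε, lt_min hδ₁ hε, fun δ hδ0 hδ => ?_⟩
  have hδε : δ < ε := hδ.trans_le (min_le_right _ _)
  -- At t = (δx)^{2/3} one has t³ = δ²x², and the tail at t is at most 2 δ^{-β} times the tail at
  -- x^{2/3}. Chebyshev at level εx/2 leaves the factor δ^{2-β}, which vanishes with δ as β < 2; the
  -- 8 is this 2 times the 4 from (ε/2)².
  have hδs : 8 * v * C / ε ^ 2 * δ ^ (2 - β) < η / 2 := hδ₁' (by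
    simpa [abs_of_pos hδ0] using hδ.trans_le (min_le_left _ _))
  have hbδ : ∀ᶠ x : ℝ in atTop, tailFn P (X 0) ((δ * x) ^ (2 / 3 : ℝ)) ≤
      2 * δ ^ (-β) * tailFn P (X 0) (x ^ (2 / 3 : ℝ)) := by
    have hpos : 0 < δ ^ (-β) := by positivity
    filter_upwards [(regVar_comp_rpow hg hδ0).eventually
      (gt_mem_nhds (show δ ^ (-β) < 2 * δ ^ (-β) by linarith))] with x hx
    exact ((div_lt_iff₀ (hgpos _)).1 hx).le
  have ht₀' : ∀ᶠ x : ℝ in atTop, t₀ ≤ (δ * x) ^ (2 / 3 : ℝ) :=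
    (tendsto_rpow_two_thirds.comp (tendsto_id.const_mul_atTop hδ0)).eventually
      (eventually_ge_atTop t₀)
  filter_upwards [hbδ, ht₀', hKlim.eventually (gt_mem_nhds (half_pos hη)), eventually_gt_atTop 0]
    with x hx1 hx2 hx3 hx0
  set t := (δ * x) ^ (2 / 3 : ℝ) with ht
  have hδx : 0 < δ * x := by positivity
  have htpos : 0 < t := by positivity
  set b := tailFn P (X 0) (x ^ (2 / 3 : ℝ)) with hb
  have hbpos : 0 < b := hgpos _
  set S := offspringNoise P A X i
  set S' : Ω → ℝ := fun ω => {ω | (X i ω : ℝ) ≤ t}.indicator (fun ω => (X i ω : ℝ)) ω * S ω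
    with hS'
  have hS'm : Measurable S' := (hXcast.indicator (hX.measurable_X i
    (MeasurableSet.of_discrete (s := {n : ℕ | (n : ℝ) ≤ t})))).mul (hX.measurable_offspringNoise i)
  have hsub : P.real {ω | ε * x < ‖ pairProcess P A B X i ω‖ ∧ (X i ω : ℝ) ^ (3 / 2 : ℝ) ≤ δ * x} ≤
      P.real ({ω | ε / 2 * x < |S' ω|} ∪
        {ω | ε / 2 * x < (X i ω : ℝ) * |(B (i + 1) ω : ℝ) - immigrationMean P B|}) := by
    refine ENNReal.toReal_mono (measure_ne_top _ _) (measure_mono_ae ?_)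
    filter_upwards [hX.ae_innovation_eq i] with ω hω hlt
    obtain ⟨h1, h2⟩ := hlt
    have hXt : (X i ω : ℝ) ≤ t :=
      not_lt.1 fun h => absurd h2 (not_le.2 ((lt_rpow_three_halves_iff hδx.le (by positivity)).2 h))
    rw [norm_pairProcess] at h1
    have h3 : ε * x < (X i ω : ℝ) * |innovation P A B X (i + 1) ω| := by
      rcases lt_max_iff.1 h1 with h | h
      · exfalso
        have : δ * x < ε * x := by gcongr
        linarith
      · exact h
    by_contra hcon
    obtain ⟨h4, h5⟩ := not_or.1 hcon
    replace h4 : |S' ω| ≤ ε / 2 * x := not_lt.1 h4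
    replace h5 : (X i ω : ℝ) * |(B (i + 1) ω : ℝ) - immigrationMean P B| ≤ ε / 2 * x := not_lt.1 h5
    have h6 : |S' ω| = (X i ω : ℝ) * |S ω| := by
      simp only [hS']
      rw [Set.indicator_of_mem (by exact hXt), abs_mul, abs_of_nonneg (Nat.cast_nonneg _)]
    rw [hω] at h3
    have h7 := mul_le_mul_of_nonneg_left
      (abs_add_le (S ω) ((B (i + 1) ω : ℝ) - immigrationMean P B))
      (Nat.cast_nonneg (X i ω) : (0 : ℝ) ≤ X i ω)
    rw [mul_add] at h7
    linarith
  refine hsub.trans ((measureReal_union_le _ _).trans ?_)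
  have hfirst : P.real {ω | ε / 2 * x < |S' ω|} ≤ η / 2 * b := by
    have h1 := measureReal_lt_abs_le (P := P) hS'm (c := ε / 2 * x) (by positivity)
      (mul_nonneg hv0 (truncMoment_nonneg (P := P) (X i) t))
      (hX.lintegral_sq_truncated hA hμ i htpos.le).le
    have h2 := htr t hx2
    have ht3 : t ^ 3 = δ ^ 2 * x ^ 2 := by
      rw [ht, ← Real.rpow_natCast, ← Real.rpow_mul hδx.le]
      norm_num
      ring
    calc _ ≤ _ := h1
      _ ≤ v * (C * (t ^ 3 * (2 * δ ^ (-β) * b))) / (ε / 2 * x) ^ 2 := by gcongr; exact h2.trans (by gcongr)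
      _ = 8 * v * C / ε ^ 2 * δ ^ (2 - β) * b := by
        rw [ht3, Real.rpow_sub hδ0, Real.rpow_neg hδ0.le]
        norm_num
        field_simp
        ring
      _ ≤ _ := by gcongr
  have hsecond := hK (ε / 2 * x) (by positivity)
  rw [Real.mul_rpow (by positivity) hx0.le, ← mul_assoc] at hsecond
  have h3 : K * (ε / 2) ^ (-p) * x ^ (-p) ≤ η / 2 * b := by
    rw [← mul_div_assoc, div_lt_iff₀ hbpos] at hx3
    exact hx3.le
  linarith

end Stationary

/-! ### Convergence in measure and in distribution -/

theorem tendstoInMeasure_pi {Ω ι κ : Type*} [MeasurableSpace Ω] [Fintype κ] {E : κ → Type*}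
    [∀ k, PseudoEMetricSpace (E k)] {P : Measure Ω} {l : Filter ι} {f : ι → Ω → ∀ k, E k}
    {g : Ω → ∀ k, E k} (h : ∀ k, TendstoInMeasure P (fun i ω => f i ω k) l (fun ω => g ω k)) :
    TendstoInMeasure P f l g := by
  intro ε hε
  have hsum : Tendsto (fun i => ∑ k, P {ω | ε ≤ edist (f i ω k) (g ω k)}) l (𝓝 0) := by
    simpa using tendsto_finsetSum Finset.univ fun k _ => h k ε hε
  refine tendsto_of_tendsto_of_tendsto_of_le_of_le tendsto_const_nhds hsum (fun _ => zero_le) ?_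
  intro i
  refine (measure_mono ?_).trans (measure_iUnion_fintype_le P _)
  intro ω (hω : ε ≤ edist (f i ω) (g ω))
  rw [edist_pi_def, Finset.le_sup_iff (by simpa using hε)] at hω
  obtain ⟨k, _, hk⟩ := hω
  exact Set.mem_iUnion.2 ⟨k, hk⟩

theorem tendstoInMeasure_prodMk {Ω ι E F : Type*} [MeasurableSpace Ω]
    [PseudoEMetricSpace E] [PseudoEMetricSpace F] {P : Measure Ω} {l : Filter ι} {f : ι → Ω → E}
    {f' : ι → Ω → F} {g : Ω → E} {g' : Ω → F} (h : TendstoInMeasure P f l g)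
    (h' : TendstoInMeasure P f' l g') :
    TendstoInMeasure P (fun i ω => (f i ω, f' i ω)) l (fun ω => (g ω, g' ω)) := by
  intro ε hε
  have hsum := (h ε hε).add (h' ε hε)
  rw [add_zero] at hsum
  refine tendsto_of_tendsto_of_tendsto_of_le_of_le tendsto_const_nhds hsum (fun _ => zero_le) ?_
  intro i
  refine (measure_mono ?_).trans (measure_union_le _ _)
  intro ω (hω : ε ≤ edist (f i ω, f' i ω) (g ω, g' ω))
  rw [Prod.edist_eq, le_max_iff] at hω
  exact hω

/-- Conditioning on the random index, written out: under independence the sequence may be evaluated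
at a frozen index. -/
theorem measure_random_index {Ω F : Type*} [MeasurableSpace Ω] [MeasurableSpace F] {P : Measure Ω}
    [IsProbabilityMeasure P] {N : Ω → ℕ} {Y : ℕ → Ω → F} (hN : Measurable N)
    (hY : ∀ n, Measurable (Y n)) (hind : IndepFun N (fun ω n => Y n ω) P) (u : Set ℕ) {t : Set F}
    (ht : MeasurableSet t) :
    P (N ⁻¹' u ∩ {ω | Y (N ω) ω ∈ t}) =
      ∫⁻ ω, (N ⁻¹' u).indicator (fun ω => P (Y (N ω) ⁻¹' t)) ω ∂P := by
  have hs : ∀ n : ℕ, MeasurableSet {w : ℕ → F | n ∈ u ∧ w n ∈ t} := fun n =>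
    (MeasurableSet.const (n ∈ u)).inter (measurable_pi_apply n ht)
  have hF : Measurable fun p : ℕ × (ℕ → F) =>
      {w : ℕ → F | p.1 ∈ u ∧ w p.1 ∈ t}.indicator (fun _ => (1 : ℝ≥0∞)) p.2 :=
    measurable_from_prod_countable_right fun n => measurable_const.indicator (hs n)
  have h := lintegral_of_indepFun hind hN (measurable_pi_lambda _ hY) hF
  have hYN : Measurable fun ω => Y (N ω) ω := by
    have : Measurable fun p : ℕ × Ω => Y p.1 p.2 :=
      measurable_from_prod_countable_right fun n => hY n
    exact this.comp (hN.prodMk measurable_id)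
  change P (N ⁻¹' u ∩ (fun ω => Y (N ω) ω) ⁻¹' t) = _
  rw [← lintegral_indicator_one ((hN MeasurableSet.of_discrete).inter (hYN ht))]
  refine Eq.trans ?_ (h.trans ?_)
  · rfl
  · refine lintegral_congr fun ω => ?_
    by_cases hω : N ω ∈ u
    · rw [Set.indicator_of_mem (by exact hω), ← lintegral_indicator_one (hY (N ω) ht)]
      refine lintegral_congr fun ω' => ?_
      by_cases hω' : Y (N ω) ω' ∈ t
      · rw [Set.indicator_of_mem (by exact ⟨hω, hω'⟩), Set.indicator_of_mem (by exact hω')]; rfl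
      · rw [Set.indicator_of_notMem (by exact fun hh => hω' hh.2),
          Set.indicator_of_notMem (by exact hω')]
    · rw [Set.indicator_of_notMem (by exact hω)]
      refine (lintegral_congr fun ω' => ?_).trans lintegral_zero
      exact Set.indicator_of_notMem (by exact fun hh => hω hh.1) _

/-- A sequence of independent, weakly convergent variables, evaluated at a random index that tends
to infinity, is asymptotically independent of the index. -/
theorem tendsto_mixture {Ω Ω' F : Type*} [MeasurableSpace Ω] [MeasurableSpace Ω']
    [TopologicalSpace F] [SecondCountableTopology F] [TopologicalSpace.PseudoMetrizableSpace F]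
    [MeasurableSpace F] [BorelSpace F] {P : Measure Ω} [IsProbabilityMeasure P]
    {Q : Measure Ω'} [IsProbabilityMeasure Q] {N : Ω → ℕ} {Y : ℕ → Ω → F} {Z : Ω' → F}
    (hN : Measurable N) (hY : ∀ n, Measurable (Y n)) (hind : IndepFun N (fun ω n => Y n ω) P)
    (hYZ : TendstoInDistribution Y atTop Z (fun _ => P) Q) {ι : Type*} {l : Filter ι}
    [l.IsCountablyGenerated]
    {T : ι → Set ℕ} (hT : ∀ n₀ : ℕ, ∀ᶠ i in l, ∀ n ∈ T i, n₀ ≤ n)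
    (a : ι → ℕ → ℝ) {π : ProbabilityMeasure ℝ} {μ : ι → ProbabilityMeasure ℝ}
    (hμ : ∀ i, (μ i : Measure ℝ) = (P[|N ⁻¹' T i]).map fun ω => a i (N ω))
    (hμπ : Tendsto μ l (𝓝 π)) {ν : ι → ProbabilityMeasure (ℝ × F)}
    (hν : ∀ i, (ν i : Measure (ℝ × F)) = (P[|N ⁻¹' T i]).map fun ω => (a i (N ω), Y (N ω) ω))
    {ν' : ProbabilityMeasure (ℝ × F)} (hν' : (ν' : Measure (ℝ × F)) = (π : Measure ℝ).prod (Q.map Z)) :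
    Tendsto ν l (𝓝 ν') := by
  have hZm : AEMeasurable Z Q := hYZ.aemeasurable_limit
  let κZ : ProbabilityMeasure F := ⟨Q.map Z, Measure.isProbabilityMeasure_map hZm⟩
  -- Rectangles whose sides have null boundary form a π-system that is rich enough to determine weak
  -- convergence, and on them the limit measure is a product.
  let S : Set (Set (ℝ × F)) := {t | ∃ (a : Set ℝ) (b : Set F),
    MeasurableSet a ∧ π (frontier a) = 0 ∧ MeasurableSet b ∧ κZ (frontier b) = 0 ∧ t = a ×ˢ b}
  have hS : IsPiSystem S := by
    rintro - ⟨a, b, ameas, ha, bmeas, hb, rfl⟩ - ⟨a', b', a'meas, ha', b'meas, hb', rfl⟩ -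
    refine ⟨a ∩ a', b ∩ b', ameas.inter a'meas, ?_, bmeas.inter b'meas, ?_, Set.prod_inter_prod⟩
    · rw [ProbabilityMeasure.null_iff_toMeasure_null] at ha ha' ⊢
      exact null_frontier_inter ha ha'
    · rw [ProbabilityMeasure.null_iff_toMeasure_null] at hb hb' ⊢
      exact null_frontier_inter hb hb'
  have hYN : Measurable fun ω => Y (N ω) ω := by
    have : Measurable fun p : ℕ × Ω => Y p.1 p.2 :=
      measurable_from_prod_countable_right fun n => hY n
    exact this.comp (hN.prodMk measurable_id)
  have haN : ∀ i, Measurable fun ω => a i (N ω) := fun i => (measurable_of_countable (a i)).comp hN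
  refine hS.tendsto_probabilityMeasure_of_tendsto_of_mem ?_ ?_ ?_
  · rintro - ⟨a, b, ameas, ha, bmeas, hb, rfl⟩
    exact ameas.prod bmeas
  · let : PseudoMetricSpace F := TopologicalSpace.pseudoMetrizableSpacePseudoMetric F
    intro u u_open x xu
    obtain ⟨ε, εpos, hε⟩ : ∃ ε > 0, Metric.ball x ε ⊆ u := Metric.isOpen_iff.1 u_open x xu
    obtain ⟨r, hr, hr0⟩ : ∃ r ∈ Set.Ioo 0 ε,
        (π : Measure ℝ) (frontier (Metric.thickening r {x.1})) = 0 :=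
      exists_null_frontier_thickening _ _ εpos
    obtain ⟨r', hr', hr0'⟩ : ∃ r ∈ Set.Ioo 0 ε,
        (κZ : Measure F) (frontier (Metric.thickening r {x.2})) = 0 :=
      exists_null_frontier_thickening _ _ εpos
    rw [Metric.thickening_singleton] at hr0 hr0'
    refine ⟨Metric.ball x.1 r ×ˢ Metric.ball x.2 r', ⟨_, _, measurableSet_ball, ?_,
      measurableSet_ball, ?_, rfl⟩, ?_, ?_⟩
    · rwa [ProbabilityMeasure.null_iff_toMeasure_null]
    · rwa [ProbabilityMeasure.null_iff_toMeasure_null]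
    · exact (Metric.isOpen_ball.prod Metric.isOpen_ball).mem_nhds
        ⟨Metric.mem_ball_self hr.1, Metric.mem_ball_self hr'.1⟩
    · refine subset_trans ?_ hε
      rintro ⟨y, z⟩ ⟨hy, hz⟩
      rw [Metric.mem_ball, Prod.dist_eq]
      exact max_lt (lt_trans hy hr.2) (lt_trans hz hr'.2)
  · rintro - ⟨s, t, hs, hs0, ht, ht0, rfl⟩
    have hlim1 : Tendsto (fun i => (μ i : Measure ℝ).real s) l (𝓝 ((π : Measure ℝ).real s)) := by
      have := ProbabilityMeasure.tendsto_measure_of_null_frontier_of_tendsto hμπ hs0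
      exact (NNReal.continuous_coe.tendsto _).comp this
    have hlim2 : Tendsto (fun n => P.real (Y n ⁻¹' t)) atTop (𝓝 ((Q.map Z).real t)) := by
      have := ProbabilityMeasure.tendsto_measure_of_null_frontier_of_tendsto hYZ.tendsto ht0
      have h2 := (NNReal.continuous_coe.tendsto _).comp this
      refine h2.congr fun n => ?_
      change ((P.map (Y n)).real t) = _
      rw [map_measureReal_apply (hY n) ht]
    set q := (Q.map Z).real t with hq
    have hTm : ∀ i, MeasurableSet (N ⁻¹' T i) := fun i => hN MeasurableSet.of_discrete
    have hμs : ∀ i, (μ i : Measure ℝ) s = (P (N ⁻¹' T i))⁻¹ * P (N ⁻¹' (T i ∩ a i ⁻¹' s)) := by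
      intro i
      rw [hμ, Measure.map_apply (haN i) hs, cond_apply (hTm i)]
      rfl
    have hνs : ∀ i, (ν i : Measure (ℝ × F)) (s ×ˢ t) = (P (N ⁻¹' T i))⁻¹ *
        P (N ⁻¹' (T i ∩ a i ⁻¹' s) ∩ {ω | Y (N ω) ω ∈ t}) := by
      intro i
      rw [hν, Measure.map_apply ((haN i).prodMk hYN) (hs.prod ht), cond_apply (hTm i)]
      congr 2
      ext ω
      change (N ω ∈ T i ∧ a i (N ω) ∈ s ∧ Y (N ω) ω ∈ t) ↔
        ((N ω ∈ T i ∧ a i (N ω) ∈ s) ∧ Y (N ω) ω ∈ t)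
      rw [and_assoc]
    -- Eventually every index in T i exceeds n₀, where P(Y n ∈ t) is within ε of its limit q.
    -- Averaging over the law of the index gives the same accuracy for the rectangle, whatever the
    -- dependence of a i (N) on N.
    have hbound : ∀ ε : ℝ, 0 < ε → ∀ᶠ i in l, |(ν i : Measure (ℝ × F)).real (s ×ˢ t) -
        q * (μ i : Measure ℝ).real s| ≤ ε := by
      intro ε hε
      obtain ⟨n₀, hn₀⟩ := eventually_atTop.1 (hlim2.eventually (Metric.ball_mem_nhds q hε))
      filter_upwards [hT n₀] with i hi
      set u := T i ∩ a i ⁻¹' s with hu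
      have hq : ∀ n ∈ u, |P.real (Y n ⁻¹' t) - q| < ε := fun n hn => hn₀ n (hi n hn.1)
      have hum : MeasurableSet (N ⁻¹' u) := hN MeasurableSet.of_discrete
      have hup : (ν i : Measure (ℝ × F)).real (s ×ˢ t) ≤ (q + ε) * (μ i : Measure ℝ).real s := by
        refine ENNReal.toReal_le_of_le_ofReal (mul_nonneg (by positivity) measureReal_nonneg) ?_
        rw [ENNReal.ofReal_mul (by positivity), ofReal_measureReal, hνs, hμs, mul_left_comm,
          measure_random_index hN hY hind u ht]
        gcongr
        rw [← lintegral_indicator_const hum]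
        refine lintegral_mono fun ω => ?_
        refine Set.indicator_le_indicator' fun hω => ?_
        rw [← ofReal_measureReal]
        exact ENNReal.ofReal_le_ofReal (by linarith [(abs_lt.1 (hq _ hω)).2])
      have hlow : (q - ε) * (μ i : Measure ℝ).real s ≤ (ν i : Measure (ℝ × F)).real (s ×ˢ t) := by
        rcases le_or_gt q ε with hqε | hqε
        · exact (mul_nonpos_of_nonpos_of_nonneg (by linarith) measureReal_nonneg).trans
            measureReal_nonneg
        refine (ENNReal.ofReal_le_iff_le_toReal (measure_ne_top _ _)).1 ?_
        rw [ENNReal.ofReal_mul (by linarith), ofReal_measureReal, hνs, hμs, mul_left_comm,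
          measure_random_index hN hY hind u ht]
        gcongr
        rw [← lintegral_indicator_const hum]
        refine lintegral_mono fun ω => ?_
        refine Set.indicator_le_indicator' fun hω => ?_
        rw [← ofReal_measureReal]
        exact ENNReal.ofReal_le_ofReal (by linarith [(abs_lt.1 (hq _ hω)).1])
      have h1 : (μ i : Measure ℝ).real s ≤ 1 := measureReal_le_one
      have h0 : 0 ≤ (μ i : Measure ℝ).real s := measureReal_nonneg
      rw [abs_le]
      constructor <;> nlinarith
    have hlim : Tendsto (fun i => (ν i : Measure (ℝ × F)).real (s ×ˢ t)) l
        (𝓝 (q * (π : Measure ℝ).real s)) := by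
      have h1 : Tendsto (fun i => (ν i : Measure (ℝ × F)).real (s ×ˢ t) -
          q * (μ i : Measure ℝ).real s) l (𝓝 0) := by
        rw [Metric.tendsto_nhds]
        intro ε hε
        filter_upwards [hbound (ε / 2) (half_pos hε)] with i hi
        rw [Real.dist_eq, sub_zero]
        linarith
      have h2 := h1.add (hlim1.const_mul q)
      rw [zero_add] at h2
      exact h2.congr fun i => by ring
    have hν'r : (ν' : Measure (ℝ × F)).real (s ×ˢ t) = q * (π : Measure ℝ).real s := by
      rw [hν', measureReal_prod_prod, mul_comm]
    rw [← NNReal.tendsto_coe]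
    rw [← hν'r] at hlim
    exact hlim

/-! ### The path started from a large generation -/

section Stationary

variable {Ω : Type*} [MeasurableSpace Ω] {P : Measure Ω} [IsProbabilityMeasure P]
    {A : ℤ → ℕ → Ω → ℕ} {B : ℤ → Ω → ℕ} {X : ℤ → Ω → ℕ}

/-- The path driven by the random environment. -/
def envPath (A : ℤ → ℕ → Ω → ℕ) (B : ℤ → Ω → ℕ) (s : ℤ) (n k : ℕ) (ω : Ω) : ℕ :=
  gwPath (fun i j => A i j ω) (fun i => B i ω) s n k

/-- The centered offspring sum over the first `d` individuals of generation `s + k`. -/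
noncomputable def centeredSum (P : Measure Ω) (A : ℤ → ℕ → Ω → ℕ) (s : ℤ) (k d : ℕ) (ω : Ω) : ℝ :=
  ∑ j ∈ Finset.range d, ((A (s + k + 1) j ω : ℝ) - offspringMean P A)

theorem envPath_succ (s : ℤ) (n k : ℕ) (ω : Ω) : (envPath A B s n (k + 1) ω : ℝ) =
    offspringMean P A * envPath A B s n k ω + centeredSum P A s k (envPath A B s n k ω) ω +
      B (s + k + 1) ω := by
  simp [envPath, gwPath, centeredSum, Finset.sum_sub_distrib, mul_comm]

theorem IsStationaryGWI.measurable_centeredSum (hX : IsStationaryGWI P A B X) (s : ℤ) (k : ℕ)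
    {d : Ω → ℕ} (hd : Measurable d) : Measurable fun ω => centeredSum P A s k (d ω) ω :=
  measurable_sum_range (a := fun j ω => ((A (s + k + 1) j ω : ℝ) - offspringMean P A))
    (fun j => (measurable_of_countable (fun n : ℕ => (n : ℝ) - offspringMean P A)).comp
      (hX.measurable_A _ j)) hd

theorem sq_centeredSum_sub (s : ℤ) (k d d' : ℕ) (ω : Ω) :
    (centeredSum P A s k d ω - centeredSum P A s k d' ω) ^ 2 =
      (∑ j ∈ Finset.Ico (min d d') (max d d'),
        ((A (s + k + 1) j ω : ℝ) - offspringMean P A)) ^ 2 := by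
  rcases le_total d d' with h | h
  · rw [min_eq_left h, max_eq_right h, Finset.sum_Ico_eq_sub _ h, centeredSum, centeredSum]
    ring
  · rw [min_eq_right h, max_eq_left h, Finset.sum_Ico_eq_sub _ h, centeredSum, centeredSum]

/-- The two sums share a row and differ by the summands between the two lengths. The random length
depends on the environment up to time s + k only, hence is independent of that row, and Wald's
second identity applies. -/
theorem IsStationaryGWI.lintegral_sq_centeredSum_sub (hX : IsStationaryGWI P A B X)
    (hA : MemLp (fun ω => (A 0 0 ω : ℝ)) 2 P) (s : ℤ) (n k d : ℕ) :
    ∫⁻ ω, ENNReal.ofReal ((centeredSum P A s k (envPath A B s n k ω) ω -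
      centeredSum P A s k d ω) ^ 2) ∂P =
    (∫⁻ ω, ENNReal.ofReal |(envPath A B s n k ω : ℝ) - d| ∂P) *
      ENNReal.ofReal (offspringVar P A) := by
  have hm : Measurable[envSigma A B (· ≤ s + k)] (envPath A B s n k) :=
    measurable_gwPath_envSigma s n k
  have hm' : Measurable (envPath A B s n k) := hX.measurable_path s n k
  have hcomp : ∀ f : ℕ → ℕ × ℕ, Measurable f := fun f => measurable_of_countable f
  have hi : IndepFun (fun ω => (min (envPath A B s n k ω) d, max (envPath A B s n k ω) d))
      (fun ω j => A (s + k + 1) j ω) P :=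
    (hX.indepFun_of_envSigma (p := (· ≤ s + k)) (q := (s + k + 1 ≤ ·)) (fun i h => by omega) hm
      (measurable_offspring_envSigma _)).comp
      (φ := fun n : ℕ => (min n d, max n d)) (hcomp _) measurable_id
  have h := (hX.isIIDCounts hA (s + k + 1)).lintegral_sq_random_sum
    (N₁ := fun ω => min (envPath A B s n k ω) d) (N₂ := fun ω => max (envPath A B s n k ω) d)
    (hm'.min measurable_const) (hm'.max measurable_const) hi
  simp only [sq_centeredSum_sub]
  rw [h]
  congr 1
  refine lintegral_congr fun ω => ?_
  rw [← ENNReal.ofReal_natCast]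
  congr 1
  rw [Nat.cast_sub min_le_max, Nat.cast_max, Nat.cast_min, max_sub_min_eq_abs, abs_sub_comm]

/-- Induction over generations: the deviation is multiplied by m and receives the offspring noise,
of order √n since its second moment is of order n, and the immigrants, of order 1. -/
theorem IsStationaryGWI.lintegral_abs_envPath_sub_le (hX : IsStationaryGWI P A B X)
    (hA : MemLp (fun ω => (A 0 0 ω : ℝ)) 2 P) (hμ : offspringMean P A ∈ Set.Ioo (0 : ℝ) 1)
    (hBfin : ∫⁻ ω, (B 0 ω : ℝ≥0∞) ∂P < ∞) (s : ℤ) (k : ℕ) :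
    ∃ C : ℝ, 0 ≤ C ∧ ∀ n : ℕ, 1 ≤ n →
      ∫⁻ ω, ENNReal.ofReal |(envPath A B s n k ω : ℝ) - offspringMean P A ^ k * n| ∂P ≤
        ENNReal.ofReal (C * √n) := by
  set m := offspringMean P A with hm
  set v := offspringVar P A with hv
  have hv0 : 0 ≤ v := variance_nonneg _ _
  have hcast : Measurable fun n : ℕ => (n : ℝ) := measurable_of_countable _
  induction k with
  | zero => exact ⟨0, le_rfl, fun n _ => by simp [envPath, gwPath]⟩
  | succ k ih =>
    obtain ⟨C, hC, ih⟩ := ih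
    set b := (∫⁻ ω, (B 0 ω : ℝ≥0∞) ∂P).toReal with hb
    -- The three terms are the inherited deviation, the noise, and the immigration, the latter
    -- absorbed through 1 ≤ √n.
    refine ⟨m * C + ((1 + C) * v + 1) / 2 + b, by have := hμ.1; positivity, fun n hn => ?_⟩
    have hn1 : (1 : ℝ) ≤ n := by exact_mod_cast hn
    have hsq : 1 ≤ √(n : ℝ) := Real.one_le_sqrt.2 hn1
    have hsqn : √(n : ℝ) * √n = n := Real.mul_self_sqrt (by positivity)
    have hpm : Measurable fun ω => (envPath A B s n k ω : ℝ) := hcast.comp (hX.measurable_path s n k)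
    set S : Ω → ℝ := fun ω => centeredSum P A s k (envPath A B s n k ω) ω with hS
    have hSm : Measurable S := hX.measurable_centeredSum s k (hX.measurable_path s n k)
    have hmk : m ^ k ≤ 1 := pow_le_one₀ hμ.1.le hμ.2.le
    have hmk0 : 0 ≤ m ^ k := pow_nonneg hμ.1.le k
    have hmean : ∫⁻ ω, ENNReal.ofReal |(envPath A B s n k ω : ℝ) - (0 : ℕ)| ∂P ≤
        ENNReal.ofReal ((1 + C) * n) := by
      calc _ ≤ ∫⁻ ω, (ENNReal.ofReal |(envPath A B s n k ω : ℝ) - m ^ k * n| +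
            ENNReal.ofReal (m ^ k * n)) ∂P := by
            refine lintegral_mono fun ω => ?_
            rw [← ENNReal.ofReal_add (abs_nonneg _) (by positivity)]
            refine ENNReal.ofReal_le_ofReal ?_
            have h1 := abs_sub_abs_le_abs_sub (envPath A B s n k ω : ℝ) (m ^ k * n)
            rw [abs_of_nonneg (show 0 ≤ m ^ k * (n : ℝ) by positivity)] at h1
            simp only [Nat.cast_zero, sub_zero]
            linarith
        _ ≤ ENNReal.ofReal (C * √n) + ENNReal.ofReal (m ^ k * n) := by
            rw [lintegral_add_right _ measurable_const, lintegral_const, measure_univ, mul_one]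
            gcongr
            exact ih n hn
        _ ≤ _ := by
            rw [← ENNReal.ofReal_add (by positivity) (by positivity)]
            refine ENNReal.ofReal_le_ofReal ?_
            have h1 : √(n : ℝ) ≤ n := by nlinarith
            have h2 := mul_le_mul_of_nonneg_left h1 hC
            have h3 := mul_le_of_le_one_left (Nat.cast_nonneg (α := ℝ) n) hmk
            linarith
    have hS2 : ∫⁻ ω, ENNReal.ofReal (S ω ^ 2) ∂P ≤ ENNReal.ofReal ((1 + C) * n * v) := by
      have h := hX.lintegral_sq_centeredSum_sub hA s n k 0
      simp only [centeredSum, Finset.range_zero, Finset.sum_empty, sub_zero] at h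
      rw [ENNReal.ofReal_mul (by positivity)]
      refine le_trans (le_of_eq ?_) (mul_le_mul_left hmean _)
      simpa [hS, centeredSum] using h
    have hS1 : ∫⁻ ω, ENNReal.ofReal |S ω| ∂P ≤ ENNReal.ofReal (((1 + C) * v + 1) / 2 * √n) := by
      -- The inequality |S| ≤ S²/(2√n) + √n/2, which expands (|S| - √n)² ≥ 0, derives the first
      -- moment from the second.
      calc _ ≤ ∫⁻ ω, (ENNReal.ofReal (1 / (2 * √n)) * ENNReal.ofReal (S ω ^ 2) +
            ENNReal.ofReal (√n / 2)) ∂P := by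
            refine lintegral_mono fun ω => ?_
            rw [← ENNReal.ofReal_mul (by positivity), ← ENNReal.ofReal_add (by positivity)
              (by positivity)]
            refine ENNReal.ofReal_le_ofReal ?_
            have h1 : 0 ≤ (|S ω| - √n) ^ 2 := sq_nonneg _
            rw [div_mul_eq_mul_div, one_mul, ← sub_nonneg]
            have h2 : S ω ^ 2 / (2 * √(n : ℝ)) + √n / 2 - |S ω| = (|S ω| - √n) ^ 2 / (2 * √n) := by
              have : √(n : ℝ) ≠ 0 := by positivity
              rw [sub_sq, sq_abs]
              field_simp
              ring
            rw [h2]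
            positivity
        _ = ENNReal.ofReal (1 / (2 * √n)) * ∫⁻ ω, ENNReal.ofReal (S ω ^ 2) ∂P +
            ENNReal.ofReal (√n / 2) := by
            rw [lintegral_add_right _ measurable_const, lintegral_const_mul' _ _
              ENNReal.ofReal_ne_top, lintegral_const, measure_univ, mul_one]
        _ ≤ ENNReal.ofReal (1 / (2 * √n)) * ENNReal.ofReal ((1 + C) * n * v) +
            ENNReal.ofReal (√n / 2) := by gcongr
        _ = _ := by
            rw [← ENNReal.ofReal_mul (by positivity), ← ENNReal.ofReal_add (by positivity)
              (by positivity)]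
            congr 1
            have h1 : 1 / (2 * √(n : ℝ)) * ((1 + C) * n * v) = (1 + C) * v / 2 * (n / √(n : ℝ)) := by
              ring
            rw [h1, Real.div_sqrt]
            ring
    have hB1 : ∫⁻ ω, ENNReal.ofReal (B (s + k + 1) ω : ℝ) ∂P = ENNReal.ofReal b := by
      rw [hb, ENNReal.ofReal_toReal hBfin.ne]
      have h := ((hX.identDistrib_B (s + k + 1)).comp (u := fun n : ℕ => (n : ℝ≥0∞))
        (measurable_of_countable _)).lintegral_eq
      simpa using h
    calc _ ≤ ∫⁻ ω, (ENNReal.ofReal m * ENNReal.ofReal |(envPath A B s n k ω : ℝ) - m ^ k * n| +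
          ENNReal.ofReal |S ω| + ENNReal.ofReal (B (s + k + 1) ω : ℝ)) ∂P := by
          refine lintegral_mono fun ω => ?_
          have hm0 := hμ.1.le
          rw [← ENNReal.ofReal_mul hm0, ← ENNReal.ofReal_add (by positivity) (by positivity),
            ← ENNReal.ofReal_add (by positivity) (by positivity)]
          refine ENNReal.ofReal_le_ofReal ?_
          rw [envPath_succ (P := P) s n k ω]
          have h1 : m * envPath A B s n k ω + centeredSum P A s k (envPath A B s n k ω) ω +
              B (s + k + 1) ω - m ^ (k + 1) * n =
              m * (envPath A B s n k ω - m ^ k * n) + S ω + B (s + k + 1) ω := by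
            rw [pow_succ]; ring
          rw [h1]
          refine (abs_add_le _ _).trans (add_le_add ((abs_add_le _ _).trans (add_le_add ?_ le_rfl)) ?_)
          · rw [abs_mul, abs_of_nonneg hm0]
          · rw [abs_of_nonneg (Nat.cast_nonneg _)]
      _ = ENNReal.ofReal m * ∫⁻ ω, ENNReal.ofReal |(envPath A B s n k ω : ℝ) - m ^ k * n| ∂P +
          ∫⁻ ω, ENNReal.ofReal |S ω| ∂P + ENNReal.ofReal b := by
          rw [lintegral_add_right _ (show Measurable fun ω => ENNReal.ofReal (B (s + k + 1) ω : ℝ) from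
              (hcast.comp (hX.measurable_B _)).ennreal_ofReal),
            lintegral_add_right _ (by fun_prop), lintegral_const_mul' _ _ ENNReal.ofReal_ne_top, hB1]
      _ ≤ ENNReal.ofReal m * ENNReal.ofReal (C * √n) +
          ENNReal.ofReal (((1 + C) * v + 1) / 2 * √n) + ENNReal.ofReal (b * √n) := by
          gcongr
          · exact ih n hn
          · exact le_mul_of_one_le_right ENNReal.toReal_nonneg hsq
      _ = _ := by
          have hm0 := hμ.1.le
          rw [← ENNReal.ofReal_mul hm0, ← ENNReal.ofReal_add (by positivity) (by positivity),
            ← ENNReal.ofReal_add (by positivity) (by positivity)]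
          congr 1
          ring

theorem tendstoInMeasure_add_zero {Ω : Type*} [MeasurableSpace Ω] {P : Measure Ω}
    {f g : ℕ → Ω → ℝ} (hf : TendstoInMeasure P f atTop fun _ => 0)
    (hg : TendstoInMeasure P g atTop fun _ => 0) :
    TendstoInMeasure P (fun n ω => f n ω + g n ω) atTop fun _ => 0 := by
  rw [tendstoInMeasure_iff_norm] at *
  intro ε hε
  have h := (hf (ε / 2) (half_pos hε)).add (hg (ε / 2) (half_pos hε))
  rw [add_zero] at h
  refine tendsto_of_tendsto_of_tendsto_of_le_of_le tendsto_const_nhds h (fun _ => zero_le)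
    fun n => (measure_mono ?_).trans (measure_union_le _ _)
  intro ω (hω : ε ≤ ‖_‖)
  by_contra hc
  have h1 : ¬ ε / 2 ≤ ‖f n ω - 0‖ := fun h => hc (Or.inl h)
  have h2 : ¬ ε / 2 ≤ ‖g n ω - 0‖ := fun h => hc (Or.inr h)
  rw [sub_zero] at *
  have := norm_add_le (f n ω) (g n ω)
  linarith

theorem tendsto_inv_sqrt_nat : Tendsto (fun n : ℕ => (√(n : ℝ))⁻¹) atTop (𝓝 0) :=
  tendsto_inv_atTop_zero.comp (Real.tendsto_sqrt_atTop.comp tendsto_natCast_atTop_atTop)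

/-- The relative size of the generations is asymptotically deterministic. -/
theorem IsStationaryGWI.tendstoInMeasure_envPath_div (hX : IsStationaryGWI P A B X)
    (hA : MemLp (fun ω => (A 0 0 ω : ℝ)) 2 P) (hμ : offspringMean P A ∈ Set.Ioo (0 : ℝ) 1)
    (hBfin : ∫⁻ ω, (B 0 ω : ℝ≥0∞) ∂P < ∞) (s : ℤ) (k : ℕ) :
    TendstoInMeasure P (fun n ω => (envPath A B s n k ω : ℝ) / n) atTop
      (fun _ => offspringMean P A ^ k) := by
  obtain ⟨C, hC, h⟩ := hX.lintegral_abs_envPath_sub_le hA hμ hBfin s k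
  rw [tendstoInMeasure_iff_dist]
  intro ε hε
  have hlim : Tendsto (fun n : ℕ => ENNReal.ofReal (C * (√(n : ℝ))⁻¹ / ε)) atTop (𝓝 0) := by
    have := ENNReal.tendsto_ofReal ((tendsto_inv_sqrt_nat.const_mul C).div_const ε)
    simpa using this
  refine tendsto_of_tendsto_of_tendsto_of_le_of_le' tendsto_const_nhds hlim
    (Eventually.of_forall fun _ => zero_le) ?_
  filter_upwards [eventually_ge_atTop 1] with n hn
  have hn0 : (0 : ℝ) < n := by exact_mod_cast hn
  have hsqn : √(n : ℝ) * √n = n := Real.mul_self_sqrt hn0.le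
  have hsq : 0 < √(n : ℝ) := Real.sqrt_pos.2 hn0
  have hpm : Measurable fun ω => (envPath A B s n k ω : ℝ) :=
    (measurable_of_countable (fun n : ℕ => (n : ℝ))).comp (hX.measurable_path s n k)
  have h1 := meas_ge_le_lintegral_div (μ := P)
    (f := fun ω => ENNReal.ofReal |(envPath A B s n k ω : ℝ) - offspringMean P A ^ k * n|)
    (hpm.sub_const _).norm.ennreal_ofReal.aemeasurable (ε := ENNReal.ofReal (ε * n)) (by simp; positivity) ENNReal.ofReal_ne_top
  calc _ ≤ _ := measure_mono ?_
    _ ≤ _ := h1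
    _ ≤ ENNReal.ofReal (C * √n) / ENNReal.ofReal (ε * n) := by gcongr; exact h n hn
    _ = _ := by
      rw [← ENNReal.ofReal_div_of_pos (by positivity)]
      congr 1
      rw [← Real.sqrt_div_self]
      ring
  intro ω (hω : ε ≤ dist _ _)
  refine ENNReal.ofReal_le_ofReal ?_
  rw [Real.dist_eq] at hω
  have h2 : (envPath A B s n k ω : ℝ) / n - offspringMean P A ^ k =
    ((envPath A B s n k ω : ℝ) - offspringMean P A ^ k * n) / n := by field_simp
  rw [h2, abs_div, abs_of_pos hn0, le_div_iff₀ hn0] at hω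
  exact hω

/-- The number of summands that replaces the size of generation `k`. -/
noncomputable def meanSize (m : ℝ) (n k : ℕ) : ℕ := ⌊m ^ k * n⌋₊

theorem abs_meanSize_sub_le {m : ℝ} (hm : 0 ≤ m) (n k : ℕ) :
    |m ^ k * (n : ℝ) - meanSize m n k| ≤ 1 := by
  have h0 : 0 ≤ m ^ k * (n : ℝ) := by positivity
  have h1 := Nat.floor_le h0
  have h2 := Nat.lt_floor_add_one (m ^ k * (n : ℝ))
  rw [abs_le, meanSize]
  constructor <;> linarith

theorem tendsto_meanSize {m : ℝ} (hm : 0 < m) (k : ℕ) :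
    Tendsto (fun n => meanSize m n k) atTop atTop :=
  tendsto_nat_floor_atTop.comp (tendsto_natCast_atTop_atTop.const_mul_atTop (by positivity))

theorem tendsto_meanSize_div {m : ℝ} (hm : 0 < m) (k : ℕ) :
    Tendsto (fun n : ℕ => (meanSize m n k : ℝ) / n) atTop (𝓝 (m ^ k)) :=
  (tendsto_nat_floor_mul_div_atTop (R := ℝ) (a := m ^ k) (by positivity)).comp
    tendsto_natCast_atTop_atTop

/-- Replacing the random number of summands by its mean is asymptotically harmless. -/
theorem IsStationaryGWI.tendstoInMeasure_error (hX : IsStationaryGWI P A B X)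
    (hA : MemLp (fun ω => (A 0 0 ω : ℝ)) 2 P) (hμ : offspringMean P A ∈ Set.Ioo (0 : ℝ) 1)
    (hBfin : ∫⁻ ω, (B 0 ω : ℝ≥0∞) ∂P < ∞) (s : ℤ) (k : ℕ) :
    TendstoInMeasure P (fun (n : ℕ) ω => (√(n : ℝ))⁻¹ *
      ((centeredSum P A s k (envPath A B s n k ω) ω -
        centeredSum P A s k (meanSize (offspringMean P A) n k) ω) +
        ((B (s + k + 1) ω : ℝ) - immigrationMean P B))) atTop (fun _ => (0 : ℝ)) := by
  set m := offspringMean P A with hm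
  set v := offspringVar P A with hv
  have hv0 : 0 ≤ v := variance_nonneg _ _
  obtain ⟨C, hC, h⟩ := hX.lintegral_abs_envPath_sub_le hA hμ hBfin s k
  have h1 : TendstoInMeasure P (fun (n : ℕ) ω => (√(n : ℝ))⁻¹ *
      (centeredSum P A s k (envPath A B s n k ω) ω -
        centeredSum P A s k (meanSize m n k) ω)) atTop (fun _ => (0 : ℝ)) := by
    rw [tendstoInMeasure_iff_dist]
    intro ε hε
    have hlim : Tendsto (fun n : ℕ => ENNReal.ofReal ((C + 1) * v * (√(n : ℝ))⁻¹ / ε ^ 2)) atTop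
        (𝓝 0) := by
      have := ENNReal.tendsto_ofReal ((tendsto_inv_sqrt_nat.const_mul ((C + 1) * v)).div_const (ε ^ 2))
      simpa using this
    refine tendsto_of_tendsto_of_tendsto_of_le_of_le' tendsto_const_nhds hlim
      (Eventually.of_forall fun _ => zero_le) ?_
    filter_upwards [eventually_ge_atTop 1] with n hn
    have hn0 : (0 : ℝ) < n := by exact_mod_cast hn
    have hsqn : √(n : ℝ) * √n = n := Real.mul_self_sqrt hn0.le
    have hsq : 0 < √(n : ℝ) := Real.sqrt_pos.2 hn0
    have hsq1 : 1 ≤ √(n : ℝ) := Real.one_le_sqrt.2 (by exact_mod_cast hn)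
    set d := meanSize m n k with hd
    have hpm : Measurable fun ω => (envPath A B s n k ω : ℝ) :=
      (measurable_of_countable (fun n : ℕ => (n : ℝ))).comp (hX.measurable_path s n k)
    have hTm : Measurable fun ω => centeredSum P A s k (envPath A B s n k ω) ω -
        centeredSum P A s k d ω :=
      (hX.measurable_centeredSum s k (hX.measurable_path s n k)).sub
        (hX.measurable_centeredSum s k measurable_const)
    -- On average only O(√n) summands are exchanged, so the second moment of the change is O(√n) and
    -- vanishes after division by n.
    have hmean : ∫⁻ ω, ENNReal.ofReal |(envPath A B s n k ω : ℝ) - d| ∂P ≤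
        ENNReal.ofReal ((C + 1) * √n) := by
      calc _ ≤ ∫⁻ ω, (ENNReal.ofReal |(envPath A B s n k ω : ℝ) - m ^ k * n| +
            ENNReal.ofReal 1) ∂P := by
            refine lintegral_mono fun ω => ?_
            rw [← ENNReal.ofReal_add (abs_nonneg _) (by positivity)]
            refine ENNReal.ofReal_le_ofReal ?_
            have h2 := abs_sub_le (envPath A B s n k ω : ℝ) (m ^ k * n) d
            linarith [abs_meanSize_sub_le hμ.1.le n k]
        _ ≤ ENNReal.ofReal (C * √n) + ENNReal.ofReal 1 := by
            rw [lintegral_add_right _ measurable_const, lintegral_const, measure_univ, mul_one]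
            gcongr
            exact h n hn
        _ ≤ _ := by
            rw [← ENNReal.ofReal_add (by positivity) (by positivity)]
            refine ENNReal.ofReal_le_ofReal ?_
            linarith
    have h2 := meas_ge_le_lintegral_div (μ := P)
      (f := fun ω => ENNReal.ofReal ((centeredSum P A s k (envPath A B s n k ω) ω -
        centeredSum P A s k d ω) ^ 2))
      (hTm.pow_const 2).ennreal_ofReal.aemeasurable (ε := ENNReal.ofReal (ε ^ 2 * n))
      (by simp; positivity) ENNReal.ofReal_ne_top
    calc _ ≤ _ := measure_mono ?_
      _ ≤ _ := h2
      _ ≤ ENNReal.ofReal ((C + 1) * √n) * ENNReal.ofReal v / ENNReal.ofReal (ε ^ 2 * n) := by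
        rw [hX.lintegral_sq_centeredSum_sub hA s n k d]
        gcongr
      _ = _ := by
        rw [← ENNReal.ofReal_mul (by positivity), ← ENNReal.ofReal_div_of_pos (by positivity)]
        congr 1
        rw [← Real.sqrt_div_self]
        ring
    intro ω (hω : ε ≤ dist _ _)
    refine ENNReal.ofReal_le_ofReal ?_
    rw [Real.dist_eq, sub_zero, abs_mul, abs_inv, abs_of_pos hsq, inv_mul_eq_div,
      le_div_iff₀ hsq] at hω
    rw [← sq_abs (_ - _), ← hsqn, ← sq, ← mul_pow]
    gcongr
  have h2 : TendstoInMeasure P (fun (n : ℕ) ω => (√(n : ℝ))⁻¹ *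
      ((B (s + k + 1) ω : ℝ) - immigrationMean P B)) atTop (fun _ => (0 : ℝ)) := by
    have hBm : Measurable fun ω => (B (s + k + 1) ω : ℝ) - immigrationMean P B :=
      (measurable_of_countable (fun n : ℕ => (n : ℝ) - immigrationMean P B)).comp (hX.measurable_B _)
    refine tendstoInMeasure_of_tendsto_ae (fun n => (hBm.const_mul _).aestronglyMeasurable)
      (Eventually.of_forall fun ω => ?_)
    simpa using tendsto_inv_sqrt_nat.mul_const ((B (s + k + 1) ω : ℝ) - immigrationMean P B)
  have h3 := tendstoInMeasure_add_zero h1 h2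
  refine TendstoInMeasure.congr (fun n => Eventually.of_forall fun ω => ?_)
    (Eventually.of_forall fun ω => ?_) h3
  · ring
  · rfl

end Stationary

/-! ### The central limit theorem along the generations -/

theorem tendstoInDistribution_pi_of_iIndepFun {Ω Ω' κ ι : Type*} [Fintype κ] [MeasurableSpace Ω]
    [MeasurableSpace Ω'] {P : Measure Ω} [IsProbabilityMeasure P] {Q : Measure Ω'}
    [IsProbabilityMeasure Q] {l : Filter ι} {Y : ι → κ → Ω → ℝ} {Z : κ → Ω' → ℝ}
    (hY : ∀ i, iIndepFun (Y i) P) (hZ : iIndepFun Z Q)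
    (h : ∀ k, TendstoInDistribution (fun i => Y i k) l (Z k) (fun _ => P) Q) :
    TendstoInDistribution (fun i ω k => Y i k ω) l (fun ω k => Z k ω) (fun _ => P) Q where
  forall_aemeasurable i := aemeasurable_pi_lambda _ fun k => (h k).forall_aemeasurable i
  aemeasurable_limit := aemeasurable_pi_lambda _ fun k => (h k).aemeasurable_limit
  tendsto := by
    have h1 := (ProbabilityMeasure.continuous_pi (α := fun _ : κ => ℝ)).continuousAt.tendsto.comp
      (tendsto_pi_nhds.2 fun k => (h k).tendsto)
    refine (h1.congr fun i => ?_).trans_eq ?_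
    · refine Subtype.ext ?_
      exact ((hY i).map_fun_eq_pi_map fun k => (h k).forall_aemeasurable i).symm
    · congr 1
      refine Subtype.ext ?_
      exact (hZ.map_fun_eq_pi_map fun k => (h k).aemeasurable_limit).symm

/-- The law of a two-sided sequence of i.i.d. centered Gaussian variables with variance `v`. -/
noncomputable def gaussSeq (v : ℝ) : Measure (ℤ → ℝ) :=
  Measure.infinitePi fun _ => gaussianReal 0 v.toNNReal

instance (v : ℝ) : IsProbabilityMeasure (gaussSeq v) := by
  unfold gaussSeq; infer_instance

theorem iIndepFun_gaussSeq (v : ℝ) : iIndepFun (fun (i : ℤ) (z : ℤ → ℝ) => z i) (gaussSeq v) :=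
  iIndepFun_infinitePi (X := fun _ x => x) fun _ => measurable_id

theorem map_eval_gaussSeq (v : ℝ) (i : ℤ) :
    (gaussSeq v).map (fun z => z i) = gaussianReal 0 v.toNNReal :=
  Measure.infinitePi_map_eval _ i

/-- The deterministic decay of the pair process along the generations. -/
noncomputable def genScale (m : ℝ) (k : ℤ) : ℝ := m ^ (3 * (k : ℝ) / 2)

theorem genScale_pos {m : ℝ} (hm : 0 < m) (k : ℤ) : 0 < genScale m k := Real.rpow_pos_of_pos hm _

theorem genScale_add {m : ℝ} (hm : 0 < m) (k l : ℤ) :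
    genScale m (k + l) = genScale m k * genScale m l := by
  rw [genScale, genScale, genScale, ← Real.rpow_add hm]
  push_cast
  ring_nf

theorem genScale_natCast {m : ℝ} (hm : 0 < m) (k : ℕ) :
    genScale m k = (m ^ k) ^ (3 / 2 : ℝ) := by
  rw [genScale, ← Real.rpow_natCast, ← Real.rpow_mul hm.le]
  push_cast
  ring_nf

/-- The limit of the pair process, once it has started from a large generation. -/
noncomputable def spine (m : ℝ) (r : ℝ) (z : ℤ → ℝ) (k : ℤ) : ℝ × ℝ :=
  (r * genScale m k) • ((1, z k) : ℝ × ℝ)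

section Stationary

variable {Ω : Type*} [MeasurableSpace Ω] {P : Measure Ω} [IsProbabilityMeasure P]
    {A : ℤ → ℕ → Ω → ℕ} {B : ℤ → Ω → ℕ} {X : ℤ → Ω → ℕ}

/-- Independence of the doubly indexed family is regrouped into independence of its rows by currying
the infinite product measure. -/
theorem IsStationaryGWI.iIndepFun_rows (hX : IsStationaryGWI P A B X) :
    iIndepFun (fun (i : ℤ) ω (j : ℕ) => A i j ω) P := by
  have hI : iIndepFun (fun p : ℤ × ℕ => A p.1 p.2) P := hX.indep.precomp Sum.inl_injective
  have hm : ∀ i j, Measurable (A i j) := hX.measurable_A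
  have hp : ∀ i j, IsProbabilityMeasure (P.map (A i j)) := fun i j =>
    Measure.isProbabilityMeasure_map (hm i j).aemeasurable
  have hrow : ∀ i, iIndepFun (A i) P := fun i =>
    hI.precomp (g := fun j : ℕ => (i, j)) fun a b h => (Prod.ext_iff.1 h).2
  rw [iIndepFun_iff_map_fun_eq_infinitePi_map fun i => measurable_pi_lambda _ (hm i)]
  have h1 := hI.map_fun_eq_infinitePi_map fun p : ℤ × ℕ => hm p.1 p.2
  have h2 := Measure.infinitePi_map_curry fun i j => P.map (A i j)
  have hmm : Measurable fun ω (p : ℤ × ℕ) => A p.1 p.2 ω :=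
    measurable_pi_lambda _ fun p => hm p.1 p.2
  rw [← h1, Measure.map_map (MeasurableEquiv.measurable _) hmm] at h2
  refine Eq.trans ?_ (h2.trans ?_)
  · rfl
  · congr 1
    funext i
    exact ((hrow i).map_fun_eq_infinitePi_map (hm i)).symm

/-- With deterministic numbers of summands, the sums from different generations use different rows
and are exactly independent, so the one-dimensional central limit theorem gives joint convergence.
Row s + k + 1 produces the fluctuation that follows generation s + k, hence the coordinate z (s +
k). -/
theorem IsStationaryGWI.tendstoInDistribution_centeredSum (hX : IsStationaryGWI P A B X)
    (hA : MemLp (fun ω => (A 0 0 ω : ℝ)) 2 P) (hμ : offspringMean P A ∈ Set.Ioo (0 : ℝ) 1)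
    (s : ℤ) (K : ℕ) :
    TendstoInDistribution (fun (n : ℕ) ω (k : Fin K) =>
        (√(meanSize (offspringMean P A) n k : ℝ))⁻¹ *
          centeredSum P A s k (meanSize (offspringMean P A) n k) ω) atTop
      (fun (z : ℤ → ℝ) (k : Fin K) => z (s + k)) (fun _ => P) (gaussSeq (offspringVar P A)) := by
  have hcast : ∀ c : ℝ, Measurable fun n : ℕ => (n : ℝ) - c := fun c => measurable_of_countable _
  refine tendstoInDistribution_pi_of_iIndepFun
    (Y := fun (n : ℕ) (k : Fin K) ω => (√(meanSize (offspringMean P A) n k : ℝ))⁻¹ *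
          centeredSum P A s k (meanSize (offspringMean P A) n k) ω)
    (Z := fun (k : Fin K) (z : ℤ → ℝ) => z (s + k)) (fun n => ?_) ?_ fun k => ?_
  · have h1 := hX.iIndepFun_rows.precomp (g := fun k : Fin K => s + (k : ℕ) + 1) fun a b h => by
      ext; simpa using h
    refine h1.comp (fun k (w : ℕ → ℕ) => (√(meanSize (offspringMean P A) n k : ℝ))⁻¹ *
      ∑ j ∈ Finset.range (meanSize (offspringMean P A) n k), ((w j : ℝ) - offspringMean P A))
      fun k => ?_
    exact (Finset.measurable_fun_sum _ fun j _ => (hcast _).comp (measurable_pi_apply j)).const_mul _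
  · exact (iIndepFun_gaussSeq _).precomp (g := fun k : Fin K => s + (k : ℕ)) fun a b h => by
      ext; simpa using h
  · have hiid := hX.isIIDCounts hA (s + (k : ℕ) + 1)
    have hc : Measurable fun n : ℕ => (n : ℝ) := measurable_of_countable _
    have hlaw : HasLaw (fun z : ℤ → ℝ => z (s + (k : ℕ)))
        (gaussianReal 0 (variance (fun ω => (A (s + (k : ℕ) + 1) 0 ω : ℝ)) P).toNNReal)
        (gaussSeq (offspringVar P A)) :=
      ⟨(measurable_pi_apply _).aemeasurable, by rw [map_eval_gaussSeq, hiid.var]⟩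
    have h := tendstoInDistribution_inv_sqrt_mul_sum_sub
      (X := fun j ω => (A (s + (k : ℕ) + 1) j ω : ℝ)) hlaw (hiid.memLp 0)
      (hiid.indep.comp (fun _ n => (n : ℝ)) fun _ => hc) fun j => (hiid.identDistrib j).comp hc
    have h2 : ∀ (d : ℕ) ω, (√(d : ℝ))⁻¹ * centeredSum P A s k d ω = (√(d : ℝ))⁻¹ *
        (∑ j ∈ Finset.range d, (A (s + (k : ℕ) + 1) j ω : ℝ) -
          d * ∫ ω, (A (s + (k : ℕ) + 1) 0 ω : ℝ) ∂P) := by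
      intro d ω
      rw [hiid.mean, centeredSum, Finset.sum_sub_distrib, Finset.sum_const, Finset.card_range,
        nsmul_eq_mul]
    simp only [h2]
    exact ⟨fun n => h.forall_aemeasurable _, h.aemeasurable_limit,
      h.tendsto.comp (tendsto_meanSize hμ.1 k)⟩

/-- The pair process along the path started from generation size `n`, rescaled. -/
noncomputable def normPath (P : Measure Ω) (A : ℤ → ℕ → Ω → ℕ) (B : ℤ → Ω → ℕ) (s : ℤ) (K n : ℕ)
    (ω : Ω) (k : Fin K) : ℝ × ℝ :=
  (((envPath A B s n k ω : ℝ) / n) ^ (3 / 2 : ℝ), (envPath A B s n k ω : ℝ) / n *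
    ((√(n : ℝ))⁻¹ * (envPath A B s n (k + 1) ω - offspringMean P A * envPath A B s n k ω -
      immigrationMean P B)))

theorem measurable_envPath_future (s : ℤ) (n k : ℕ) :
    Measurable[envSigma A B (s < ·)] (envPath A B s n k) := by
  let σ : MeasurableSpace Ω := envSigma A B (s < ·)
  exact measurable_gwPath (n := fun _ => n) measurable_const
    (fun i j h _ => measurable_envSigma_left (p := (s < ·)) h j)
    fun i h _ => measurable_envSigma_right (p := (s < ·)) h

theorem measurable_normPath_future (s : ℤ) (K : ℕ) :
    Measurable[envSigma A B (s < ·)] fun ω n => normPath P A B s K n ω := by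
  let σ : MeasurableSpace Ω := envSigma A B (s < ·)
  have hc : Measurable fun n : ℕ => (n : ℝ) := measurable_of_countable _
  have h : ∀ n k, Measurable fun ω => (envPath A B s n k ω : ℝ) := fun n k =>
    hc.comp (measurable_envPath_future s n k)
  refine measurable_pi_lambda _ fun n => measurable_pi_lambda _ fun k => Measurable.prodMk ?_ ?_
  · exact ((h n k).div_const _).pow_const _
  · exact ((h n k).div_const _).mul
      ((((h n (k + 1)).sub ((h n k).const_mul _)).sub_const _).const_mul _)

theorem IsStationaryGWI.measurable_normPath (hX : IsStationaryGWI P A B X) (s : ℤ) (K n : ℕ) :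
    Measurable (normPath P A B s K n) :=
  ((measurable_pi_apply n).comp (measurable_normPath_future s K)).mono (hX.envSigma_le _) le_rfl

/-- The second coordinate is split for Slutsky's theorem: a normalised sum with a fixed number d of
summands, with factor √(d/n), and the error handled by `tendstoInMeasure_error`. -/
theorem normPath_snd_eq (s : ℤ) (K n : ℕ) (ω : Ω) (k : Fin K) (d : ℕ) :
    (normPath P A B s K n ω k).2 = (envPath A B s n k ω : ℝ) / n *
      (√((d : ℝ) / n) * ((√(d : ℝ))⁻¹ * centeredSum P A s k d ω) + (√(n : ℝ))⁻¹ *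
        ((centeredSum P A s k (envPath A B s n k ω) ω - centeredSum P A s k d ω) +
          ((B (s + k + 1) ω : ℝ) - immigrationMean P B))) := by
  have h1 : √((d : ℝ) / n) * ((√(d : ℝ))⁻¹ * centeredSum P A s k d ω) =
      (√(n : ℝ))⁻¹ * centeredSum P A s k d ω := by
    rcases Nat.eq_zero_or_pos d with rfl | hd
    · simp [centeredSum]
    · have : √(d : ℝ) ≠ 0 := by positivity
      rw [Real.sqrt_div (Nat.cast_nonneg d)]
      field_simp
  rw [h1]
  simp only [normPath]
  rw [envPath_succ (P := P)]
  ring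

/-- Slutsky: the relative size tends to m^k, the factor √(d/n) to m^{k/2} and the error to 0. Their
product m^k · m^{k/2} is the decay m^{3k/2} of the second coordinate, the same as that of the first.
-/
theorem IsStationaryGWI.tendstoInDistribution_normPath (hX : IsStationaryGWI P A B X)
    (hA : MemLp (fun ω => (A 0 0 ω : ℝ)) 2 P) (hμ : offspringMean P A ∈ Set.Ioo (0 : ℝ) 1)
    (hBfin : ∫⁻ ω, (B 0 ω : ℝ≥0∞) ∂P < ∞) (s : ℤ) (K : ℕ) :
    TendstoInDistribution (normPath P A B s K) atTop
      (fun (z : ℤ → ℝ) (k : Fin K) =>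
        genScale (offspringMean P A) (k : ℕ) • ((1, z (s + (k : ℕ))) : ℝ × ℝ))
      (fun _ => P) (gaussSeq (offspringVar P A)) := by
  set m := offspringMean P A with hm
  have hm0 : 0 < m := hμ.1
  have hc : Measurable fun n : ℕ => (n : ℝ) := measurable_of_countable _
  let Y : ℕ → Ω → Fin K → ℝ × ℝ × ℝ := fun n ω k => ((envPath A B s n k ω : ℝ) / n,
    √((meanSize m n k : ℝ) / n), (√(n : ℝ))⁻¹ *
      ((centeredSum P A s k (envPath A B s n k ω) ω - centeredSum P A s k (meanSize m n k) ω) +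
        ((B (s + k + 1) ω : ℝ) - immigrationMean P B)))
  let g : (Fin K → ℝ) × (Fin K → ℝ × ℝ × ℝ) → Fin K → ℝ × ℝ := fun p k =>
    ((p.2 k).1 ^ (3 / 2 : ℝ), (p.2 k).1 * ((p.2 k).2.1 * p.1 k + (p.2 k).2.2))
  have hg : Continuous g := by
    refine continuous_pi fun k => Continuous.prodMk ?_ (by fun_prop)
    exact (Real.continuous_rpow_const (by norm_num)).comp (by fun_prop)
  have hYm : ∀ n, AEMeasurable (Y n) P := by
    intro n
    refine (measurable_pi_lambda _ fun k => ?_).aemeasurable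
    refine ((hc.comp (hX.measurable_path s n k)).div_const _).prodMk (measurable_const.prodMk ?_)
    exact (((hX.measurable_centeredSum s k (hX.measurable_path s n k)).sub
      (hX.measurable_centeredSum s k measurable_const)).add
      ((hc.comp (hX.measurable_B _)).sub_const _)).const_mul _
  have hYt : TendstoInMeasure P Y atTop
      (fun _ (k : Fin K) => (m ^ (k : ℕ), √(m ^ (k : ℕ)), (0 : ℝ))) := by
    refine tendstoInMeasure_pi fun k => tendstoInMeasure_prodMk
      (hX.tendstoInMeasure_envPath_div hA hμ hBfin s k) (tendstoInMeasure_prodMk ?_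
        (hX.tendstoInMeasure_error hA hμ hBfin s k))
    exact tendstoInMeasure_of_tendsto_ae (fun n => aestronglyMeasurable_const)
      (Eventually.of_forall fun ω =>
        (Real.continuous_sqrt.tendsto _).comp (tendsto_meanSize_div hm0 k))
  have h := (hX.tendstoInDistribution_centeredSum hA hμ s K)
    |>.continuous_comp_prodMk_of_tendstoInMeasure_const hg hYt hYm
  refine h.congr (fun n => Eventually.of_forall fun ω => ?_) (Eventually.of_forall fun z => ?_)
  · funext k
    refine Prod.ext rfl ?_
    exact (normPath_snd_eq s K n ω k _).symm
  · funext k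
    have h1 : genScale m ((k : ℕ) : ℤ) = m ^ (k : ℕ) * √(m ^ (k : ℕ)) := by
      have h2 : 0 < m ^ (k : ℕ) := by positivity
      rw [genScale_natCast hm0, show (3 / 2 : ℝ) = 1 + 1 / 2 by norm_num, Real.rpow_add h2,
        Real.rpow_one, Real.sqrt_eq_rpow]
    refine Prod.ext ?_ ?_
    · simp [g, genScale_natCast hm0]
    · simp only [g, h1, Prod.smul_mk, smul_eq_mul, add_zero]
      ring

end Stationary

/-! ### The homogeneous measure on the half line -/

/-- The measure on `(0, ∞)` that gives mass `a ^ (-β)` to `(a, ∞)`. -/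
noncomputable def powerMeasure (β : ℝ) : Measure ℝ :=
  (volume.restrict (Set.Ioi 0)).map fun u : ℝ => u ^ (-β⁻¹)

instance (β : ℝ) : SFinite (powerMeasure β) := by
  unfold powerMeasure; infer_instance

theorem measurable_rpow_neg_inv (β : ℝ) : Measurable fun u : ℝ => u ^ (-β⁻¹) :=
  measurable_id.pow_const _

theorem lt_rpow_neg_inv_iff {β a u : ℝ} (hβ : 0 < β) (ha : 0 < a) (hu : 0 < u) :
    a < u ^ (-β⁻¹) ↔ u < a ^ (-β) := by
  have h : a = (a ^ (-β)) ^ (-β⁻¹) := by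
    rw [← Real.rpow_mul ha.le, neg_mul_neg, mul_inv_cancel₀ hβ.ne', Real.rpow_one]
  conv_lhs => rw [h]
  have h2 : -β⁻¹ < 0 := neg_lt_zero.2 (inv_pos.2 hβ)
  exact Real.rpow_lt_rpow_iff_of_neg (Real.rpow_pos_of_pos ha _) hu h2

theorem powerMeasure_Ioi {β a : ℝ} (hβ : 0 < β) (ha : 0 < a) :
    powerMeasure β (Set.Ioi a) = ENNReal.ofReal (a ^ (-β)) := by
  rw [powerMeasure, Measure.map_apply (measurable_rpow_neg_inv β) measurableSet_Ioi,
    Measure.restrict_apply (measurable_rpow_neg_inv β measurableSet_Ioi)]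
  have h : (fun u : ℝ => u ^ (-β⁻¹)) ⁻¹' Set.Ioi a ∩ Set.Ioi 0 = Set.Ioo 0 (a ^ (-β)) := by
    ext u
    constructor
    · rintro ⟨h1, h2⟩
      exact ⟨h2, (lt_rpow_neg_inv_iff hβ ha h2).1 h1⟩
    · rintro ⟨h1, h2⟩
      exact ⟨(lt_rpow_neg_inv_iff hβ ha h1).2 h2, h1⟩
  rw [h, Real.volume_Ioo, sub_zero]

theorem ae_pos_powerMeasure (β : ℝ) : ∀ᵐ r ∂powerMeasure β, 0 < r := by
  rw [powerMeasure, ae_map_iff (measurable_rpow_neg_inv β).aemeasurable measurableSet_Ioi]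
  filter_upwards [ae_restrict_mem measurableSet_Ioi] with u hu
  exact Real.rpow_pos_of_pos hu _

/-- Homogeneity of the power law is scaling of Lebesgue measure seen through u ↦ u^{-1/β}. -/
theorem map_mul_powerMeasure {β c : ℝ} (hβ : 0 < β) (hc : 0 < c) :
    (powerMeasure β).map (c * ·) = ENNReal.ofReal (c ^ β) • powerMeasure β := by
  have hd : 0 < c ^ (-β) := Real.rpow_pos_of_pos hc _
  have h1 : (volume.restrict (Set.Ioi (0 : ℝ))).map (c ^ (-β) * ·) =
      ENNReal.ofReal (c ^ β) • volume.restrict (Set.Ioi (0 : ℝ)) := by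
    have h2 := Measure.restrict_map (μ := volume) (measurable_const_mul (c ^ (-β)))
      (measurableSet_Ioi (a := (0 : ℝ)))
    rw [Real.map_volume_mul_left hd.ne', Set.preimage_const_mul_Ioi₀ _ hd, zero_div] at h2
    rw [← h2, Measure.restrict_smul, abs_of_pos (inv_pos.2 hd), Real.rpow_neg hc.le, inv_inv]
  rw [powerMeasure, Measure.map_map (measurable_const_mul c) (measurable_rpow_neg_inv β),
    ← Measure.map_smul, ← h1, Measure.map_map (measurable_rpow_neg_inv β) (measurable_const_mul _)]
  refine Measure.map_congr ?_
  filter_upwards [ae_restrict_mem measurableSet_Ioi] with u (hu : 0 < u)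
  simp only [Function.comp]
  rw [Real.mul_rpow hd.le hu.le, ← Real.rpow_mul hc.le, neg_mul_neg, mul_inv_cancel₀ hβ.ne',
    Real.rpow_one]

theorem powerMeasure_singleton {β : ℝ} (hβ : 0 < β) (a : ℝ) : powerMeasure β {a} = 0 := by
  rw [powerMeasure, Measure.map_apply (measurable_rpow_neg_inv β) (measurableSet_singleton a),
    Measure.restrict_apply (measurable_rpow_neg_inv β (measurableSet_singleton a))]
  refine measure_mono_null (t := {a ^ (-β)}) ?_ (measure_singleton _)
  rintro u ⟨h1, h2⟩
  have h1 : u ^ (-β⁻¹) = a := h1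
  rw [Set.mem_singleton_iff, ← h1, ← Real.rpow_mul (le_of_lt h2), neg_mul_neg,
    inv_mul_cancel₀ hβ.ne', Real.rpow_one]

/-! ### Weak convergence on the line -/

/-- Survival functions determine the mass of half-open intervals, which form a π-system containing a
neighbourhood basis of each point. -/
theorem tendsto_probabilityMeasure_real {ι : Type*} {l : Filter ι} [l.IsCountablyGenerated]
    {μ : ι → ProbabilityMeasure ℝ} {π : ProbabilityMeasure ℝ}
    (h : ∀ a : ℝ, Tendsto (fun i => (μ i : Measure ℝ).real (Set.Ioi a)) l
      (𝓝 ((π : Measure ℝ).real (Set.Ioi a)))) : Tendsto μ l (𝓝 π) := by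
  have hIoc : ∀ (ν : ProbabilityMeasure ℝ) (a b : ℝ), (ν : Measure ℝ).real (Set.Ioc a b) =
      (ν : Measure ℝ).real (Set.Ioi a) - (ν : Measure ℝ).real (Set.Ioi (max a b)) := by
    intro ν a b
    rw [← measureReal_sdiff (Set.Ioi_subset_Ioi (le_max_left a b)) measurableSet_Ioi]
    congr 1
    ext t
    simp only [Set.mem_Ioc, Set.mem_sdiff, Set.mem_Ioi, not_lt, sup_lt_iff, not_and]
    constructor
    · rintro ⟨h1, h2⟩
      exact ⟨h1, fun _ => h2⟩
    · rintro ⟨h1, h2⟩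
      exact ⟨h1, h2 h1⟩
  have hS : IsPiSystem {t : Set ℝ | ∃ a b : ℝ, t = Set.Ioc a b} := by
    rintro - ⟨a, b, rfl⟩ - ⟨a', b', rfl⟩ -
    exact ⟨_, _, Set.Ioc_inter_Ioc⟩
  refine hS.tendsto_probabilityMeasure_of_tendsto_of_mem ?_ ?_ ?_
  · rintro - ⟨a, b, rfl⟩
    exact measurableSet_Ioc
  · intro u hu x hx
    obtain ⟨ε, hε, h⟩ := Metric.isOpen_iff.1 hu x hx
    refine ⟨Set.Ioc (x - ε / 2) (x + ε / 2), ⟨_, _, rfl⟩,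
      Ioc_mem_nhds (by linarith) (by linarith), fun y hy => h ?_⟩
    rw [Metric.mem_ball, Real.dist_eq, abs_lt]
    constructor <;> linarith [hy.1, hy.2]
  · rintro - ⟨a, b, rfl⟩
    rw [← NNReal.tendsto_coe]
    have h1 := (h a).sub (h (max a b))
    simp only [← hIoc] at h1
    exact h1

theorem measurable_random_index {Ω F : Type*} [MeasurableSpace Ω] [MeasurableSpace F] {N : Ω → ℕ}
    {Y : ℕ → Ω → F} (hN : Measurable N) (hY : ∀ n, Measurable (Y n)) :
    Measurable fun ω => Y (N ω) ω := by
  have : Measurable fun p : ℕ × Ω => Y p.1 p.2 := measurable_from_prod_countable_right fun n => hY n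
  exact this.comp (hN.prodMk measurable_id)

/-! ### The conditional limit given a large generation -/

section Stationary

variable {Ω : Type*} [MeasurableSpace Ω] {P : Measure Ω} [IsProbabilityMeasure P]
    {A : ℤ → ℕ → Ω → ℕ} {B : ℤ → Ω → ℕ} {X : ℤ → Ω → ℕ}

/-- The tail function of `X_0 ^ (3/2)`. -/
noncomputable def scaleFn (P : Measure Ω) (X : ℤ → Ω → ℕ) (x : ℝ) : ℝ :=
  tailFn P (X 0) (x ^ (2 / 3 : ℝ))

theorem IsStationaryGWI.measureReal_lt_rpow (hX : IsStationaryGWI P A B X) (s : ℤ) {y : ℝ}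
    (hy : 0 ≤ y) : P.real {ω | y < (X s ω : ℝ) ^ (3 / 2 : ℝ)} = scaleFn P X y := by
  rw [scaleFn, ← tailFn_congr (hX.identDistrib_X s), tailFn]
  simp only [lt_rpow_three_halves_iff hy (Nat.cast_nonneg _)]

/-- The reason for the exponent 3/2: fluctuations from a generation of size n are of order √n, so
X_k M_{k+1} is of order n · √n, like X_k^{3/2}. The common factor X_s^{3/2}/x splits off from both
coordinates. -/
theorem pairProcess_eq_normPath {s : ℤ} {K : ℕ} {ω : Ω} (hω : ∀ k : ℕ, X (s + k) ω =
    envPath A B s (X s ω) k ω) (h0 : 0 < X s ω) (x : ℝ) (k : Fin K) :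
    x⁻¹ • pairProcess P A B X (s + (k : ℕ)) ω =
      ((X s ω : ℝ) ^ (3 / 2 : ℝ) / x) • normPath P A B s K (X s ω) ω k := by
  have hn : (0 : ℝ) < X s ω := by exact_mod_cast h0
  have h1 : X (s + (k : ℕ) + 1) ω = envPath A B s (X s ω) (k + 1) ω := by
    have := hω (k + 1)
    rw [← this]
    push_cast
    rw [add_assoc]
  have h32 : (X s ω : ℝ) ^ (3 / 2 : ℝ) = X s ω * √(X s ω : ℝ) := by
    rw [show (3 / 2 : ℝ) = 1 + 1 / 2 by norm_num, Real.rpow_add hn, Real.rpow_one,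
      Real.sqrt_eq_rpow]
  refine Prod.ext ?_ ?_
  · simp only [pairProcess, normPath, Prod.smul_mk, smul_eq_mul]
    rw [hω k, Real.div_rpow (Nat.cast_nonneg _) hn.le]
    have : (X s ω : ℝ) ^ (3 / 2 : ℝ) ≠ 0 := (Real.rpow_pos_of_pos hn _).ne'
    field_simp
  · simp only [pairProcess, normPath, Prod.smul_mk, smul_eq_mul, innovation]
    rw [h1, add_sub_cancel_right, hω k, h32]
    have h3 : √(X s ω : ℝ) ≠ 0 := (Real.sqrt_pos.2 hn).ne'
    generalize √(X s ω : ℝ) = q at h3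
    generalize (X s ω : ℝ) = n at hn
    field_simp

/-- The law, given that it exceeds `δ`, of a variable with the infinite law `powerMeasure β`. -/
noncomputable def condPower (β δ : ℝ) : Measure ℝ :=
  ENNReal.ofReal (δ ^ β) • (powerMeasure β).restrict (Set.Ioi δ)

theorem condPower_Ioi {β δ : ℝ} (hβ : 0 < β) (hδ : 0 < δ) (t : ℝ) :
    condPower β δ (Set.Ioi t) = ENNReal.ofReal (δ ^ β * (max t δ) ^ (-β)) := by
  have : 0 < max t δ := lt_max_of_lt_right hδ
  rw [condPower, Measure.smul_apply, Measure.restrict_apply measurableSet_Ioi, Set.Ioi_inter_Ioi,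
    powerMeasure_Ioi hβ this, smul_eq_mul, ENNReal.ofReal_mul (by positivity)]

theorem isProbabilityMeasure_condPower {β δ : ℝ} (hβ : 0 < β) (hδ : 0 < δ) :
    IsProbabilityMeasure (condPower β δ) := by
  refine ⟨?_⟩
  have h1 := powerMeasure_Ioi hβ hδ
  rw [condPower, Measure.smul_apply, Measure.restrict_apply_univ, h1, smul_eq_mul,
    ← ENNReal.ofReal_mul (by positivity), ← Real.rpow_add hδ, add_neg_cancel, Real.rpow_zero,
    ENNReal.ofReal_one]

theorem measurable_size (hX : IsStationaryGWI P A B X) (s : ℤ) (x : ℝ) :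
    Measurable fun ω => (X s ω : ℝ) ^ (3 / 2 : ℝ) / x :=
  (measurable_of_countable fun n : ℕ => (n : ℝ) ^ (3 / 2 : ℝ) / x).comp (hX.measurable_X s)

theorem measurableSet_lt_size (hX : IsStationaryGWI P A B X) (s : ℤ) (y : ℝ) :
    MeasurableSet {ω | y < (X s ω : ℝ) ^ (3 / 2 : ℝ)} :=
  hX.measurable_X s (MeasurableSet.of_discrete (s := {n : ℕ | y < (n : ℝ) ^ (3 / 2 : ℝ)}))

theorem measure_lt_size_ne_zero (hX : IsStationaryGWI P A B X)
    (hpos : ∀ x, 0 < scaleFn P X x) (s : ℤ) (y : ℝ) :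
    P {ω | y < (X s ω : ℝ) ^ (3 / 2 : ℝ)} ≠ 0 := by
  intro h0
  have h1 : P.real {ω | max y 0 < (X s ω : ℝ) ^ (3 / 2 : ℝ)} = 0 := by
    rw [Measure.real, measure_mono_null (fun ω hω => ?_) h0, ENNReal.toReal_zero]
    exact lt_of_le_of_lt (le_max_left _ _) (show max y 0 < _ from hω)
  rw [hX.measureReal_lt_rpow s (le_max_right _ _)] at h1
  exact (hpos _).ne' h1

theorem tendsto_cond_size (hX : IsStationaryGWI P A B X) {β : ℝ} (hβ : 0 < β)
    (hpos : ∀ x, 0 < scaleFn P X x)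
    (hratio : ∀ q : ℝ, 0 < q → Tendsto (fun x => scaleFn P X (q * x) / scaleFn P X x) atTop
      (𝓝 (q ^ (-β)))) (s : ℤ) {δ : ℝ} (hδ : 0 < δ) {μ : ℝ → ProbabilityMeasure ℝ}
    (hμ : ∀ x, (μ x : Measure ℝ) = (P[|{ω | δ * x < (X s ω : ℝ) ^ (3 / 2 : ℝ)}]).map
      fun ω => (X s ω : ℝ) ^ (3 / 2 : ℝ) / x) {π : ProbabilityMeasure ℝ}
    (hπ : (π : Measure ℝ) = condPower β δ) : Tendsto μ atTop (𝓝 π) := by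
  refine tendsto_probabilityMeasure_real fun t => ?_
  have hmax : 0 < max t δ := lt_max_of_lt_right hδ
  have h1 : Tendsto (fun x => (scaleFn P X (max t δ * x) / scaleFn P X x) /
      (scaleFn P X (δ * x) / scaleFn P X x)) atTop (𝓝 ((max t δ) ^ (-β) / δ ^ (-β))) :=
    (hratio _ hmax).div (hratio _ hδ) (Real.rpow_pos_of_pos hδ _).ne'
  have h2 : (π : Measure ℝ).real (Set.Ioi t) = (max t δ) ^ (-β) / δ ^ (-β) := by
    rw [Measure.real, hπ, condPower_Ioi hβ hδ, ENNReal.toReal_ofReal (by positivity),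
      Real.rpow_neg hδ.le, div_inv_eq_mul, mul_comm]
  rw [h2]
  refine h1.congr' ?_
  filter_upwards [eventually_gt_atTop 0] with x hx
  rw [div_div_div_cancel_right₀ (hpos x).ne', hμ,
    map_measureReal_apply (measurable_size hX s x) measurableSet_Ioi, Measure.real,
    cond_apply (measurableSet_lt_size hX s _), ENNReal.toReal_mul, ENNReal.toReal_inv,
    ← hX.measureReal_lt_rpow s (y := δ * x) (by positivity),
    ← hX.measureReal_lt_rpow s (y := max t δ * x) (by positivity), div_eq_inv_mul]
  simp only [Measure.real]
  congr 3
  ext ω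
  change max t δ * x < _ ↔ δ * x < _ ∧ t < _ / x
  rw [lt_div_iff₀ hx, max_mul_of_nonneg _ _ hx.le, max_lt_iff, and_comm]

theorem powerMeasure_restrict_eq {β δ : ℝ} (hδ : 0 < δ) :
    (powerMeasure β).restrict (Set.Ioi δ) = ENNReal.ofReal (δ ^ (-β)) • condPower β δ := by
  rw [condPower, smul_smul, ← ENNReal.ofReal_mul (by positivity), ← Real.rpow_add hδ,
    neg_add_cancel, Real.rpow_zero, ENNReal.ofReal_one, one_smul]

/-- Given that generation `s` is large, the pair process from time `s` on converges in law. -/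
theorem IsStationaryGWI.tendsto_cond_fidi (hX : IsStationaryGWI P A B X) {α : ℝ}
    (hA : MemLp (fun ω => (A 0 0 ω : ℝ)) 2 P) (hμ : offspringMean P A ∈ Set.Ioo (0 : ℝ) 1)
    (hα : α ∈ Set.Ioo (1 : ℝ) 2) (hB : RegVar (tailFn P (B 0)) α) (s : ℤ) (K : ℕ)
    {δ : ℝ} (hδ : 0 < δ) (f : (Fin K → ℝ × ℝ) →ᵇ ℝ) :
    Tendsto (fun x : ℝ => (∫ ω in {ω | δ * x < (X s ω : ℝ) ^ (3 / 2 : ℝ)},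
        f (fun k => x⁻¹ • pairProcess P A B X (s + (k : ℕ)) ω) ∂P) / scaleFn P X x) atTop
      (𝓝 (∫ p : ℝ × (ℤ → ℝ) in {p | δ < p.1}, f (fun k =>
        (p.1 * genScale (offspringMean P A) (k : ℕ)) • ((1, p.2 (s + (k : ℕ))) : ℝ × ℝ))
          ∂((powerMeasure (2 * α / 3)).prod (gaussSeq (offspringVar P A))))) := by
  set m := offspringMean P A with hm
  set v := offspringVar P A with hv
  set β := 2 * α / 3 with hβ
  have hβ0 : 0 < β := by have := hα.1; positivity
  have hBfin := lintegral_natCast_lt_top (hX.measurable_B 0) hB hα.1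
  have hreg := hX.regVar_X hA hμ hα hB
  have hpos : ∀ x, 0 < scaleFn P X x := fun x =>
    hreg.pos (tailFn_antitone _) (tailFn_nonneg _) _
  have hratio : ∀ q : ℝ, 0 < q → Tendsto (fun x => scaleFn P X (q * x) / scaleFn P X x) atTop
      (𝓝 (q ^ (-β))) := fun q hq => regVar_comp_rpow hreg hq
  let T : ℝ → Set ℕ := fun x => {n | δ * x < (n : ℝ) ^ (3 / 2 : ℝ)}
  have hTm : ∀ x, MeasurableSet (X s ⁻¹' T x) := fun x => measurableSet_lt_size hX s _
  have hcond : ∀ x, IsProbabilityMeasure (P[|X s ⁻¹' T x]) := fun x =>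
    cond_isProbabilityMeasure (measure_lt_size_ne_zero hX hpos s (δ * x))
  have hT : ∀ n₀ : ℕ, ∀ᶠ x : ℝ in atTop, ∀ n ∈ T x, n₀ ≤ n := by
    intro n₀
    filter_upwards [eventually_ge_atTop ((n₀ : ℝ) ^ (3 / 2 : ℝ) / δ)] with x hx n hn
    have h1 : (n₀ : ℝ) ^ (3 / 2 : ℝ) < (n : ℝ) ^ (3 / 2 : ℝ) := by
      rw [div_le_iff₀ hδ] at hx
      exact lt_of_le_of_lt (by linarith) hn
    have h2 := (Real.rpow_lt_rpow_iff (Nat.cast_nonneg _) (Nat.cast_nonneg _) (by norm_num)).1 h1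
    exact_mod_cast h2.le
  have hNm : ∀ n, Measurable (normPath P A B s K n) := fun n => hX.measurable_normPath s K n
  have hYN : Measurable fun ω => normPath P A B s K (X s ω) ω :=
    measurable_random_index (Y := normPath P A B s K) (hX.measurable_X s) hNm
  have hjm : ∀ x : ℝ, Measurable fun ω =>
      ((X s ω : ℝ) ^ (3 / 2 : ℝ) / x, normPath P A B s K (X s ω) ω) := fun x =>
    (measurable_size hX s x).prodMk hYN
  have hπp := isProbabilityMeasure_condPower hβ0 hδ
  obtain ⟨μ, hμ'⟩ : ∃ μ : ℝ → ProbabilityMeasure ℝ, ∀ x, (μ x : Measure ℝ) =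
      (P[|X s ⁻¹' T x]).map fun ω => (X s ω : ℝ) ^ (3 / 2 : ℝ) / x :=
    ⟨fun x => ⟨_, Measure.isProbabilityMeasure_map (measurable_size hX s x).aemeasurable⟩,
      fun x => rfl⟩
  obtain ⟨π, hπ⟩ : ∃ π : ProbabilityMeasure ℝ, (π : Measure ℝ) = condPower β δ := ⟨⟨_, hπp⟩, rfl⟩
  have hμπ : Tendsto μ atTop (𝓝 π) := tendsto_cond_size hX hβ0 hpos hratio s hδ hμ' hπ
  obtain ⟨Z, hZ⟩ : ∃ Z : (ℤ → ℝ) → Fin K → ℝ × ℝ,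
      Z = fun (z : ℤ → ℝ) (k : Fin K) => genScale m (k : ℕ) • ((1, z (s + (k : ℕ))) : ℝ × ℝ) := ⟨_, rfl⟩
  have hZm : Measurable Z := by rw [hZ]; fun_prop
  have hZp : IsProbabilityMeasure ((gaussSeq v).map Z) :=
    Measure.isProbabilityMeasure_map hZm.aemeasurable
  obtain ⟨ν, hν⟩ : ∃ ν : ℝ → ProbabilityMeasure (ℝ × (Fin K → ℝ × ℝ)), ∀ x, (ν x : Measure _) =
      (P[|X s ⁻¹' T x]).map fun ω =>
        ((X s ω : ℝ) ^ (3 / 2 : ℝ) / x, normPath P A B s K (X s ω) ω) :=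
    ⟨fun x => ⟨_, Measure.isProbabilityMeasure_map (hjm x).aemeasurable⟩, fun x => rfl⟩
  obtain ⟨ν', hν'⟩ : ∃ ν' : ProbabilityMeasure (ℝ × (Fin K → ℝ × ℝ)), (ν' : Measure _) =
      (condPower β δ).prod ((gaussSeq v).map Z) := ⟨⟨_, inferInstance⟩, rfl⟩
  have hνν' : Tendsto ν atTop (𝓝 ν') :=
    tendsto_mixture (Y := normPath P A B s K) (hX.measurable_X s) hNm
      (hX.indepFun_future hA hμ s (measurable_normPath_future s K))
      (hZ ▸ hX.tendstoInDistribution_normPath hA hμ hBfin s K) hT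
      (fun x n => (n : ℝ) ^ (3 / 2 : ℝ) / x) hμ' hμπ hν (hπ ▸ hν')
  obtain ⟨Φ, hΦdef⟩ : ∃ Φ : ℝ × (Fin K → ℝ × ℝ) → Fin K → ℝ × ℝ,
    Φ = fun (p : ℝ × (Fin K → ℝ × ℝ)) (k : Fin K) => p.1 • p.2 k := ⟨_, rfl⟩
  have hΦ : Continuous Φ := by rw [hΦdef]; fun_prop
  have hlim : Tendsto (fun x => ∫ p, f (Φ p) ∂(ν x : Measure (ℝ × (Fin K → ℝ × ℝ)))) atTop
      (𝓝 (∫ p, f (Φ p) ∂(ν' : Measure (ℝ × (Fin K → ℝ × ℝ))))) := (ProbabilityMeasure.tendsto_iff_forall_integral_tendsto.1 hνν')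
    (f.compContinuous ⟨Φ, hΦ⟩)
  -- P(X_0^{3/2} > δx)/P(X_0^{3/2} > x) → δ^{-β} converts the conditional expectation into an
  -- integral normalised at level x. The same factor turns `condPower` back into the restriction of
  -- `powerMeasure`.
  have hr := (hratio δ hδ).mul hlim
  have hFm : Measurable fun p => f (Φ p) := f.continuous.measurable.comp hΦ.measurable
  have hlimit : δ ^ (-β) * ∫ p, f (Φ p) ∂(ν' : Measure (ℝ × (Fin K → ℝ × ℝ))) =
      ∫ p : ℝ × (ℤ → ℝ) in {p | δ < p.1}, f (fun k =>
        (p.1 * genScale m (k : ℕ)) • ((1, p.2 (s + (k : ℕ))) : ℝ × ℝ))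
          ∂((powerMeasure β).prod (gaussSeq v)) := by
    have h2 : ((powerMeasure β).prod (gaussSeq v)).restrict {p : ℝ × (ℤ → ℝ) | δ < p.1} =
        ((powerMeasure β).restrict (Set.Ioi δ)).prod (gaussSeq v) := by
      rw [← Measure.restrict_univ (μ := gaussSeq v), Measure.prod_restrict, Measure.restrict_univ]
      congr 1
      ext p
      simp
    have h3 : (condPower β δ).prod ((gaussSeq v).map Z) =
        ((condPower β δ).prod (gaussSeq v)).map (Prod.map id Z) := by
      rw [← Measure.map_prod_map _ _ measurable_id hZm, Measure.map_id]
    rw [hν', h3, h2, powerMeasure_restrict_eq hδ, Measure.prod_smul_left, integral_smul_measure,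
      ENNReal.toReal_ofReal (by positivity), smul_eq_mul]
    congr 1
    rw [integral_map (measurable_id.prodMap hZm).aemeasurable hFm.aestronglyMeasurable]
    refine integral_congr_ae (Eventually.of_forall fun p => ?_)
    simp [hΦdef, hZ, mul_smul]
  rw [hlimit] at hr
  refine hr.congr' ?_
  filter_upwards [eventually_gt_atTop 0, hT 1] with x hx hx1
  have h3 : ∫ p, f (Φ p) ∂(ν x : Measure (ℝ × (Fin K → ℝ × ℝ))) =
      (scaleFn P X (δ * x))⁻¹ * ∫ ω in {ω | δ * x < (X s ω : ℝ) ^ (3 / 2 : ℝ)},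
        f (fun k => x⁻¹ • pairProcess P A B X (s + (k : ℕ)) ω) ∂P := by
    rw [hν, integral_map (hjm x).aemeasurable hFm.aestronglyMeasurable, ProbabilityTheory.cond,
      integral_smul_measure, smul_eq_mul, ENNReal.toReal_inv]
    congr 1
    · rw [← hX.measureReal_lt_rpow s (by positivity)]; rfl
    · refine integral_congr_ae ?_
      filter_upwards [ae_restrict_mem (hTm x), ae_restrict_of_ae hX.ae_eq_gwPath] with ω hω hω'
      congr 1
      funext k
      rw [hΦdef]
      exact (pairProcess_eq_normPath (hω' s) (hx1 _ hω) x k).symm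
  rw [h3]
  have := (hpos (δ * x)).ne'
  have := (hpos x).ne'
  field_simp

end Stationary

/-! ### The limit measure -/

theorem integrable_of_bounded_of_eq_zero {Ω : Type*} [MeasurableSpace Ω] {μ : Measure Ω}
    {f : Ω → ℝ} (hf : AEStronglyMeasurable f μ) {s : Set Ω} (hs : MeasurableSet s)
    (hμs : μ s ≠ ∞) {C : ℝ} (hC : ∀ x, |f x| ≤ C) (h0 : ∀ x, x ∉ s → f x = 0) :
    Integrable f μ := by
  have hi : Integrable (s.indicator fun _ => C) μ := (integrableOn_const hμs).integrable_indicator hs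
  refine hi.mono' hf (Eventually.of_forall fun x => ?_)
  by_cases hx : x ∈ s
  · rw [Set.indicator_of_mem hx]
    exact hC x
  · rw [Set.indicator_of_notMem hx, h0 x hx, norm_zero]

/-- The moment of order `β` of `max 1 |Z|`, where `Z` is centered Gaussian with variance `v`. -/
noncomputable def gaussMoment (v β : ℝ) : ℝ≥0∞ :=
  ∫⁻ z, ENNReal.ofReal ((max 1 |z|) ^ β) ∂gaussianReal 0 v.toNNReal

theorem measurable_max_one_abs_rpow (β : ℝ) : Measurable fun z : ℝ => (max 1 |z|) ^ β :=
  (measurable_const.max measurable_norm).pow_const _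

theorem gaussMoment_ne_top (v : ℝ) {β : ℝ} (hβ : β ≤ 2) : gaussMoment v β ≠ ∞ := by
  have hi : Integrable (fun z : ℝ => 1 + z ^ 2) (gaussianReal 0 v.toNNReal) :=
    (integrable_const 1).add (memLp_id_gaussianReal 2).integrable_sq
  refine ((lintegral_mono fun z => ENNReal.ofReal_le_ofReal ?_).trans_lt hi.lintegral_lt_top).ne
  have h1 : (1 : ℝ) ≤ max 1 |z| := le_max_left _ _
  refine (Real.rpow_le_rpow_of_exponent_le h1 hβ).trans ?_
  rw [Real.rpow_two]
  rcases le_total 1 |z| with h | h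
  · rw [max_eq_right h, sq_abs]
    linarith
  · rw [max_eq_left h]
    nlinarith [sq_nonneg z]

theorem one_le_gaussMoment (v : ℝ) {β : ℝ} (hβ : 0 ≤ β) : 1 ≤ gaussMoment v β := by
  calc (1 : ℝ≥0∞) = ∫⁻ _, 1 ∂gaussianReal 0 v.toNNReal := by simp
    _ ≤ _ := lintegral_mono fun z => by
      rw [← ENNReal.ofReal_one]
      exact ENNReal.ofReal_le_ofReal (Real.one_le_rpow (le_max_left _ _) hβ)

theorem lintegral_gaussSeq_moment (v β : ℝ) {g : ℝ} (hg : 0 < g) (k : ℤ) :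
    ∫⁻ z, ENNReal.ofReal ((g * max 1 |z k|) ^ β) ∂gaussSeq v =
      ENNReal.ofReal (g ^ β) * gaussMoment v β := by
  rw [gaussMoment, ← map_eval_gaussSeq v k,
    lintegral_map (measurable_max_one_abs_rpow β).ennreal_ofReal (measurable_pi_apply k),
    ← lintegral_const_mul' _ _ ENNReal.ofReal_ne_top]
  refine lintegral_congr fun z => ?_
  rw [← ENNReal.ofReal_mul (by positivity), Real.mul_rpow hg.le (by positivity)]

/-- Integrating out the radial variable first gives (y/φ)^{-β} = y^{-β} φ^β, a Breiman-type formula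
which is exact for the pure power law. -/
theorem powerMeasure_prod_lt {E : Type*} [MeasurableSpace E] (γ : Measure E) [SFinite γ] {β y : ℝ}
    (hβ : 0 < β) (hy : 0 < y) {φ : E → ℝ} (hφ : Measurable φ) (hφ0 : ∀ z, 0 < φ z) :
    ((powerMeasure β).prod γ) {p | y < p.1 * φ p.2} =
      ENNReal.ofReal (y ^ (-β)) * ∫⁻ z, ENNReal.ofReal (φ z ^ β) ∂γ := by
  have hms : MeasurableSet {p : ℝ × E | y < p.1 * φ p.2} :=
    measurableSet_lt measurable_const (measurable_fst.mul (hφ.comp measurable_snd))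
  rw [Measure.prod_apply_symm hms, ← lintegral_const_mul' _ _ ENNReal.ofReal_ne_top]
  refine lintegral_congr fun z => ?_
  have h1 : (fun r : ℝ => (r, z)) ⁻¹' {p : ℝ × E | y < p.1 * φ p.2} = Set.Ioi (y / φ z) := by
    ext r
    exact (div_lt_iff₀ (hφ0 z)).symm
  rw [h1, powerMeasure_Ioi hβ (div_pos hy (hφ0 z)), ← ENNReal.ofReal_mul (by positivity),
    Real.div_rpow hy.le (hφ0 z).le, Real.rpow_neg (hφ0 z).le, div_inv_eq_mul]

theorem norm_smul_one_pair (r z : ℝ) : ‖r • ((1, z) : ℝ × ℝ)‖ = |r| * max 1 |z| := by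
  rw [norm_smul, Prod.norm_def, norm_one, Real.norm_eq_abs, Real.norm_eq_abs]

theorem measure_lt_norm_smul_pair {v β g y : ℝ} (hβ : 0 < β) (hg : 0 < g) (hy : 0 < y) (k : ℤ) :
    ((powerMeasure β).prod (gaussSeq v)) {p | y < ‖(p.1 * g) • ((1, p.2 k) : ℝ × ℝ)‖} =
      ENNReal.ofReal (y ^ (-β)) * (ENNReal.ofReal (g ^ β) * gaussMoment v β) := by
  rw [← lintegral_gaussSeq_moment v β hg k, ← powerMeasure_prod_lt (gaussSeq v) hβ hy
    (φ := fun z => g * max 1 |z k|) ((measurable_const.max (measurable_pi_apply k).norm).const_mul g)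
    fun z => mul_pos hg (lt_max_of_lt_left one_pos)]
  refine measure_congr ?_
  filter_upwards [Measure.quasiMeasurePreserving_fst.ae (ae_pos_powerMeasure β)] with p hp
  refine propext ?_
  change y < ‖_‖ ↔ y < _
  rw [norm_smul_one_pair, abs_of_pos (mul_pos hp hg), mul_assoc]

/-- The measure of the first times `u` for which generation `k` belongs to the large cluster. -/
noncomputable def genMass (m α : ℝ) (k : ℤ) : ℝ := m ^ (-(α * (k : ℝ)))

theorem genMass_pos {m : ℝ} (hm : 0 < m) (α : ℝ) (k : ℤ) : 0 < genMass m α k :=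
  Real.rpow_pos_of_pos hm _

theorem genMass_mono {m α : ℝ} (hm : 0 < m) (hm1 : m ≤ 1) (hα : 0 ≤ α) : Monotone (genMass m α) := by
  intro k l h
  refine Real.rpow_le_rpow_of_exponent_ge hm hm1 (neg_le_neg (mul_le_mul_of_nonneg_left ?_ hα))
  exact_mod_cast h

/-- The identity that makes the limit measure compatible with stationarity. Generation k is present
for u in an interval of length m^{-αk}, while its size carries the factor m^{3k/2}, whose β-th power
is m^{αk}; the effects cancel and all times have the same tail (`limitMeasure_lt_norm`). -/
theorem genMass_mul_genScale {m : ℝ} (hm : 0 < m) (α : ℝ) (k : ℤ) :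
    genMass m α k * genScale m k ^ (2 * α / 3) = 1 := by
  rw [genMass, genScale, ← Real.rpow_mul hm.le, ← Real.rpow_add hm]
  convert Real.rpow_zero m using 2
  ring

/-- The space on which the infinite limit measure lives: the coordinates are the position of the
first large generation, the size of generation `0` and the Gaussian fluctuations. -/
abbrev LimitSpace : Type := ℝ × ℝ × (ℤ → ℝ)

/-- The infinite limit measure. -/
noncomputable def limitMeasure (β v : ℝ) : Measure LimitSpace :=
  (volume.restrict (Set.Ioi 0)).prod ((powerMeasure β).prod (gaussSeq v))

/-- The limit of the pair process under the infinite limit measure. -/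
noncomputable def limitProcess (m α : ℝ) (k : ℤ) (p : LimitSpace) : ℝ × ℝ :=
  {p : LimitSpace | p.1 ≤ genMass m α k}.indicator (fun p => spine m p.2.1 p.2.2 k) p

theorem limitProcess_of_le {m α : ℝ} {k : ℤ} {p : LimitSpace} (h : p.1 ≤ genMass m α k) :
    limitProcess m α k p = spine m p.2.1 p.2.2 k :=
  Set.indicator_of_mem (s := {p : LimitSpace | p.1 ≤ genMass m α k}) h _

theorem limitProcess_of_not_le {m α : ℝ} {k : ℤ} {p : LimitSpace} (h : ¬ p.1 ≤ genMass m α k) :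
    limitProcess m α k p = 0 :=
  Set.indicator_of_notMem (s := {p : LimitSpace | p.1 ≤ genMass m α k}) h _

theorem measurable_spine (m : ℝ) (k : ℤ) :
    Measurable fun p : ℝ × (ℤ → ℝ) => spine m p.1 p.2 k := by
  unfold spine
  fun_prop

theorem measurable_limitProcess (m α : ℝ) (k : ℤ) : Measurable (limitProcess m α k) :=
  ((measurable_spine m k).comp measurable_snd).indicator
    (measurableSet_le measurable_fst measurable_const)

theorem volume_restrict_Iic {c : ℝ} :
    (volume.restrict (Set.Ioi (0 : ℝ))) (Set.Iic c) = ENNReal.ofReal c := by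
  rw [Measure.restrict_apply measurableSet_Iic, Set.inter_comm, Set.Ioi_inter_Iic, Real.volume_Ioc,
    sub_zero]

theorem limitMeasure_lt_norm {m α v y : ℝ} (hm : 0 < m) (hα : 0 < α) (hy : 0 < y) (k : ℤ) :
    limitMeasure (2 * α / 3) v {p | y < ‖ limitProcess m α k p‖} =
      ENNReal.ofReal (y ^ (-(2 * α / 3))) * gaussMoment v (2 * α / 3) := by
  have h1 : {p : LimitSpace | y < ‖ limitProcess m α k p‖} = Set.Iic (genMass m α k) ×ˢ
      {p : ℝ × (ℤ → ℝ) | y < ‖(p.1 * genScale m k) • ((1, p.2 k) : ℝ × ℝ)‖} := by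
    ext p
    by_cases hp : p.1 ≤ genMass m α k
    · change y < ‖_‖ ↔ p.1 ≤ _ ∧ y < ‖_‖
      rw [limitProcess_of_le hp, spine]
      simp [hp]
    · change y < ‖_‖ ↔ p.1 ≤ _ ∧ y < ‖_‖
      rw [limitProcess_of_not_le hp, norm_zero]
      simp [hp, hy.le]
  rw [h1, limitMeasure, Measure.prod_prod, volume_restrict_Iic,
    measure_lt_norm_smul_pair (by positivity) (genScale_pos hm k) hy, mul_left_comm,
    ← mul_assoc (ENNReal.ofReal _) (ENNReal.ofReal _) (gaussMoment _ _),
    ← ENNReal.ofReal_mul (genMass_pos hm α k).le, genMass_mul_genScale hm, ENNReal.ofReal_one, one_mul]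

/-! ### Truncation in time -/

/-- Set the coordinates before time `κ` to zero. -/
noncomputable def truncBelow {I : Finset ℤ} (κ : ℤ) (w : I → ℝ × ℝ) (i : I) : ℝ × ℝ :=
  if κ ≤ i then w i else 0

theorem continuous_truncBelow {I : Finset ℤ} (κ : ℤ) : Continuous (truncBelow (I := I) κ) := by
  refine continuous_pi fun i => ?_
  by_cases h : κ ≤ (i : ℤ)
  · simp only [truncBelow, h, if_true]
    fun_prop
  · simp only [truncBelow, h, if_false]
    fun_prop

theorem norm_truncBelow_le {I : Finset ℤ} (κ : ℤ) (w : I → ℝ × ℝ) : ‖truncBelow κ w‖ ≤ ‖w‖ := by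
  refine (pi_norm_le_iff_of_nonneg (norm_nonneg _)).2 fun i => ?_
  rw [truncBelow]
  split_ifs
  · exact norm_le_pi_norm w i
  · rw [norm_zero]
    exact norm_nonneg _

theorem truncBelow_of_le {I : Finset ℤ} {κ : ℤ} (h : ∀ i : I, κ ≤ i) (w : I → ℝ × ℝ) :
    truncBelow κ w = w := by
  funext i
  rw [truncBelow, if_pos (h i)]

theorem truncBelow_of_lt {I : Finset ℤ} {κ : ℤ} (h : ∀ i : I, (i : ℤ) < κ) (w : I → ℝ × ℝ) :
    truncBelow κ w = 0 := by
  funext i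
  rw [truncBelow, if_neg (not_le.2 (h i)), Pi.zero_apply]

theorem truncBelow_truncBelow {I : Finset ℤ} {κ l : ℤ} (h : κ ≤ l) (w : I → ℝ × ℝ) :
    truncBelow l (truncBelow κ w) = truncBelow l w := by
  funext i
  simp only [truncBelow]
  by_cases hi : l ≤ (i : ℤ)
  · rw [if_pos hi, if_pos hi, if_pos (h.trans hi)]
  · rw [if_neg hi, if_neg hi]

theorem truncBelow_succ_eq {I : Finset ℤ} {κ : ℤ} {w : I → ℝ × ℝ}
    (h : ∀ i : I, (i : ℤ) = κ → w i = 0) : truncBelow κ w = truncBelow (κ + 1) w := by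
  funext i
  simp only [truncBelow]
  rcases lt_trichotomy (i : ℤ) κ with hi | hi | hi
  · rw [if_neg (by omega), if_neg (by omega)]
  · rw [if_pos (by omega), if_neg (by omega), h i hi]
  · rw [if_pos (by omega), if_pos (by omega)]

/-- Erasing one more time changes the vector by its κ-th coordinate only. For a Lipschitz functional
the telescoping increment is therefore small unless coordinate κ is large. -/
theorem norm_truncBelow_sub_le {I : Finset ℤ} (κ : I) (w : I → ℝ × ℝ) :
    ‖truncBelow κ w - truncBelow (κ + 1) w‖ ≤ ‖w κ‖ := by
  refine (pi_norm_le_iff_of_nonneg (norm_nonneg _)).2 fun i => ?_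
  simp only [Pi.sub_apply, truncBelow]
  rcases lt_trichotomy (i : ℤ) κ with hi | hi | hi
  · rw [if_neg (by omega), if_neg (by omega), sub_zero, norm_zero]
    exact norm_nonneg _
  · rw [if_pos (by omega), if_neg (by omega), sub_zero, Subtype.ext hi]
  · rw [if_pos (by omega), if_pos (by omega), sub_self, norm_zero]
    exact norm_nonneg _

/-! ### Convergence of functionals that vanish near the origin -/

section Stationary

variable {Ω : Type*} [MeasurableSpace Ω] {P : Measure Ω} [IsProbabilityMeasure P]
    {A : ℤ → ℕ → Ω → ℕ} {B : ℤ → Ω → ℕ} {X : ℤ → Ω → ℕ}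

theorem IsStationaryGWI.measurable_pairProcess (hX : IsStationaryGWI P A B X) (k : ℤ) :
    Measurable (pairProcess P A B X k) := by
  have h : ∀ k, Measurable fun ω => (X k ω : ℝ) := fun k =>
    (measurable_of_countable fun n : ℕ => (n : ℝ)).comp (hX.measurable_X k)
  refine ((h k).pow_const _).prodMk ((h k).mul ?_)
  exact ((h _).sub ((h _).const_mul _)).sub_const _

theorem IsStationaryGWI.measurable_scaled (hX : IsStationaryGWI P A B X) (I : Finset ℤ) (x : ℝ) :
    Measurable fun ω (i : I) => x⁻¹ • pairProcess P A B X i ω :=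
  measurable_pi_lambda _ fun i => (hX.measurable_pairProcess i).const_smul x⁻¹

theorem IsStationaryGWI.scaleFn_pos (hX : IsStationaryGWI P A B X) {α : ℝ}
    (hA : MemLp (fun ω => (A 0 0 ω : ℝ)) 2 P) (hμ : offspringMean P A ∈ Set.Ioo (0 : ℝ) 1)
    (hα : α ∈ Set.Ioo (1 : ℝ) 2) (hB : RegVar (tailFn P (B 0)) α) (x : ℝ) : 0 < scaleFn P X x :=
  (hX.regVar_X hA hμ hα hB).pos (tailFn_antitone _) (tailFn_nonneg _) _

/-- Either the generation is small, which `small_generation` controls, or X_i^{3/2} exceeds a fixed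
multiple of x, which has a regularly varying probability. -/
theorem IsStationaryGWI.exists_norm_le_mul_scaleFn (hX : IsStationaryGWI P A B X) {α : ℝ}
    (hA : MemLp (fun ω => (A 0 0 ω : ℝ)) 2 P) (hμ : offspringMean P A ∈ Set.Ioo (0 : ℝ) 1)
    (hα : α ∈ Set.Ioo (1 : ℝ) 2) (hB : RegVar (tailFn P (B 0)) α) (i : ℤ) {η : ℝ} (hη : 0 < η) :
    ∃ C : ℝ, 0 ≤ C ∧ ∀ᶠ x : ℝ in atTop,
      P.real {ω | η * x < ‖ pairProcess P A B X i ω‖} ≤ C * scaleFn P X x := by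
  obtain ⟨δ₀, hδ₀, h⟩ := hX.small_generation hA hμ hα hB i hη one_pos
  have hδ : 0 < δ₀ / 2 := half_pos hδ₀
  have hpos := hX.scaleFn_pos hA hμ hα hB
  have hr : Tendsto (fun x => scaleFn P X (δ₀ / 2 * x) / scaleFn P X x) atTop
      (𝓝 ((δ₀ / 2) ^ (-(2 * α / 3)))) := regVar_comp_rpow (hX.regVar_X hA hμ hα hB) hδ
  refine ⟨1 + ((δ₀ / 2) ^ (-(2 * α / 3)) + 1), by positivity, ?_⟩
  filter_upwards [h _ hδ (half_lt_self hδ₀), hr.eventually (gt_mem_nhds (lt_add_one _)),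
    eventually_ge_atTop 0] with x h1 h2 hx
  rw [div_lt_iff₀ (hpos x)] at h2
  rw [add_mul]
  refine le_trans ?_ (add_le_add h1 h2.le)
  rw [← hX.measureReal_lt_rpow i (by positivity)]
  refine (measureReal_mono ?_).trans (measureReal_union_le _ _)
  intro ω hω
  by_cases hc : (X i ω : ℝ) ^ (3 / 2 : ℝ) ≤ δ₀ / 2 * x
  · exact Or.inl ⟨hω, hc⟩
  · exact Or.inr (not_le.1 hc)

theorem IsStationaryGWI.exists_pi_norm_le_mul_scaleFn (hX : IsStationaryGWI P A B X) {α : ℝ}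
    (hA : MemLp (fun ω => (A 0 0 ω : ℝ)) 2 P) (hμ : offspringMean P A ∈ Set.Ioo (0 : ℝ) 1)
    (hα : α ∈ Set.Ioo (1 : ℝ) 2) (hB : RegVar (tailFn P (B 0)) α) (I : Finset ℤ) {η : ℝ}
    (hη : 0 < η) :
    ∃ C : ℝ, 0 ≤ C ∧ ∀ᶠ x : ℝ in atTop,
      P.real {ω | η < ‖fun i : I => x⁻¹ • pairProcess P A B X i ω‖} ≤ C * scaleFn P X x := by
  choose C hC h using fun i : I => hX.exists_norm_le_mul_scaleFn hA hμ hα hB i hη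
  refine ⟨∑ i, C i, Finset.sum_nonneg fun i _ => hC i, ?_⟩
  filter_upwards [eventually_all.2 h, eventually_gt_atTop 0] with x hx hx0
  rw [Finset.sum_mul]
  refine le_trans ?_ (Finset.sum_le_sum fun i _ => hx i)
  refine (measureReal_mono ?_).trans (measureReal_iUnion_fintype_le _)
  intro ω (hω : η < _)
  by_contra hc
  rw [Set.mem_iUnion, not_exists] at hc
  refine not_le.2 hω ((pi_norm_le_iff_of_nonneg hη.le).2 fun i => ?_)
  have h1 : ¬ η * x < ‖ pairProcess P A B X i ω‖ := hc i
  rw [norm_smul, norm_inv, Real.norm_of_nonneg hx0.le, inv_mul_le_iff₀ hx0, mul_comm]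
  exact not_lt.1 h1

theorem tendsto_setIntegral_of_lt {E : Type*} [MeasurableSpace E] {μ : Measure (ℝ × E)}
    {H : ℝ × E → ℝ} (hH : Integrable H μ) (hpos : ∀ᵐ p ∂μ, 0 < p.1) :
    Tendsto (fun δ : ℝ => ∫ p in {p | δ < p.1}, H p ∂μ) (𝓝[>] 0) (𝓝 (∫ p, H p ∂μ)) := by
  have hms : ∀ δ : ℝ, MeasurableSet {p : ℝ × E | δ < p.1} := fun δ =>
    measurableSet_lt measurable_const measurable_fst
  simp only [← integral_indicator (hms _)]
  refine tendsto_integral_filter_of_dominated_convergence (fun p => ‖H p‖)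
    (Eventually.of_forall fun δ => hH.aestronglyMeasurable.indicator (hms δ))
    (Eventually.of_forall fun δ => Eventually.of_forall fun p => norm_indicator_le_norm_self _ _)
    hH.norm ?_
  filter_upwards [hpos] with p hp
  refine tendsto_const_nhds.congr' ?_
  filter_upwards [mem_nhdsWithin_of_mem_nhds (gt_mem_nhds hp)] with δ hδ
  exact (Set.indicator_of_mem (by exact hδ) _).symm

theorem norm_pi_gt_subset_iUnion {ι T : Type*} [Fintype ι] {η : ℝ} (hη : 0 ≤ η)
    (W : ι → T → ℝ × ℝ) : {p | η < ‖fun i => W i p‖} ⊆ ⋃ i, {p | η < ‖W i p‖} := by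
  intro p (hp : η < _)
  by_contra hc
  rw [Set.mem_iUnion, not_exists] at hc
  exact not_le.2 hp ((pi_norm_le_iff_of_nonneg hη).2 fun i => not_lt.1 (hc i))

/-- The contribution of the paths whose first large generation is `κ`. -/
theorem IsStationaryGWI.tendsto_first_generation (hX : IsStationaryGWI P A B X) {α : ℝ}
    (hA : MemLp (fun ω => (A 0 0 ω : ℝ)) 2 P) (hμ : offspringMean P A ∈ Set.Ioo (0 : ℝ) 1)
    (hα : α ∈ Set.Ioo (1 : ℝ) 2) (hB : RegVar (tailFn P (B 0)) α) {I : Finset ℤ} (κ : I)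
    {h : (I → ℝ × ℝ) → ℝ} (hc : Continuous h) {C L η : ℝ} (hη : 0 < η) (hL0 : 0 ≤ L)
    (hC : ∀ w, |h w| ≤ C) (h0 : ∀ w, ‖w‖ ≤ η → h w = 0) (hL : ∀ w, |h w| ≤ L * ‖w κ‖)
    (hdep : ∀ w, h (truncBelow κ w) = h w) :
    Tendsto (fun x : ℝ => (∫ ω, h (fun i : I => x⁻¹ • pairProcess P A B X i ω) ∂P) / scaleFn P X x)
      atTop (𝓝 (∫ p : ℝ × (ℤ → ℝ), h (fun i =>
        (p.1 * genScale (offspringMean P A) (i - κ)) • ((1, p.2 i) : ℝ × ℝ))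
          ∂((powerMeasure (2 * α / 3)).prod (gaussSeq (offspringVar P A))))) := by
  set m := offspringMean P A with hm
  set v := offspringVar P A with hv
  have hm0 : 0 < m := hμ.1
  set β := 2 * α / 3 with hβ
  have hβ0 : 0 < β := by have := hα.1; positivity
  have hβ2 : β ≤ 2 := by rw [hβ]; linarith [hα.2]
  have hpos := hX.scaleFn_pos hA hμ hα hB
  have hC0 : 0 ≤ C := (abs_nonneg _).trans (hC 0)
  let W : I → ℝ × (ℤ → ℝ) → ℝ × ℝ := fun i p => (p.1 * genScale m (i - κ)) • ((1, p.2 i) : ℝ × ℝ)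
  have hWm : ∀ i, Measurable (W i) := fun i => by simp only [W]; fun_prop
  have hHm : Measurable fun p => h (fun i => W i p) :=
    hc.measurable.comp (measurable_pi_lambda _ hWm)
  have hint : Integrable (fun p => h (fun i => W i p)) ((powerMeasure β).prod (gaussSeq v)) := by
    refine integrable_of_bounded_of_eq_zero hHm.aestronglyMeasurable
      (s := {p | η < ‖fun i => W i p‖})
      (measurableSet_lt measurable_const (measurable_pi_lambda _ hWm).norm) ?_ (fun p => hC _)
      fun p hp => h0 _ (not_lt.1 hp)
    refine ne_top_of_le_ne_top ?_ ((measure_mono (norm_pi_gt_subset_iUnion hη.le W)).trans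
      (measure_iUnion_fintype_le _ _))
    refine (ENNReal.sum_lt_top.2 fun i _ => ?_).ne
    simp only [W]
    rw [measure_lt_norm_smul_pair hβ0 (genScale_pos hm0 _) hη]
    exact ENNReal.mul_lt_top ENNReal.ofReal_lt_top
      (ENNReal.mul_lt_top ENNReal.ofReal_lt_top (gaussMoment_ne_top v hβ2).lt_top)
  have hJ := tendsto_setIntegral_of_lt hint
    (Measure.quasiMeasurePreserving_fst.ae (ae_pos_powerMeasure β))
  -- the contribution of large generations
  obtain ⟨K, hK⟩ : ∃ K : ℕ, ∀ i : I, ((i : ℤ) - κ).toNat < K := by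
    refine ⟨(Finset.univ.sup fun i : I => ((i : ℤ) - κ).toNat) + 1, fun i => ?_⟩
    exact Nat.lt_succ_of_le (Finset.le_sup (f := fun i : I => ((i : ℤ) - κ).toNat)
      (Finset.mem_univ i))
  -- The window of length K starting at κ covers all of I after κ. Coordinates before κ are set to
  -- 0, which `hdep` allows.
  let Ψ : (Fin K → ℝ × ℝ) → I → ℝ × ℝ := fun w i =>
    if (κ : ℤ) ≤ i then w ⟨((i : ℤ) - κ).toNat, hK i⟩ else 0
  have hΨ : Continuous Ψ := by
    refine continuous_pi fun i => ?_
    by_cases hi : (κ : ℤ) ≤ i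
    · simp only [Ψ, hi, if_true]
      fun_prop
    · simp only [Ψ, hi, if_false]
      fun_prop
  let f : (Fin K → ℝ × ℝ) →ᵇ ℝ :=
    BoundedContinuousFunction.ofNormedAddCommGroup (fun w => h (Ψ w)) (hc.comp hΨ) C fun w => hC _
  have hΨ1 : ∀ V : ℤ → ℝ × ℝ, h (Ψ fun k => V (κ + (k : ℕ))) = h (fun i => V i) := by
    intro V
    rw [← hdep fun i => V i]
    congr 1
    funext i
    simp only [Ψ, truncBelow]
    split_ifs with hi
    · congr 1
      omega
    · rfl
  have hlarge : ∀ δ : ℝ, 0 < δ →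
      Tendsto (fun x : ℝ => (∫ ω in {ω | δ * x < (X κ ω : ℝ) ^ (3 / 2 : ℝ)},
        h (fun i : I => x⁻¹ • pairProcess P A B X i ω) ∂P) / scaleFn P X x) atTop
      (𝓝 (∫ p in {p | δ < p.1}, h (fun i => W i p) ∂((powerMeasure β).prod (gaussSeq v)))) := by
    intro δ hδ
    have h1 := hX.tendsto_cond_fidi hA hμ hα hB κ K hδ f
    have h2 : ∀ (x : ℝ) ω, f (fun k => x⁻¹ • pairProcess P A B X (κ + (k : ℕ)) ω) =
        h (fun i : I => x⁻¹ • pairProcess P A B X i ω) := fun x ω =>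
      hΨ1 fun k => x⁻¹ • pairProcess P A B X k ω
    have h3 : ∀ p : ℝ × (ℤ → ℝ), f (fun k =>
        (p.1 * genScale m (k : ℕ)) • ((1, p.2 (κ + (k : ℕ))) : ℝ × ℝ)) = h (fun i => W i p) := by
      intro p
      have := hΨ1 fun k => (p.1 * genScale m (k - κ)) • ((1, p.2 k) : ℝ × ℝ)
      simp only [add_sub_cancel_left] at this
      exact this
    simp only [h2, ← hm, ← hv, ← hβ, h3] at h1
    exact h1
  -- the remainder
  obtain ⟨D, hD0, hD⟩ := hX.exists_pi_norm_le_mul_scaleFn hA hμ hα hB I hη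
  have hrem : ∀ ε' : ℝ, 0 < ε' → ∀ᶠ δ in 𝓝[>] (0 : ℝ), ∀ᶠ x : ℝ in atTop,
      |(∫ ω, h (fun i : I => x⁻¹ • pairProcess P A B X i ω) ∂P) / scaleFn P X x -
        (∫ ω in {ω | δ * x < (X κ ω : ℝ) ^ (3 / 2 : ℝ)},
          h (fun i : I => x⁻¹ • pairProcess P A B X i ω) ∂P) / scaleFn P X x| ≤ ε' := by
    intro ε' hε'
    -- When X_κ^{3/2} ≤ δx, there are two cases. If the pair at κ still exceeds εx, the probability
    -- is at most η' times the scale and |h| ≤ C. Otherwise |h| ≤ Lε, and h ≠ 0 only on an event of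
    -- probability at most D times the scale. The constants give each case half of ε'.
    set ε := ε' / (2 * (L * D + 1)) with hε
    have hε0 : 0 < ε := by positivity
    set η' := ε' / (2 * (C + 1)) with hη'
    have hη'0 : 0 < η' := by positivity
    obtain ⟨δ₀, hδ₀, hsmall⟩ := hX.small_generation hA hμ hα hB κ hε0 hη'0
    filter_upwards [Ioo_mem_nhdsGT hδ₀] with δ hδ
    filter_upwards [hsmall δ hδ.1 hδ.2, hD, eventually_gt_atTop 0] with x h1 h2 hx
    have hVm := hX.measurable_scaled I x
    have hgm : Measurable fun ω => h (fun i : I => x⁻¹ • pairProcess P A B X i ω) :=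
      hc.measurable.comp hVm
    have hgi : Integrable (fun ω => h (fun i : I => x⁻¹ • pairProcess P A B X i ω)) P :=
      Integrable.of_bound hgm.aestronglyMeasurable C (Eventually.of_forall fun ω => hC _)
    have hsm := measurableSet_lt_size hX κ (δ * x)
    have hsplit := integral_add_compl hsm hgi
    rw [← hsplit, add_div, add_sub_cancel_left, abs_div, abs_of_pos (hpos x),
      div_le_iff₀ (hpos x)]
    set s1 := {ω | ε * x < ‖ pairProcess P A B X κ ω‖ ∧ (X κ ω : ℝ) ^ (3 / 2 : ℝ) ≤ δ * x} with hs1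
    set s2 := {ω | η < ‖fun i : I => x⁻¹ • pairProcess P A B X i ω‖} with hs2
    have hle : MeasurableSet {ω | (X κ ω : ℝ) ^ (3 / 2 : ℝ) ≤ δ * x} := by
      convert hsm.compl using 1
      ext ω
      exact (not_lt (a := δ * x) (b := (X κ ω : ℝ) ^ (3 / 2 : ℝ))).symm
    have hs1m : MeasurableSet s1 :=
      (measurableSet_lt measurable_const (hX.measurable_pairProcess κ).norm).inter
        hle
    have hs2m : MeasurableSet s2 := measurableSet_lt measurable_const hVm.norm
    have hbi : Integrable (fun ω => s1.indicator (fun _ => C) ω + s2.indicator (fun _ => L * ε) ω)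
        P := ((integrable_const C).indicator hs1m).add ((integrable_const (L * ε)).indicator hs2m)
    calc |∫ ω in {ω | δ * x < (X κ ω : ℝ) ^ (3 / 2 : ℝ)}ᶜ,
          h (fun i : I => x⁻¹ • pairProcess P A B X i ω) ∂P|
        ≤ ∫ ω in {ω | δ * x < (X κ ω : ℝ) ^ (3 / 2 : ℝ)}ᶜ,
          (s1.indicator (fun _ => C) ω + s2.indicator (fun _ => L * ε) ω) ∂P := by
          rw [← Real.norm_eq_abs]
          refine norm_integral_le_of_norm_le hbi.integrableOn ?_
          filter_upwards [ae_restrict_mem hsm.compl] with ω hω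
          have hω : (X κ ω : ℝ) ^ (3 / 2 : ℝ) ≤ δ * x := not_lt.1 hω
          have hi1 : 0 ≤ s1.indicator (fun _ => C) ω := Set.indicator_nonneg (fun _ _ => hC0) _
          have hi2 : 0 ≤ s2.indicator (fun _ => L * ε) ω :=
            Set.indicator_nonneg (fun _ _ => by positivity) _
          rw [Real.norm_eq_abs]
          by_cases hb : ω ∈ s2
          · by_cases ha : ω ∈ s1
            · rw [Set.indicator_of_mem ha]
              linarith [hC fun i : I => x⁻¹ • pairProcess P A B X i ω]
            · rw [Set.indicator_of_mem hb]
              have h3 : ‖ pairProcess P A B X κ ω‖ ≤ ε * x := by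
                by_contra hcon
                exact ha ⟨not_le.1 hcon, hω⟩
              have h4 : ‖x⁻¹ • pairProcess P A B X κ ω‖ ≤ ε := by
                rw [norm_smul, norm_inv, Real.norm_of_nonneg hx.le, inv_mul_le_iff₀ hx, mul_comm]
                exact h3
              have h5 := hL fun i : I => x⁻¹ • pairProcess P A B X i ω
              have h6 := mul_le_mul_of_nonneg_left h4 hL0
              linarith
          · rw [h0 _ (not_lt.1 hb), abs_zero]
            exact add_nonneg hi1 hi2
      _ ≤ ∫ ω, (s1.indicator (fun _ => C) ω + s2.indicator (fun _ => L * ε) ω) ∂P := by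
          refine setIntegral_le_integral hbi (Eventually.of_forall fun ω => ?_)
          exact add_nonneg (Set.indicator_nonneg (fun _ _ => hC0) _)
            (Set.indicator_nonneg (fun _ _ => by positivity) _)
      _ = P.real s1 * C + P.real s2 * (L * ε) := by
          rw [integral_add ((integrable_const C).indicator hs1m)
            ((integrable_const (L * ε)).indicator hs2m), integral_indicator_const _ hs1m,
            integral_indicator_const _ hs2m, smul_eq_mul, smul_eq_mul]
      _ ≤ η' * scaleFn P X x * C + D * scaleFn P X x * (L * ε) := by
          gcongr
          exact h1
      _ ≤ ε' * scaleFn P X x := by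
          have h3 : η' * C ≤ ε' / 2 := by
            rw [hη', div_mul_eq_mul_div, div_le_div_iff₀ (by positivity) two_pos]
            nlinarith
          have h4 : D * (L * ε) ≤ ε' / 2 := by
            rw [hε, ← mul_assoc, mul_div_assoc', div_le_div_iff₀ (by positivity) two_pos]
            nlinarith [mul_nonneg hL0 hD0]
          have h5 := mul_le_mul_of_nonneg_right (add_le_add h3 h4) (hpos x).le
          linarith
  -- The limits δ → 0 and x → ∞ are interchanged: δ is fixed so that both the truncated limit and,
  -- for all large x, the remainder are within ε/4.
  rw [Metric.tendsto_nhds]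
  intro ε hε
  have hJ' := hJ.eventually (Metric.ball_mem_nhds _ (show 0 < ε / 4 by positivity))
  obtain ⟨δ, hδ1, hδ2, hδ3⟩ := (hJ'.and ((hrem (ε / 4) (by positivity)).and
    self_mem_nhdsWithin)).exists
  have hl := (hlarge δ hδ3).eventually (Metric.ball_mem_nhds _ (show 0 < ε / 4 by positivity))
  filter_upwards [hl, hδ2] with x hx1 hx2
  have hδ1 : dist _ _ < ε / 4 := hδ1
  have hx1 : dist _ _ < ε / 4 := hx1
  rw [← Real.dist_eq] at hx2
  have h1 := dist_triangle4 ((∫ ω, h (fun i : I => x⁻¹ • pairProcess P A B X i ω) ∂P) / scaleFn P X x)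
    ((∫ ω in {ω | δ * x < (X κ ω : ℝ) ^ (3 / 2 : ℝ)},
          h (fun i : I => x⁻¹ • pairProcess P A B X i ω) ∂P) / scaleFn P X x)
    (∫ p in {p | δ < p.1}, h (fun i => W i p) ∂((powerMeasure β).prod (gaussSeq v)))
    (∫ p, h (fun i => W i p) ∂((powerMeasure β).prod (gaussSeq v)))
  exact lt_of_le_of_lt h1 (by linarith)

end Stationary

/-! ### The limit theorem for Lipschitz functionals -/

theorem lintegral_powerMeasure_comp_mul {β c : ℝ} (hβ : 0 < β) (hc : 0 < c) {E : Type*}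
    [MeasurableSpace E] (γ : Measure E) [SFinite γ] {F : ℝ × E → ℝ} (hF : Measurable F) :
    ∫ p : ℝ × E, F (c * p.1, p.2) ∂((powerMeasure β).prod γ) =
      c ^ β * ∫ p, F p ∂((powerMeasure β).prod γ) := by
  have hm : Measurable (Prod.map (c * ·) id : ℝ × E → ℝ × E) :=
    (measurable_const_mul c).prodMap measurable_id
  have h1 : ((powerMeasure β).prod γ).map (Prod.map (c * ·) id) =
      ENNReal.ofReal (c ^ β) • (powerMeasure β).prod γ := by
    rw [← Measure.map_prod_map _ _ (measurable_const_mul c) measurable_id, Measure.map_id,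
      map_mul_powerMeasure hβ hc, Measure.prod_smul_left]
  have h2 := integral_map hm.aemeasurable (hF.aestronglyMeasurable (μ :=
    ((powerMeasure β).prod γ).map (Prod.map (c * ·) id)))
  rw [h1, integral_smul_measure, ENNReal.toReal_ofReal (by positivity), smul_eq_mul] at h2
  exact h2.symm

/-- The thresholds `genMass` increase with time, so a cluster present at time κ is present at all
later times and the process coincides with the full spine there. -/
theorem truncBelow_limitProcess {m α : ℝ} (hm : 0 < m) (hm1 : m ≤ 1) (hα : 0 ≤ α) {I : Finset ℤ}
    {κ : ℤ} {p : LimitSpace} (hp : p.1 ≤ genMass m α κ) :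
    truncBelow κ (fun i : I => limitProcess m α i p) =
      truncBelow κ fun i : I => spine m p.2.1 p.2.2 i := by
  funext i
  simp only [truncBelow]
  split_ifs with hi
  · exact limitProcess_of_le (hp.trans (genMass_mono hm hm1 hα hi))
  · rfl

theorem truncBelow_limitProcess_succ {m α : ℝ} {I : Finset ℤ}
    {κ : ℤ} {p : LimitSpace} (hp : ¬ p.1 ≤ genMass m α κ) :
    truncBelow κ (fun i : I => limitProcess m α i p) =
      truncBelow (κ + 1) fun i : I => limitProcess m α i p :=
  truncBelow_succ_eq fun i hi =>
    limitProcess_of_not_le (by rw [hi]; exact hp)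

theorem measurable_limitProcess_pi (m α : ℝ) (I : Finset ℤ) :
    Measurable fun (p : LimitSpace) (i : I) => limitProcess m α i p :=
  measurable_pi_lambda _ fun i => measurable_limitProcess m α i

theorem limitMeasure_lt_pi_norm_ne_top {m α v y : ℝ} (hm : 0 < m) (hα : 0 < α) (hα2 : α ≤ 3)
    (hy : 0 < y) (I : Finset ℤ) :
    limitMeasure (2 * α / 3) v {p | y < ‖fun i : I => limitProcess m α i p‖} ≠ ∞ := by
  refine ne_top_of_le_ne_top ?_ ((measure_mono (norm_pi_gt_subset_iUnion hy.le
    fun (i : I) p => limitProcess m α i p)).trans (measure_iUnion_fintype_le _ _))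
  refine (ENNReal.sum_lt_top.2 fun i _ => ?_).ne
  rw [limitMeasure_lt_norm hm hα hy]
  exact ENNReal.mul_lt_top ENNReal.ofReal_lt_top (gaussMoment_ne_top v (by linarith)).lt_top

theorem integrable_comp_limitProcess {m α v η C : ℝ} (hm : 0 < m) (hα : 0 < α) (hα2 : α ≤ 3)
    (hη : 0 < η) {I : Finset ℤ} {h : (I → ℝ × ℝ) → ℝ} (hc : Continuous h) (hC : ∀ w, |h w| ≤ C)
    (h0 : ∀ w, ‖w‖ ≤ η → h w = 0) :
    Integrable (fun p : LimitSpace => h fun i => limitProcess m α i p)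
      (limitMeasure (2 * α / 3) v) :=
  integrable_of_bounded_of_eq_zero
    (hc.measurable.comp (measurable_limitProcess_pi m α I)).aestronglyMeasurable
    (measurableSet_lt measurable_const (measurable_limitProcess_pi m α I).norm)
    (limitMeasure_lt_pi_norm_ne_top hm hα hα2 hη I) (fun _ => hC _) fun _ hp => h0 _ (not_lt.1 hp)

section Stationary

variable {Ω : Type*} [MeasurableSpace Ω] {P : Measure Ω} [IsProbabilityMeasure P]
    {A : ℤ → ℕ → Ω → ℕ} {B : ℤ → Ω → ℕ} {X : ℤ → Ω → ℕ}

/-- One step of the decomposition according to the first large generation. -/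
theorem IsStationaryGWI.tendsto_functional_step (hX : IsStationaryGWI P A B X) {α : ℝ}
    (hA : MemLp (fun ω => (A 0 0 ω : ℝ)) 2 P) (hμ : offspringMean P A ∈ Set.Ioo (0 : ℝ) 1)
    (hα : α ∈ Set.Ioo (1 : ℝ) 2) (hB : RegVar (tailFn P (B 0)) α) {I : Finset ℤ} (κ : ℤ)
    {f : (I → ℝ × ℝ) → ℝ} {L : NNReal} (hL : LipschitzWith L f) {C η : ℝ} (hη : 0 < η)
    (hC : ∀ w, |f w| ≤ C) (h0 : ∀ w, ‖w‖ ≤ η → f w = 0) :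
    Tendsto (fun x : ℝ => (∫ ω, (f (truncBelow κ fun i : I => x⁻¹ • pairProcess P A B X i ω) -
        f (truncBelow (κ + 1) fun i : I => x⁻¹ • pairProcess P A B X i ω)) ∂P) / scaleFn P X x)
      atTop (𝓝 (∫ p, (f (truncBelow κ fun i : I => limitProcess (offspringMean P A) α i p) -
        f (truncBelow (κ + 1) fun i : I => limitProcess (offspringMean P A) α i p))
          ∂(limitMeasure (2 * α / 3) (offspringVar P A)))) := by
  set m := offspringMean P A with hm
  set v := offspringVar P A with hv
  have hm0 : 0 < m := hμ.1
  have hα0 : 0 < α := by linarith [hα.1]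
  set β := 2 * α / 3 with hβ
  have hβ0 : 0 < β := by positivity
  by_cases hκ : κ ∈ I
  swap
  · have h1 : ∀ w : I → ℝ × ℝ, truncBelow κ w = truncBelow (κ + 1) w := fun w =>
      truncBelow_succ_eq fun i hi => absurd (hi ▸ i.2) hκ
    simp [h1]
  -- The increment ignores the times before κ and vanishes when coordinate κ does, which is the form
  -- required by `tendsto_first_generation`.
  let h : (I → ℝ × ℝ) → ℝ := fun w => f (truncBelow κ w) - f (truncBelow (κ + 1) w)
  have hc : Continuous h := (hL.continuous.comp (continuous_truncBelow κ)).sub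
    (hL.continuous.comp (continuous_truncBelow (κ + 1)))
  have h1 := hX.tendsto_first_generation hA hμ hα hB ⟨κ, hκ⟩ (h := h) hc (C := 2 * C) (L := L) hη
    L.2 (fun w => ?_) (fun w hw => ?_) (fun w => ?_) fun w => ?_
  · convert h1 using 2
    have hS : Measurable fun (p : ℝ × (ℤ → ℝ)) (i : I) => spine m p.1 p.2 i :=
      measurable_pi_lambda _ fun i => measurable_spine m i
    -- On the limit space the increment depends on u only through the presence of the cluster at
    -- time κ, so u integrates out to the factor `genMass m α κ`.
    have h2 : ∀ p : LimitSpace, h (fun i => limitProcess m α i p) =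
        (Set.Iic (genMass m α κ)).indicator 1 p.1 * h (fun i => spine m p.2.1 p.2.2 i) := by
      intro p
      by_cases hp : p.1 ≤ genMass m α κ
      · rw [Set.indicator_of_mem (by exact hp), Pi.one_apply, one_mul]
        simp only [h]
        rw [← truncBelow_truncBelow (Int.le_add_one le_rfl : κ ≤ κ + 1),
          truncBelow_limitProcess hm0 hμ.2.le hα0.le hp,
          truncBelow_truncBelow (Int.le_add_one le_rfl : κ ≤ κ + 1)]
      · rw [Set.indicator_of_notMem (by exact hp), zero_mul]
        simp only [h]
        rw [truncBelow_limitProcess_succ hp, sub_self]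
    have h3 : ∫ p : LimitSpace, h (fun i => limitProcess m α i p) ∂limitMeasure β v =
        genMass m α κ * ∫ p : ℝ × (ℤ → ℝ), h (fun i => spine m p.1 p.2 i)
          ∂((powerMeasure β).prod (gaussSeq v)) := by
      simp only [h2]
      rw [limitMeasure]
      have h4 := integral_prod_mul (μ := volume.restrict (Set.Ioi (0 : ℝ)))
        (ν := (powerMeasure β).prod (gaussSeq v)) ((Set.Iic (genMass m α κ)).indicator (1 : ℝ → ℝ))
        fun q => h fun i => spine m q.1 q.2 i
      rw [h4, integral_indicator_one measurableSet_Iic, Measure.real, volume_restrict_Iic, ENNReal.toReal_ofReal (genMass_pos hm0 α κ).le]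
    change ∫ p : LimitSpace, h (fun i => limitProcess m α i p) ∂limitMeasure β v = _
    rw [h3]
    have hF : Measurable fun p : ℝ × (ℤ → ℝ) => h fun i =>
        (p.1 * genScale m (i - κ)) • ((1, p.2 i) : ℝ × ℝ) := by
      refine hc.measurable.comp (measurable_pi_lambda _ fun i => ?_)
      fun_prop
    -- Multiplying r by the scale of generation κ shifts the time origin from κ to 0. It costs the
    -- scale to the power β, which cancels `genMass m α κ`.
    have h4 := lintegral_powerMeasure_comp_mul hβ0 (genScale_pos hm0 κ) (gaussSeq v) hF
    have h5 : ∀ p : ℝ × (ℤ → ℝ), (h fun i =>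
        (genScale m κ * p.1 * genScale m (i - κ)) • ((1, p.2 i) : ℝ × ℝ)) =
        h (fun i => spine m p.1 p.2 i) := by
      intro p
      congr 1
      funext i
      rw [spine, mul_comm (genScale m κ), mul_assoc, ← genScale_add hm0, add_sub_cancel]
    simp only [h5] at h4
    rw [h4, ← mul_assoc, genMass_mul_genScale hm0, one_mul]
  · exact (abs_sub _ _).trans (by linarith [hC (truncBelow κ w), hC (truncBelow (κ + 1) w)])
  · simp only [h]
    rw [h0 _ ((norm_truncBelow_le _ _).trans hw), h0 _ ((norm_truncBelow_le _ _).trans hw), sub_zero]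
  · have h2 := hL.dist_le_mul (truncBelow κ w) (truncBelow (κ + 1) w)
    rw [Real.dist_eq, dist_eq_norm] at h2
    exact h2.trans (mul_le_mul_of_nonneg_left (norm_truncBelow_sub_le ⟨κ, hκ⟩ w) L.2)
  · simp only [h]
    rw [truncBelow_truncBelow le_rfl, truncBelow_truncBelow (Int.le_add_one le_rfl : κ ≤ κ + 1)]

/-- Vague convergence of the finite-dimensional distributions. -/
theorem IsStationaryGWI.tendsto_functional (hX : IsStationaryGWI P A B X) {α : ℝ}
    (hA : MemLp (fun ω => (A 0 0 ω : ℝ)) 2 P) (hμ : offspringMean P A ∈ Set.Ioo (0 : ℝ) 1)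
    (hα : α ∈ Set.Ioo (1 : ℝ) 2) (hB : RegVar (tailFn P (B 0)) α) {I : Finset ℤ}
    {f : (I → ℝ × ℝ) → ℝ} {L : NNReal} (hL : LipschitzWith L f) {C η : ℝ} (hη : 0 < η)
    (hC : ∀ w, |f w| ≤ C) (h0 : ∀ w, ‖w‖ ≤ η → f w = 0) :
    Tendsto (fun x : ℝ => (∫ ω, f (fun i : I => x⁻¹ • pairProcess P A B X i ω) ∂P) / scaleFn P X x)
      atTop (𝓝 (∫ p, f (fun i : I => limitProcess (offspringMean P A) α i p)
          ∂(limitMeasure (2 * α / 3) (offspringVar P A)))) := by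
  obtain ⟨a, ha⟩ : ∃ a : ℤ, ∀ i : I, a ≤ i := by
    obtain ⟨a, ha⟩ := I.bddBelow
    exact ⟨a, fun i => ha i.2⟩
  obtain ⟨n, hn⟩ : ∃ n : ℕ, ∀ i : I, (i : ℤ) < a + n := by
    obtain ⟨b, hb⟩ := I.bddAbove
    exact ⟨(b - a).toNat + 1, fun i => by have : (i : ℤ) ≤ b := hb i.2; omega⟩
  -- Telescoping from a, at or before all times of I, to a + n, after all of them. The last term is
  -- f 0 = 0.
  have hsum : ∀ w : I → ℝ × ℝ, f w = ∑ j ∈ Finset.range n,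
      (f (truncBelow (a + j) w) - f (truncBelow (a + j + 1) w)) := by
    intro w
    have h1 := Finset.sum_range_sub' (fun j : ℕ => f (truncBelow (a + j) w)) n
    simp only [Nat.cast_add, Nat.cast_one, ← add_assoc] at h1
    rw [h1, truncBelow_of_lt hn, Nat.cast_zero, add_zero, truncBelow_of_le ha,
      h0 0 (by rw [norm_zero]; exact hη.le), sub_zero]
  have hstep := tendsto_finsetSum (Finset.range n) fun j _ =>
    hX.tendsto_functional_step hA hμ hα hB (a + j) hL hη hC h0
  have hc : ∀ κ : ℤ, Continuous fun w : I → ℝ × ℝ => f (truncBelow κ w) := fun κ =>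
    hL.continuous.comp (continuous_truncBelow κ)
  have hα0 : 0 < α := by linarith [hα.1]
  have hi : ∀ κ : ℤ, Integrable (fun p => f (truncBelow κ fun i : I =>
      limitProcess (offspringMean P A) α i p)) (limitMeasure (2 * α / 3) (offspringVar P A)) :=
    fun κ => integrable_comp_limitProcess hμ.1 hα0 (by linarith [hα.2]) hη (hc κ)
      (fun w => hC _) fun w hw => h0 _ ((norm_truncBelow_le _ _).trans hw)
  have hi' : ∀ (x : ℝ) (κ : ℤ), Integrable (fun ω => f (truncBelow κ fun i : I =>
      x⁻¹ • pairProcess P A B X i ω)) P := fun x κ =>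
    Integrable.of_bound ((hc κ).measurable.comp (hX.measurable_scaled I x)).aestronglyMeasurable C
      (Eventually.of_forall fun ω => hC _)
  have h1 := integral_finsetSum (Finset.range n) fun (j : ℕ) _ =>
    (hi (a + j)).sub (hi (a + j + 1))
  have h2 : ∀ x, _ := fun x => integral_finsetSum (Finset.range n) fun (j : ℕ) _ =>
    (hi' x (a + j)).sub (hi' x (a + j + 1))
  simp only [Pi.sub_apply, ← hsum] at h1 h2
  rw [h1]
  refine hstep.congr fun x => ?_
  rw [h2, Finset.sum_div]

end Stationary

/-! ### Conditional laws given a large value of a homogeneous functional -/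

/-- The piecewise linear function that rises from `0` to `1` on `[0, 1]`. -/
noncomputable def ramp (t : ℝ) : ℝ := max 0 (min 1 t)

theorem ramp_nonneg (t : ℝ) : 0 ≤ ramp t := le_max_left _ _

theorem ramp_le_one (t : ℝ) : ramp t ≤ 1 := max_le zero_le_one (min_le_left _ _)

theorem ramp_of_nonpos {t : ℝ} (h : t ≤ 0) : ramp t = 0 :=
  max_eq_left ((min_le_right _ _).trans h)

theorem ramp_of_one_le {t : ℝ} (h : 1 ≤ t) : ramp t = 1 := by
  rw [ramp, min_eq_left h, max_eq_right zero_le_one]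

theorem lipschitzWith_ramp : LipschitzWith 1 ramp := (LipschitzWith.id.const_min 1).const_max 0

/-- The indicator of t > 1 lies between two ramps of slope a: the lower one starts rising at 1, the
upper one has finished rising there. -/
theorem abs_indicator_sub_ramp_le {a : ℝ} (ha : 0 ≤ a) (t : ℝ) :
    |(Set.Ioi 1).indicator 1 t - ramp (a * (t - 1))| ≤
      ramp (a * (t - 1) + 1) - ramp (a * (t - 1)) := by
  by_cases ht : 1 < t
  · have h1 : 0 ≤ a * (t - 1) := mul_nonneg ha (by linarith)
    rw [Set.indicator_of_mem (show t ∈ Set.Ioi 1 from ht), Pi.one_apply,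
      ramp_of_one_le (t := a * (t - 1) + 1) (by linarith),
      abs_of_nonneg (sub_nonneg.2 (ramp_le_one _))]
  · have h1 : a * (t - 1) ≤ 0 := mul_nonpos_of_nonneg_of_nonpos ha (by linarith)
    rw [Set.indicator_of_notMem (show t ∉ Set.Ioi 1 from ht), ramp_of_nonpos h1, sub_zero, abs_zero,
      sub_zero]
    exact ramp_nonneg _

theorem exists_lipschitzWith_mul {E : Type*} [PseudoMetricSpace E] {f g : E → ℝ} {K L : NNReal}
    (hf : LipschitzWith K f) (hg : LipschitzWith L g) {C D : ℝ} (hC : ∀ w, |f w| ≤ C)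
    (hD : ∀ w, |g w| ≤ D) : ∃ M, LipschitzWith M fun w => f w * g w := by
  refine ⟨(|C| * L + |D| * K).toNNReal, LipschitzWith.of_dist_le_mul fun w w' => ?_⟩
  rw [Real.coe_toNNReal _ (by positivity), Real.dist_eq]
  have h1 := hf.dist_le_mul w w'
  have h2 := hg.dist_le_mul w w'
  rw [Real.dist_eq] at h1 h2
  calc |f w * g w - f w' * g w'| = |f w * (g w - g w') + g w' * (f w - f w')| := by
        congr 1
        ring
    _ ≤ |f w| * |g w - g w'| + |g w'| * |f w - f w'| := by
        rw [← abs_mul, ← abs_mul]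
        exact abs_add_le _ _
    _ ≤ |C| * (L * dist w w') + |D| * (K * dist w w') := by
        exact add_le_add
          (mul_le_mul ((hC w).trans (le_abs_self C)) h2 (abs_nonneg _) (abs_nonneg _))
          (mul_le_mul ((hD w').trans (le_abs_self D)) h1 (abs_nonneg _) (abs_nonneg _))
    _ = _ := by ring

theorem exists_lipschitzWith_ramp {E : Type*} [PseudoMetricSpace E] {φ : E → ℝ}
    (hφ : LipschitzWith 1 φ) (a b : ℝ) :
    ∃ M, LipschitzWith M fun w => ramp (a * (φ w - 1) + b) := by
  refine ⟨(|a|).toNNReal, LipschitzWith.of_dist_le_mul fun w w' => ?_⟩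
  rw [Real.coe_toNNReal _ (abs_nonneg _)]
  have h1 := hφ.dist_le_mul w w'
  have h2 := lipschitzWith_ramp.dist_le_mul (a * (φ w - 1) + b) (a * (φ w' - 1) + b)
  rw [NNReal.coe_one, one_mul] at h1 h2
  refine h2.trans ?_
  rw [Real.dist_eq] at h1 ⊢
  rw [show a * (φ w - 1) + b - (a * (φ w' - 1) + b) = a * (φ w - φ w') by ring, abs_mul]
  gcongr

/-- A Lipschitz and positively homogeneous functional that is dominated by the norm. -/
structure IsGauge {E : Type*} [NormedAddCommGroup E] [NormedSpace ℝ E] (φ : E → ℝ) : Prop where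
  lipschitz : LipschitzWith 1 φ
  le_norm : ∀ w, φ w ≤ ‖w‖
  smul : ∀ (c : ℝ) (w : E), 0 < c → φ (c • w) = c * φ w

theorem isGauge_norm {E : Type*} [NormedAddCommGroup E] [NormedSpace ℝ E] :
    IsGauge fun w : E => ‖w‖ where
  lipschitz := lipschitzWith_one_norm
  le_norm _ := le_rfl
  smul c w hc := by rw [norm_smul, Real.norm_of_nonneg hc.le]

/-- Conditioning on the value at a single time is a gauge as well; it yields the tail process, while
the full norm yields joint regular variation. -/
theorem isGauge_norm_eval {ι : Type*} [Fintype ι] (i : ι) :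
    IsGauge fun w : ι → ℝ × ℝ => ‖w i‖ where
  lipschitz := by
    have := lipschitzWith_one_norm.comp (LipschitzWith.eval (α := fun _ : ι => ℝ × ℝ) i)
    rwa [one_mul] at this
  le_norm w := norm_le_pi_norm w i
  smul c w hc := by rw [Pi.smul_apply, norm_smul, Real.norm_of_nonneg hc.le]

section Gauge

variable {T E : Type*} [MeasurableSpace T] [NormedAddCommGroup E] [NormedSpace ℝ E]
  [MeasurableSpace E] [BorelSpace E] {μ : Measure T} {W : T → E} {φ : E → ℝ}

theorem integrable_of_eq_zero_of_norm_le (hW : Measurable W)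
    (hfin : μ {p | 1 / 2 < ‖W p‖} ≠ ∞) {f : E → ℝ} (hf : Measurable f) {C : ℝ}
    (hC : ∀ w, |f w| ≤ C) (h0 : ∀ w, ‖w‖ ≤ 1 / 2 → f w = 0) : Integrable (fun p => f (W p)) μ :=
  integrable_of_bounded_of_eq_zero (hf.comp hW).aestronglyMeasurable
    (measurableSet_lt measurable_const hW.norm) hfin (fun _ => hC _) fun _ hp => h0 _ (not_lt.1 hp)

/-- The upper ramp starts at 1 - 1/a, which is at least 1/2 when a ≥ 2. Both ramps then vanish on
the ball of radius 1/2, as the vague limit theorem demands. -/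
theorem IsGauge.ramp_eq_zero (hφ : IsGauge φ) {a : ℝ} (ha : 2 ≤ a) {w : E} (hw : ‖w‖ ≤ 1 / 2) :
    ramp (a * (φ w - 1) + 1) = 0 ∧ ramp (a * (φ w - 1)) = 0 := by
  have h1 := (hφ.le_norm w).trans hw
  have h2 : a * (φ w - 1) + 1 ≤ 0 := by nlinarith
  exact ⟨ramp_of_nonpos h2, ramp_of_nonpos (by linarith)⟩

/-- Stated for a general measure because it serves twice: for the law of the rescaled process and
for the infinite limit measure. -/
theorem abs_setIntegral_sub_le (hW : Measurable W) (hfin : μ {p | 1 / 2 < ‖W p‖} ≠ ∞)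
    (hφ : IsGauge φ) {f : E → ℝ} (hf : Measurable f) {C : ℝ} (hC : ∀ w, |f w| ≤ C) {a : ℝ}
    (ha : 2 ≤ a) :
    |∫ p in {p | 1 < φ (W p)}, f (W p) ∂μ - ∫ p, f (W p) * ramp (a * (φ (W p) - 1)) ∂μ| ≤
      C * ∫ p, (ramp (a * (φ (W p) - 1) + 1) - ramp (a * (φ (W p) - 1))) ∂μ := by
  have hC0 : 0 ≤ C := (abs_nonneg _).trans (hC 0)
  have hφm : Measurable φ := hφ.lipschitz.continuous.measurable
  have hr : Measurable ramp := lipschitzWith_ramp.continuous.measurable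
  have hrm : Measurable fun w => ramp (a * (φ w - 1)) :=
    hr.comp ((hφm.sub_const _).const_mul _)
  have hrm' : Measurable fun w => ramp (a * (φ w - 1) + 1) :=
    hr.comp (((hφm.sub_const _).const_mul _).add_const _)
  have him : Measurable fun w => (Set.Ioi (1 : ℝ)).indicator (1 : ℝ → ℝ) (φ w) :=
    (measurable_one.indicator measurableSet_Ioi).comp hφm
  have hi0 : ∀ t : ℝ, 0 ≤ (Set.Ioi (1 : ℝ)).indicator (1 : ℝ → ℝ) t ∧
      (Set.Ioi (1 : ℝ)).indicator (1 : ℝ → ℝ) t ≤ 1 := fun t =>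
    ⟨Set.indicator_nonneg (fun _ _ => zero_le_one) _, Set.indicator_le_self' (fun _ _ => zero_le_one) _⟩
  have h1 : Integrable (fun p => f (W p) * (Set.Ioi (1 : ℝ)).indicator (1 : ℝ → ℝ) (φ (W p))) μ := by
    refine integrable_of_eq_zero_of_norm_le hW hfin (hf.mul him) (C := C) (fun w => ?_) fun w hw => ?_
    · simp only [Pi.mul_apply]
      rw [abs_mul, abs_of_nonneg (hi0 _).1]
      exact (mul_le_of_le_one_right (abs_nonneg _) (hi0 _).2).trans (hC w)
    · simp only [Pi.mul_apply]
      rw [Set.indicator_of_notMem, mul_zero]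
      have := hφ.le_norm w
      exact (not_lt.2 (by linarith) : ¬ 1 < φ w)
  have h2 : Integrable (fun p => f (W p) * ramp (a * (φ (W p) - 1))) μ := by
    refine integrable_of_eq_zero_of_norm_le hW hfin (hf.mul hrm) (C := C) (fun w => ?_) fun w hw => ?_
    · simp only [Pi.mul_apply]
      rw [abs_mul, abs_of_nonneg (ramp_nonneg _)]
      exact (mul_le_of_le_one_right (abs_nonneg _) (ramp_le_one _)).trans (hC w)
    · simp only [Pi.mul_apply]
      rw [(hφ.ramp_eq_zero ha hw).2, mul_zero]
  have h3 : Integrable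
      (fun p => ramp (a * (φ (W p) - 1) + 1) - ramp (a * (φ (W p) - 1))) μ := by
    refine integrable_of_eq_zero_of_norm_le hW hfin (hrm'.sub hrm) (C := 1) (fun w => ?_)
      fun w hw => ?_
    · simp only [Pi.sub_apply]
      rw [abs_le]
      constructor <;> linarith [ramp_nonneg (a * (φ w - 1) + 1), ramp_nonneg (a * (φ w - 1)),
        ramp_le_one (a * (φ w - 1) + 1), ramp_le_one (a * (φ w - 1))]
    · simp only [Pi.sub_apply]
      rw [(hφ.ramp_eq_zero ha hw).1, (hφ.ramp_eq_zero ha hw).2, sub_zero]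
  have h4 : ∫ p in {p | 1 < φ (W p)}, f (W p) ∂μ =
      ∫ p, f (W p) * (Set.Ioi (1 : ℝ)).indicator (1 : ℝ → ℝ) (φ (W p)) ∂μ := by
    have hms : MeasurableSet {p | 1 < φ (W p)} := measurableSet_lt measurable_const (hφm.comp hW)
    rw [← integral_indicator hms]
    refine integral_congr_ae (Eventually.of_forall fun p => ?_)
    by_cases hp : 1 < φ (W p)
    · simp only
      rw [Set.indicator_of_mem (by exact hp), Set.indicator_of_mem (by exact hp), Pi.one_apply,
        mul_one]
    · simp only
      rw [Set.indicator_of_notMem (by exact hp), Set.indicator_of_notMem (by exact hp), mul_zero]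
  rw [h4, ← integral_sub h1 h2, ← integral_const_mul, ← Real.norm_eq_abs]
  refine norm_integral_le_of_norm_le (h3.const_mul C) (Eventually.of_forall fun p => ?_)
  rw [← mul_sub, norm_mul]
  exact mul_le_mul (hC _) (abs_indicator_sub_ramp_le (by linarith) _) (norm_nonneg _) hC0

theorem tendsto_integral_ramp_sub (hW : Measurable W) (hfin : μ {p | 1 / 2 < ‖W p‖} ≠ ∞)
    (hφ : IsGauge φ) (hnull : ∀ᵐ p ∂μ, φ (W p) ≠ 1) :
    Tendsto (fun n : ℕ => ∫ p, (ramp (((n : ℝ) + 2) * (φ (W p) - 1) + 1) -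
      ramp (((n : ℝ) + 2) * (φ (W p) - 1))) ∂μ) atTop (𝓝 0) := by
  have hφm : Measurable φ := hφ.lipschitz.continuous.measurable
  have hr : Measurable ramp := lipschitzWith_ramp.continuous.measurable
  have hsm : MeasurableSet {p | 1 / 2 < ‖W p‖} := measurableSet_lt measurable_const hW.norm
  rw [← integral_zero T ℝ (μ := μ)]
  refine tendsto_integral_of_dominated_convergence ({p | 1 / 2 < ‖W p‖}.indicator fun _ => 1)
    (fun n => ?_) ((integrableOn_const hfin).integrable_indicator hsm) (fun n => ?_) ?_
  · exact ((hr.comp ((((hφm.comp hW).sub_const _).const_mul _).add_const _)).sub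
      (hr.comp (((hφm.comp hW).sub_const _).const_mul _))).aestronglyMeasurable
  · refine Eventually.of_forall fun p => ?_
    have hn : (2 : ℝ) ≤ n + 2 := by linarith [Nat.cast_nonneg (α := ℝ) n]
    by_cases hp : 1 / 2 < ‖W p‖
    · rw [Set.indicator_of_mem (by exact hp), Real.norm_eq_abs, abs_le]
      constructor <;> linarith [ramp_nonneg (((n : ℝ) + 2) * (φ (W p) - 1) + 1),
        ramp_nonneg (((n : ℝ) + 2) * (φ (W p) - 1)),
        ramp_le_one (((n : ℝ) + 2) * (φ (W p) - 1) + 1), ramp_le_one (((n : ℝ) + 2) * (φ (W p) - 1))]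
    · rw [(hφ.ramp_eq_zero hn (not_lt.1 hp)).1, (hφ.ramp_eq_zero hn (not_lt.1 hp)).2, sub_zero,
        norm_zero, Set.indicator_of_notMem (by exact hp)]
  · filter_upwards [hnull] with p hp
    have hlin : Tendsto (fun n : ℕ => (n : ℝ) + 2) atTop atTop :=
      tendsto_natCast_atTop_atTop.atTop_add tendsto_const_nhds
    refine tendsto_const_nhds.congr' ?_
    rcases lt_or_gt_of_ne hp with h | h
    · have h1 : 0 < 1 - φ (W p) := by linarith
      filter_upwards [(hlin.atTop_mul_const h1).eventually_ge_atTop 1] with n hn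
      rw [ramp_of_nonpos (by linarith), ramp_of_nonpos (by linarith), sub_zero]
    · have h1 : 0 < φ (W p) - 1 := by linarith
      filter_upwards [(hlin.atTop_mul_const h1).eventually_ge_atTop 1] with n hn
      rw [ramp_of_one_le (by linarith), ramp_of_one_le (by linarith), sub_self]

end Gauge

theorem limitProcess_smul (m α : ℝ) (k : ℤ) (u r : ℝ) (z : ℤ → ℝ) :
    limitProcess m α k (u, r, z) = r • limitProcess m α k (u, 1, z) := by
  by_cases h : u ≤ genMass m α k
  · rw [limitProcess_of_le h, limitProcess_of_le h, spine, spine, smul_smul, one_mul]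
  · rw [limitProcess_of_not_le h, limitProcess_of_not_le h, smul_zero]

/-- For fixed u and z the gauge is linear in r > 0, so it equals 1 for at most one r, and the power
law has no atoms. -/
theorem ae_gauge_limitProcess_ne_one {m α v β : ℝ} (hβ : 0 < β) {I : Finset ℤ}
    {φ : (I → ℝ × ℝ) → ℝ} (hφ : IsGauge φ) :
    ∀ᵐ p ∂limitMeasure β v, φ (fun i : I => limitProcess m α i p) ≠ 1 := by
  have hms : MeasurableSet {p : LimitSpace | φ (fun i : I => limitProcess m α i p) = 1} :=
    measurableSet_eq_fun (hφ.lipschitz.continuous.measurable.comp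
      (measurable_limitProcess_pi m α I)) measurable_const
  have h0 : limitMeasure β v {p : LimitSpace | φ (fun i : I => limitProcess m α i p) = 1} = 0 := by
    rw [limitMeasure, Measure.measure_prod_null hms]
    refine Eventually.of_forall fun u => ?_
    change ((powerMeasure β).prod (gaussSeq v)) _ = 0
    rw [Measure.prod_apply_symm (measurable_prodMk_left hms)]
    refine (lintegral_congr fun z => ?_).trans lintegral_zero
    refine measure_mono_null (t := {(φ fun i : I => limitProcess m α i (u, 1, z))⁻¹} ∪
      {r | ¬ 0 < r}) ?_ (measure_union_null (powerMeasure_singleton hβ _)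
        (ae_iff.1 (ae_pos_powerMeasure β)))
    intro r (hr : φ (fun i : I => limitProcess m α i (u, r, z)) = 1)
    by_cases h : 0 < r
    · left
      have h1 : (fun i : I => limitProcess m α i (u, r, z)) =
          r • fun i : I => limitProcess m α i (u, 1, z) := by
        funext i
        exact limitProcess_smul m α i u r z
      rw [h1, hφ.smul _ _ h] at hr
      exact eq_inv_of_mul_eq_one_left hr
    · exact Or.inr h
  exact ae_iff.2 (by simpa only [ne_eq, not_not] using h0)

section Stationary

variable {Ω : Type*} [MeasurableSpace Ω] {P : Measure Ω} [IsProbabilityMeasure P]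
    {A : ℤ → ℕ → Ω → ℕ} {B : ℤ → Ω → ℕ} {X : ℤ → Ω → ℕ}

theorem IsGauge.setOf_lt_eq {I : Finset ℤ} {φ : (I → ℝ × ℝ) → ℝ} (hφ : IsGauge φ) {x : ℝ}
    (hx : 0 < x) (V : Ω → I → ℝ × ℝ) :
    {ω | x < φ (V ω)} = {ω | 1 < φ (fun i => x⁻¹ • V ω i)} := by
  ext ω
  have h1 : φ (fun i => x⁻¹ • V ω i) = x⁻¹ * φ (V ω) := hφ.smul x⁻¹ (V ω) (inv_pos.2 hx)
  change x < φ (V ω) ↔ 1 < φ fun i => x⁻¹ • V ω i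
  rw [h1, ← div_eq_inv_mul, lt_div_iff₀ hx, one_mul]

/-- The portmanteau step for an infinite limit measure. Replacing the sharp threshold by a ramp
costs at most the integral of the gap between two ramps; this gap integral also converges, and its
limit is small for steep ramps since {φ = 1} is null. -/
theorem IsStationaryGWI.tendsto_setIntegral_gauge (hX : IsStationaryGWI P A B X) {α : ℝ}
    (hA : MemLp (fun ω => (A 0 0 ω : ℝ)) 2 P) (hμ : offspringMean P A ∈ Set.Ioo (0 : ℝ) 1)
    (hα : α ∈ Set.Ioo (1 : ℝ) 2) (hB : RegVar (tailFn P (B 0)) α) {I : Finset ℤ}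
    {φ : (I → ℝ × ℝ) → ℝ} (hφ : IsGauge φ) {f : (I → ℝ × ℝ) → ℝ} {L : NNReal}
    (hL : LipschitzWith L f) {C : ℝ} (hC : ∀ w, |f w| ≤ C) :
    Tendsto (fun x : ℝ => (∫ ω in {ω | x < φ fun i : I => pairProcess P A B X i ω},
        f (fun i : I => x⁻¹ • pairProcess P A B X i ω) ∂P) / scaleFn P X x) atTop
      (𝓝 (∫ p in {p | 1 < φ fun i : I => limitProcess (offspringMean P A) α i p},
        f (fun i : I => limitProcess (offspringMean P A) α i p)
          ∂limitMeasure (2 * α / 3) (offspringVar P A))) := by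
  set m := offspringMean P A with hm
  set v := offspringVar P A with hv
  have hα0 : 0 < α := by linarith [hα.1]
  have hC0 : 0 ≤ C := (abs_nonneg _).trans (hC 0)
  have hpos := hX.scaleFn_pos hA hμ hα hB
  have hTm := measurable_limitProcess_pi m α I
  have hfin := limitMeasure_lt_pi_norm_ne_top (v := v) (m := m) hμ.1 hα0 (by linarith [hα.2])
    (show (0 : ℝ) < 1 / 2 by norm_num) I
  have hnull := ae_gauge_limitProcess_ne_one (m := m) (α := α) (v := v)
    (show 0 < 2 * α / 3 by positivity) hφ
  have hfm : Measurable f := hL.continuous.measurable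
  -- the smooth approximations converge
  have hG : ∀ a : ℝ, 2 ≤ a → Tendsto (fun x : ℝ => (∫ ω,
      f (fun i : I => x⁻¹ • pairProcess P A B X i ω) *
        ramp (a * (φ (fun i : I => x⁻¹ • pairProcess P A B X i ω) - 1)) ∂P) / scaleFn P X x) atTop
      (𝓝 (∫ p, f (fun i : I => limitProcess m α i p) *
        ramp (a * (φ (fun i : I => limitProcess m α i p) - 1)) ∂limitMeasure (2 * α / 3) v)) := by
    intro a ha
    obtain ⟨K, hK⟩ := exists_lipschitzWith_ramp hφ.lipschitz a 0
    simp only [add_zero] at hK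
    obtain ⟨M, hM⟩ := exists_lipschitzWith_mul hL hK hC (D := 1) fun w => by
      rw [abs_of_nonneg (ramp_nonneg _)]
      exact ramp_le_one _
    refine hX.tendsto_functional hA hμ hα hB hM (show (0 : ℝ) < 1 / 2 by norm_num) (C := C)
      (fun w => ?_) fun w hw => ?_
    · rw [abs_mul, abs_of_nonneg (ramp_nonneg _)]
      exact (mul_le_of_le_one_right (abs_nonneg _) (ramp_le_one _)).trans (hC w)
    · rw [(hφ.ramp_eq_zero ha hw).2, mul_zero]
  have hH : ∀ a : ℝ, 2 ≤ a → Tendsto (fun x : ℝ => (∫ ω,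
      (ramp (a * (φ (fun i : I => x⁻¹ • pairProcess P A B X i ω) - 1) + 1) -
        ramp (a * (φ (fun i : I => x⁻¹ • pairProcess P A B X i ω) - 1))) ∂P) / scaleFn P X x) atTop
      (𝓝 (∫ p, (ramp (a * (φ (fun i : I => limitProcess m α i p) - 1) + 1) -
        ramp (a * (φ (fun i : I => limitProcess m α i p) - 1))) ∂limitMeasure (2 * α / 3) v)) := by
    intro a ha
    obtain ⟨K, hK⟩ := exists_lipschitzWith_ramp hφ.lipschitz a 0
    obtain ⟨K', hK'⟩ := exists_lipschitzWith_ramp hφ.lipschitz a 1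
    simp only [add_zero] at hK
    refine hX.tendsto_functional hA hμ hα hB (hK'.sub hK) (show (0 : ℝ) < 1 / 2 by norm_num) (C := 1)
      (fun w => ?_) fun w hw => ?_
    · rw [abs_le]
      constructor <;> linarith [ramp_nonneg (a * (φ w - 1) + 1), ramp_nonneg (a * (φ w - 1)),
        ramp_le_one (a * (φ w - 1) + 1), ramp_le_one (a * (φ w - 1))]
    · rw [(hφ.ramp_eq_zero ha hw).1, (hφ.ramp_eq_zero ha hw).2, sub_zero]
  have hsmall := (tendsto_integral_ramp_sub hTm hfin hφ hnull).const_mul C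
  rw [mul_zero] at hsmall
  rw [Metric.tendsto_nhds]
  -- One steepness is fixed from the limit measure. The gap estimate then transfers to all large x
  -- because its own integrals converge.
  intro ε hε
  obtain ⟨n, hn⟩ := (hsmall.eventually (gt_mem_nhds (show 0 < ε / 4 by positivity))).exists
  set a : ℝ := (n : ℝ) + 2 with ha
  have ha2 : 2 ≤ a := by linarith [Nat.cast_nonneg (α := ℝ) n]
  have h1 := abs_setIntegral_sub_le hTm hfin hφ hfm hC ha2
  have h2 := (hG a ha2).eventually (Metric.ball_mem_nhds _ (show 0 < ε / 4 by positivity))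
  have h3 := ((hH a ha2).const_mul C).eventually (gt_mem_nhds hn)
  filter_upwards [h2, h3, eventually_gt_atTop 0] with x hx2 hx3 hx
  have hx2 : dist _ _ < ε / 4 := hx2
  rw [hφ.setOf_lt_eq hx fun ω (i : I) => pairProcess P A B X i ω]
  have h4 := abs_setIntegral_sub_le (hX.measurable_scaled I x) (measure_ne_top P _) hφ hfm hC ha2
  have h5 : |(∫ ω in {ω | 1 < φ fun i : I => x⁻¹ • pairProcess P A B X i ω},
      f (fun i : I => x⁻¹ • pairProcess P A B X i ω) ∂P) / scaleFn P X x - (∫ ω,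
      f (fun i : I => x⁻¹ • pairProcess P A B X i ω) *
        ramp (a * (φ (fun i : I => x⁻¹ • pairProcess P A B X i ω) - 1)) ∂P) / scaleFn P X x| <
        ε / 4 := by
    rw [← sub_div, abs_div, abs_of_pos (hpos x)]
    refine lt_of_le_of_lt (div_le_div_of_nonneg_right h4 (hpos x).le) ?_
    rwa [mul_div_assoc]
  rw [Real.dist_eq] at hx2 ⊢
  rw [abs_lt] at *
  rw [abs_le] at h1
  constructor <;> linarith [h5.1, h5.2, hx2.1, hx2.2, h1.1, h1.2]

end Stationary

/-! ### Weak convergence, stationarity and joint regular variation -/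

theorem TendstoWeakly.map {ι E F : Type*} [TopologicalSpace E] [MeasurableSpace E] [BorelSpace E]
    [TopologicalSpace F] [MeasurableSpace F] [BorelSpace F] {μ : ι → Measure E} {l : Filter ι}
    {ν : Measure E} (h : TendstoWeakly μ l ν) {g : E → F} (hg : Continuous g) :
    TendstoWeakly (fun i => (μ i).map g) l (ν.map g) := by
  intro f
  have hm : ∀ ρ : Measure F, AEStronglyMeasurable f ρ := fun ρ =>
    f.continuous.measurable.aestronglyMeasurable
  simp only [integral_map hg.measurable.aemeasurable (hm _)]
  exact h (f.compContinuous ⟨g, hg⟩)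

theorem integral_map_cond {T E : Type*} [MeasurableSpace T] [MeasurableSpace E] {μ : Measure T}
    {s : Set T} {W : T → E} (hW : Measurable W) {f : E → ℝ} (hf : Measurable f) :
    ∫ e, f e ∂((μ[|s]).map W) = (μ.real s)⁻¹ * ∫ p in s, f (W p) ∂μ := by
  rw [integral_map hW.aemeasurable hf.aestronglyMeasurable, ProbabilityTheory.cond,
    integral_smul_measure, smul_eq_mul, ENNReal.toReal_inv]
  rfl

section Stationary

variable {Ω : Type*} [MeasurableSpace Ω] {P : Measure Ω} [IsProbabilityMeasure P]
    {A : ℤ → ℕ → Ω → ℕ} {B : ℤ → Ω → ℕ} {X : ℤ → Ω → ℕ}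

theorem IsStationaryGWI.tendsto_measure_gauge (hX : IsStationaryGWI P A B X) {α : ℝ}
    (hA : MemLp (fun ω => (A 0 0 ω : ℝ)) 2 P) (hμ : offspringMean P A ∈ Set.Ioo (0 : ℝ) 1)
    (hα : α ∈ Set.Ioo (1 : ℝ) 2) (hB : RegVar (tailFn P (B 0)) α) {I : Finset ℤ}
    {φ : (I → ℝ × ℝ) → ℝ} (hφ : IsGauge φ) :
    Tendsto (fun x : ℝ => P.real {ω | x < φ fun i : I => pairProcess P A B X i ω} / scaleFn P X x)
      atTop (𝓝 ((limitMeasure (2 * α / 3) (offspringVar P A)).real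
        {p | 1 < φ fun i : I => limitProcess (offspringMean P A) α i p})) := by
  have h := hX.tendsto_setIntegral_gauge hA hμ hα hB hφ (f := fun _ => 1) (C := 1)
    (LipschitzWith.const 1) fun w => by simp
  simpa using h

theorem limitMeasure_gauge_ne_top {m α v : ℝ} (hm : 0 < m) (hα : 0 < α) (hα2 : α ≤ 3)
    {I : Finset ℤ} {φ : (I → ℝ × ℝ) → ℝ} (hφ : IsGauge φ) :
    limitMeasure (2 * α / 3) v {p | 1 < φ fun i : I => limitProcess m α i p} ≠ ∞ :=
  ne_top_of_le_ne_top (limitMeasure_lt_pi_norm_ne_top hm hα hα2 one_pos I)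
    (measure_mono fun _ hp => lt_of_lt_of_le hp (hφ.le_norm _))

/-- Given a large value of a gauge, the rescaled process converges in law. -/
theorem IsStationaryGWI.tendstoWeakly_gauge (hX : IsStationaryGWI P A B X) {α : ℝ}
    (hA : MemLp (fun ω => (A 0 0 ω : ℝ)) 2 P) (hμ : offspringMean P A ∈ Set.Ioo (0 : ℝ) 1)
    (hα : α ∈ Set.Ioo (1 : ℝ) 2) (hB : RegVar (tailFn P (B 0)) α) {I : Finset ℤ}
    {φ : (I → ℝ × ℝ) → ℝ} (hφ : IsGauge φ)
    (h0 : limitMeasure (2 * α / 3) (offspringVar P A)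
      {p | 1 < φ fun i : I => limitProcess (offspringMean P A) α i p} ≠ 0) :
    TendstoWeakly (fun x : ℝ => (P[|{ω | x < φ fun i : I => pairProcess P A B X i ω}]).map
        fun ω (i : I) => x⁻¹ • pairProcess P A B X i ω) atTop
      (((limitMeasure (2 * α / 3) (offspringVar P A))[|{p | 1 < φ fun i : I =>
        limitProcess (offspringMean P A) α i p}]).map
          fun p (i : I) => limitProcess (offspringMean P A) α i p) := by
  have htop := limitMeasure_gauge_ne_top (v := offspringVar P A) hμ.1
    (show 0 < α by linarith [hα.1]) (by linarith [hα.2]) hφ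
  have hTm := measurable_limitProcess_pi (offspringMean P A) α I
  have hpos := hX.scaleFn_pos hA hμ hα hB
  have hN := cond_isProbabilityMeasure_of_finite h0 htop
  have hratio := hX.tendsto_measure_gauge hA hμ hα hB hφ
  set S : ℝ → Set Ω := fun x => {ω | x < φ fun i : I => pairProcess P A B X i ω} with hS
  set N := limitMeasure (2 * α / 3) (offspringVar P A) with hNdef
  set D := {p : LimitSpace | 1 < φ fun i : I => limitProcess (offspringMean P A) α i p} with hD
  have hDpos : 0 < N.real D := ENNReal.toReal_pos h0 htop
  have hSpos : ∀ᶠ x in atTop, P (S x) ≠ 0 := by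
    filter_upwards [hratio.eventually (lt_mem_nhds hDpos)] with x hx h
    have h' : P.real {ω | x < φ fun i : I => pairProcess P A B X i ω} = 0 := by
      rw [Measure.real, show P {ω | x < φ fun i : I => pairProcess P A B X i ω} = 0 from h,
        ENNReal.toReal_zero]
    rw [h', zero_div] at hx
    exact lt_irrefl _ hx
  -- The conditional law is a probability measure only if the event has positive probability, which
  -- holds eventually. At other x an arbitrary Dirac mass is used.
  obtain ⟨μ, hμ'⟩ : ∃ μ : ℝ → ProbabilityMeasure (I → ℝ × ℝ), ∀ x, P (S x) ≠ 0 →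
      (μ x : Measure (I → ℝ × ℝ)) = (P[|S x]).map fun ω (i : I) =>
        x⁻¹ • pairProcess P A B X i ω := by
    have hex : ∀ x, ∃ ρ : ProbabilityMeasure (I → ℝ × ℝ), P (S x) ≠ 0 →
        (ρ : Measure (I → ℝ × ℝ)) = (P[|S x]).map fun ω (i : I) =>
          x⁻¹ • pairProcess P A B X i ω := by
      intro x
      by_cases h : P (S x) = 0
      · exact ⟨⟨Measure.dirac 0, inferInstance⟩, fun h' => absurd h h'⟩
      · have := cond_isProbabilityMeasure (μ := P) h
        exact ⟨⟨_, Measure.isProbabilityMeasure_map (hX.measurable_scaled I x).aemeasurable⟩,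
          fun _ => rfl⟩
    choose μ hμ' using hex
    exact ⟨μ, hμ'⟩
  obtain ⟨ν, hν⟩ : ∃ ν : ProbabilityMeasure (I → ℝ × ℝ), (ν : Measure (I → ℝ × ℝ)) =
      (N[|D]).map fun p (i : I) => limitProcess (offspringMean P A) α i p :=
    ⟨⟨_, Measure.isProbabilityMeasure_map hTm.aemeasurable⟩, rfl⟩
  have hlim : Tendsto μ atTop (𝓝 ν) := by
    rw [tendsto_iff_forall_lipschitz_integral_tendsto]
    rintro f ⟨C, hC⟩ ⟨L, hL⟩
    have hC' : ∀ w, |f w| ≤ |f 0| + C := by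
      intro w
      have h1 := hC w 0
      rw [Real.dist_eq] at h1
      linarith [abs_sub_abs_le_abs_sub (f w) (f 0)]
    have h1 := hX.tendsto_setIntegral_gauge hA hμ hα hB hφ hL hC'
    have h2 := (hratio.inv₀ hDpos.ne').mul h1
    rw [hν, integral_map_cond hTm hL.continuous.measurable]
    refine h2.congr' ?_
    filter_upwards [hSpos] with x hx
    rw [hμ' x hx, integral_map_cond (hX.measurable_scaled I x) hL.continuous.measurable]
    have := (hpos x).ne'
    have h3 : P.real (S x) ≠ 0 := (ENNReal.toReal_pos hx (measure_ne_top _ _)).ne'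
    simp only [hS] at h3 ⊢
    field_simp
  intro f
  have h1 := (ProbabilityMeasure.tendsto_iff_forall_integral_tendsto.1 hlim) f
  rw [hν] at h1
  refine h1.congr' ?_
  filter_upwards [hSpos] with x hx
  rw [hμ' x hx]

/-- The pair process is one measurable, shift-equivariant function of the path of X. -/
theorem IsStationaryGWI.isStronglyStationary_pairProcess (hX : IsStationaryGWI P A B X) :
    IsStronglyStationary P (pairProcess P A B X) := by
  intro h
  let G : (ℤ → ℕ) → ℤ → ℝ × ℝ := fun x k => ((x k : ℝ) ^ (3 / 2 : ℝ), (x k : ℝ) *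
    ((x (k + 1) : ℝ) - offspringMean P A * (x k : ℝ) - immigrationMean P B))
  have hc : ∀ k, Measurable fun x : ℤ → ℕ => (x k : ℝ) := fun k =>
    (measurable_of_countable fun n : ℕ => (n : ℝ)).comp (measurable_pi_apply k)
  have hG : Measurable G := measurable_pi_lambda _ fun k =>
    ((hc k).pow_const _).prodMk ((hc k).mul (((hc (k + 1)).sub ((hc k).const_mul _)).sub_const _))
  have h1 : ∀ l : ℤ, P.map (fun ω k => pairProcess P A B X (k + l) ω) =
      (P.map fun ω k => X (k + l) ω).map G := by
    intro l
    rw [Measure.map_map hG (measurable_pi_lambda _ fun k => hX.measurable_X _)]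
    congr 1
    funext ω k
    simp only [pairProcess, innovation, G, Function.comp, add_sub_cancel_right,
      show k + 1 + l = k + l + 1 by ring]
  have h2 := h1 0
  simp only [add_zero] at h2
  rw [h1, hX.stationary h, h2]

/-- Radial projection outside of the unit ball. -/
noncomputable def radialProj {E : Type*} [NormedAddCommGroup E] [NormedSpace ℝ E] (w : E) : E :=
  (max ‖w‖ 1)⁻¹ • w

theorem continuous_radialProj {E : Type*} [NormedAddCommGroup E] [NormedSpace ℝ E] :
    Continuous (radialProj : E → E) := by
  refine Continuous.smul (Continuous.inv₀ (by fun_prop) fun w => ?_) continuous_id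
  exact (lt_max_of_lt_right one_pos).ne'

theorem norm_radialProj {E : Type*} [NormedAddCommGroup E] [NormedSpace ℝ E] {w : E}
    (hw : 1 < ‖w‖) : ‖radialProj w‖ = 1 := by
  have h : 0 < ‖w‖ := one_pos.trans hw
  rw [radialProj, max_eq_left hw.le, norm_smul, norm_inv, norm_norm, inv_mul_cancel₀ h.ne']

theorem radialProj_smul {E : Type*} [NormedAddCommGroup E] [NormedSpace ℝ E] {w : E} {x : ℝ}
    (hx : 0 < x) (hw : x < ‖w‖) : radialProj (x⁻¹ • w) = ‖w‖⁻¹ • w := by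
  have h1 : ‖x⁻¹ • w‖ = x⁻¹ * ‖w‖ := by rw [norm_smul, norm_inv, Real.norm_of_nonneg hx.le]
  have h2 : 1 ≤ x⁻¹ * ‖w‖ := by
    rw [← div_eq_inv_mul, le_div_iff₀ hx, one_mul]
    exact hw.le
  have h3 : ‖w‖ ≠ 0 := (hx.trans hw).ne'
  rw [radialProj, h1, max_eq_left h2, smul_smul]
  congr 1
  field_simp

/-- The spectral measure is the law of the direction of the limit vector given norm above 1.
`radialProj` is a continuous function on the whole space that agrees with w/‖w‖ outside the unit
ball, so weak convergence carries over to directions. -/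
theorem IsStationaryGWI.isJointlyRegularlyVarying (hX : IsStationaryGWI P A B X) {α : ℝ}
    (hA : MemLp (fun ω => (A 0 0 ω : ℝ)) 2 P) (hμ : offspringMean P A ∈ Set.Ioo (0 : ℝ) 1)
    (hα : α ∈ Set.Ioo (1 : ℝ) 2) (hB : RegVar (tailFn P (B 0)) α) :
    IsJointlyRegularlyVarying P (pairProcess P A B X) (2 * α / 3) := by
  rintro I ⟨i₀, hi₀⟩
  have hα0 : 0 < α := by linarith [hα.1]
  set N := limitMeasure (2 * α / 3) (offspringVar P A) with hN
  set T : LimitSpace → I → ℝ × ℝ := fun p i => limitProcess (offspringMean P A) α i p with hT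
  have hTm : Measurable T := measurable_limitProcess_pi _ α I
  have hφ : IsGauge fun w : I → ℝ × ℝ => ‖w‖ := isGauge_norm
  have htop : N {p | 1 < ‖T p‖} ≠ ∞ :=
    limitMeasure_gauge_ne_top hμ.1 hα0 (by linarith [hα.2]) hφ
  have h0 : N {p | 1 < ‖T p‖} ≠ 0 := by
    refine (lt_of_lt_of_le ?_ (measure_mono (s := {p : LimitSpace |
      1 < ‖ limitProcess (offspringMean P A) α i₀ p‖}) fun p hp =>
        lt_of_lt_of_le hp (norm_le_pi_norm (T p) ⟨i₀, hi₀⟩))).ne'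
    rw [limitMeasure_lt_norm hμ.1 hα0 one_pos, Real.one_rpow, ENNReal.ofReal_one, one_mul]
    exact one_pos.trans_le (one_le_gaussMoment _ (by positivity))
  have hNp : IsProbabilityMeasure (N[|{p | 1 < ‖T p‖}]) := cond_isProbabilityMeasure_of_finite h0 htop
  have hms : MeasurableSet {p | 1 < ‖T p‖} := measurableSet_lt measurable_const hTm.norm
  have hrm : Measurable (radialProj : (I → ℝ × ℝ) → I → ℝ × ℝ) := continuous_radialProj.measurable
  have hpos := hX.scaleFn_pos hA hμ hα hB
  refine ⟨((N[|{p | 1 < ‖T p‖}]).map T).map radialProj, ?_, ?_, fun u hu f => ?_⟩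
  · rw [Measure.map_map hrm hTm]
    exact Measure.isProbabilityMeasure_map (hrm.comp hTm).aemeasurable
  · rw [Measure.map_map hrm hTm, Measure.map_apply (hrm.comp hTm)
      Metric.isClosed_sphere.measurableSet.compl, cond_apply hms]
    have h1 : {p | 1 < ‖T p‖} ∩ radialProj ∘ T ⁻¹' (Metric.sphere 0 1)ᶜ = ∅ := by
      ext p
      simp only [Set.mem_inter_iff, Set.mem_preimage, Set.mem_compl_iff, mem_sphere_zero_iff_norm,
        Set.mem_empty_iff_false, iff_false, not_and, not_not]
      exact fun hp => norm_radialProj hp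
    rw [h1, measure_empty, mul_zero]
  · set β := 2 * α / 3 with hβ
    set V : Ω → I → ℝ × ℝ := fun ω i => pairProcess P A B X i ω with hV
    have hVm : Measurable V := measurable_pi_lambda _ fun i => hX.measurable_pairProcess i
    have hux : Tendsto (fun x : ℝ => u * x) atTop atTop := tendsto_id.const_mul_atTop hu
    have hw := ((hX.tendstoWeakly_gauge hA hμ hα hB hφ h0).map continuous_radialProj f).comp hux
    have hr : Tendsto (fun x => P.real {ω | x < ‖V ω‖} / scaleFn P X x) atTop
        (𝓝 (N.real {p | 1 < ‖T p‖})) := hX.tendsto_measure_gauge hA hμ hα hB hφ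
    have hθ : N.real {p | 1 < ‖T p‖} ≠ 0 := (ENNReal.toReal_pos h0 htop).ne'
    have hb : Tendsto (fun x => scaleFn P X (u * x) / scaleFn P X x) atTop (𝓝 (u ^ (-β))) :=
      regVar_comp_rpow (hX.regVar_X hA hμ hα hB) hu
    -- The first three factors form P(‖V‖ > ux)/P(‖V‖ > x), with limit u^{-β}. The last is the
    -- conditional mean of f at the direction, at level ux.
    have hlim := (((hr.comp hux).mul hb).mul (hr.inv₀ hθ)).mul hw
    rw [mul_comm (N.real _) (u ^ (-β)), mul_assoc (u ^ (-β)), mul_inv_cancel₀ hθ, mul_one] at hlim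
    rw [integral_smul_measure, ENNReal.toReal_ofReal (by positivity), smul_eq_mul]
    refine hlim.congr' ?_
    filter_upwards [eventually_gt_atTop 0, (hr.comp hux).eventually_ne hθ,
      hr.eventually_ne hθ] with x hx hx1 hx2
    have hfm : Measurable f := f.continuous.measurable
    have hsm : Measurable fun ω (i : I) => (u * x)⁻¹ • pairProcess P A B X i ω :=
      hX.measurable_scaled I (u * x)
    have hvm : Measurable fun ω => ‖V ω‖⁻¹ • V ω := hVm.norm.inv.smul hVm
    have hux0 : 0 < u * x := mul_pos hu hx
    simp only [Function.comp] at hx1 ⊢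
    rw [Measure.map_map hrm hsm, integral_map_cond (hrm.comp hsm) hfm, integral_smul_measure,
      integral_map hvm.aemeasurable hfm.aestronglyMeasurable, smul_eq_mul,
      ENNReal.toReal_inv]
    have h1 : ∫ ω in {ω | u * x < ‖V ω‖}, f ((radialProj ∘ fun ω (i : I) =>
        (u * x)⁻¹ • pairProcess P A B X i ω) ω) ∂P =
        ∫ ω in {ω | u * x < ‖V ω‖}, f (‖V ω‖⁻¹ • V ω) ∂P := by
      refine setIntegral_congr_fun (measurableSet_lt measurable_const hVm.norm) fun ω hω => ?_
      exact congrArg f (radialProj_smul hux0 hω)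
    change _ * ((P.real {ω | u * x < ‖V ω‖})⁻¹ * _) = (P.real {ω | x < ‖V ω‖})⁻¹ * _
    rw [h1]
    have h2 := (hpos x).ne'
    have h3 := (hpos (u * x)).ne'
    have h4 : P.real {ω | u * x < ‖V ω‖} ≠ 0 := (div_ne_zero_iff.1 hx1).1
    have h5 : P.real {ω | x < ‖V ω‖} ≠ 0 := (div_ne_zero_iff.1 hx2).1
    field_simp

/-- The two-sided tail process. -/
theorem IsStationaryGWI.condFidiTendsto (hX : IsStationaryGWI P A B X) {α : ℝ}
    (hA : MemLp (fun ω => (A 0 0 ω : ℝ)) 2 P) (hμ : offspringMean P A ∈ Set.Ioo (0 : ℝ) 1)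
    (hα : α ∈ Set.Ioo (1 : ℝ) 2) (hB : RegVar (tailFn P (B 0)) α) :
    CondFidiTendsto P (pairProcess P A B X) (fun x => {ω | x < ‖ pairProcess P A B X 0 ω‖})
      ((limitMeasure (2 * α / 3) (offspringVar P A))[|{p |
        1 < ‖ limitProcess (offspringMean P A) α 0 p‖}]) (limitProcess (offspringMean P A) α) := by
  intro I
  have hα0 : 0 < α := by linarith [hα.1]
  -- Time 0 is added so that the conditioning event is a function of the vector under study; it is
  -- projected away afterwards.
  let J : Finset ℤ := insert 0 I
  have hJ0 : (0 : ℤ) ∈ J := Finset.mem_insert_self 0 I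
  have h0 : limitMeasure (2 * α / 3) (offspringVar P A)
      {p | 1 < ‖ limitProcess (offspringMean P A) α 0 p‖} ≠ 0 := by
    rw [limitMeasure_lt_norm hμ.1 hα0 one_pos, Real.one_rpow, ENNReal.ofReal_one, one_mul]
    exact (one_pos.trans_le (one_le_gaussMoment _ (by positivity))).ne'
  have h1 := hX.tendstoWeakly_gauge hA hμ hα hB (isGauge_norm_eval (⟨0, hJ0⟩ : J)) h0
  let r : (J → ℝ × ℝ) → I → ℝ × ℝ := fun w i => w ⟨i, Finset.mem_insert_of_mem i.2⟩
  have hr : Continuous r := by fun_prop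
  have h2 := h1.map hr
  simp only [Measure.map_map hr.measurable (hX.measurable_scaled J _),
    Measure.map_map hr.measurable (measurable_limitProcess_pi _ α J)] at h2
  exact h2

theorem cond_limitMeasure_pareto {m α v : ℝ} (hm : 0 < m) (hα : 0 < α) (hα2 : α ≤ 3) {y : ℝ}
    (hy : 1 ≤ y) :
    ((limitMeasure (2 * α / 3) v)[|{p | 1 < ‖ limitProcess m α 0 p‖}]).real
      {p | y < ‖ limitProcess m α 0 p‖} = y ^ (-(2 * α / 3)) := by
  have h1 : {p : LimitSpace | 1 < ‖ limitProcess m α 0 p‖} ∩ {p | y < ‖ limitProcess m α 0 p‖} =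
      {p | y < ‖ limitProcess m α 0 p‖} :=
    Set.inter_eq_right.2 fun p hp => lt_of_le_of_lt hy hp
  have h2 : (gaussMoment v (2 * α / 3)).toReal ≠ 0 :=
    (ENNReal.toReal_pos (one_pos.trans_le (one_le_gaussMoment v (by positivity))).ne'
      (gaussMoment_ne_top v (by linarith))).ne'
  rw [Measure.real, cond_apply (measurableSet_lt measurable_const
    (measurable_limitProcess m α 0).norm), h1, limitMeasure_lt_norm hm hα one_pos,
    limitMeasure_lt_norm hm hα (by linarith), Real.one_rpow, ENNReal.ofReal_one, one_mul,
    ENNReal.toReal_mul, ENNReal.toReal_inv, ENNReal.toReal_mul,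
    ENNReal.toReal_ofReal (by positivity)]
  field_simp

end Stationary

/-! ### The variables driving the forward tail process -/

theorem comap_subfamily_le {Ω ι κ E : Type*} [MeasurableSpace E] (f : ι → Ω → E) (g : κ → ι) :
    MeasurableSpace.comap (fun ω a => f (g a) ω) MeasurableSpace.pi ≤
      ⨆ i ∈ Set.range g, MeasurableSpace.comap (f i) inferInstance := by
  have : @Measurable _ _ (⨆ i ∈ Set.range g, MeasurableSpace.comap (f i) inferInstance) _
      (fun ω a => f (g a) ω) := by
    refine @measurable_pi_lambda _ _ _ (_) _ _ fun a => ?_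
    refine (comap_measurable (f (g a))).mono ?_ le_rfl
    exact le_iSup₂_of_le (g a) ⟨a, rfl⟩ le_rfl
  exact this.comap_le

theorem iIndepFun.indepFun_subfamilies {Ω ι κ κ' E : Type*} [MeasurableSpace Ω]
    [MeasurableSpace E] {μ : Measure Ω} {f : ι → Ω → E} (hf : iIndepFun f μ)
    (hm : ∀ i, Measurable (f i)) {g : κ → ι} {g' : κ' → ι} (h : ∀ a b, g a ≠ g' b) :
    IndepFun (fun ω a => f (g a) ω) (fun ω b => f (g' b) ω) μ := by
  have hind := indep_iSup_of_disjoint (S := Set.range g) (T := Set.range g')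
    (fun i => (hm i).comap_le) hf.iIndep (by
      rw [Set.disjoint_left]
      rintro _ ⟨a, rfl⟩ ⟨b, hb⟩
      exact h a b hb.symm)
  exact indep_of_indep_of_le_left (indep_of_indep_of_le_right hind (comap_subfamily_le f g'))
    (comap_subfamily_le f g)

theorem isCountablySpanning_range_Ioi : IsCountablySpanning (Set.range (Set.Ioi : ℝ → Set ℝ)) := by
  refine ⟨fun n : ℕ => Set.Ioi (-(n : ℝ)), fun n => ⟨_, rfl⟩, Set.eq_univ_of_forall fun x => ?_⟩
  obtain ⟨n, hn⟩ := exists_nat_gt (-x)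
  exact Set.mem_iUnion.2 ⟨n, neg_lt.1 hn⟩

theorem Measure.ext_of_Ioi_prod_Ioi {μ ν : Measure (ℝ × ℝ)} [IsProbabilityMeasure μ]
    [IsProbabilityMeasure ν] (h : ∀ a b, μ (Set.Ioi a ×ˢ Set.Ioi b) = ν (Set.Ioi a ×ˢ Set.Ioi b)) :
    μ = ν := by
  have hb : MeasurableSpace.generateFrom (Set.range (Set.Ioi : ℝ → Set ℝ)) = Real.measurableSpace :=
    (borel_eq_generateFrom_Ioi ℝ).symm
  refine ext_of_generate_finite _ (generateFrom_eq_prod hb hb isCountablySpanning_range_Ioi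
    isCountablySpanning_range_Ioi).symm (isPiSystem_Ioi.prod isPiSystem_Ioi) ?_ (by simp)
  rintro _ ⟨_, ⟨a, rfl⟩, _, ⟨b, rfl⟩, rfl⟩
  exact h a b

section Driver

variable {Ω' Ω'' : Type*} [MeasurableSpace Ω'] [MeasurableSpace Ω''] {Q : Measure Ω'}
  {Q' : Measure Ω''} [IsProbabilityMeasure Q] [IsProbabilityMeasure Q'] {α v : ℝ} {Y : Ω' → ℝ}
  {Z : ℕ → Ω' → ℝ} {Y' : Ω'' → ℝ} {Z' : ℕ → Ω'' → ℝ}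

theorem IsTailDriver.map_tail (h : IsTailDriver Q α v Y Z) :
    Q.map (fun ω k => Z (k + 1) ω) = Measure.infinitePi fun _ : ℕ => gaussianReal 0 v.toNNReal := by
  rw [(iIndepFun_iff_map_fun_eq_infinitePi_map fun k => h.measurable_Z (k + 1)).1 h.indep_Z]
  congr 1
  funext k
  exact h.gaussian (k + 1) (by omega)

theorem IsTailDriver.measurable_tail (h : IsTailDriver Q α v Y Z) :
    Measurable fun ω k => Z (k + 1) ω :=
  measurable_pi_lambda _ fun k => h.measurable_Z (k + 1)

theorem IsTailDriver.measurable_head (h : IsTailDriver Q α v Y Z) :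
    Measurable fun ω => (Y ω, Z 0 ω) :=
  h.measurable_Y.prodMk (h.measurable_Z 0)

/-- The joint law of the driving variables is determined. -/
theorem IsTailDriver.map_eq (h : IsTailDriver Q α v Y Z) (h' : IsTailDriver Q' α v Y' Z') :
    Q.map (fun ω => ((Y ω, Z 0 ω), fun k => Z (k + 1) ω)) =
      Q'.map (fun ω => ((Y' ω, Z' 0 ω), fun k => Z' (k + 1) ω)) := by
  have := Measure.isProbabilityMeasure_map (μ := Q) h.measurable_head.aemeasurable
  have := Measure.isProbabilityMeasure_map (μ := Q') h'.measurable_head.aemeasurable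
  have hpair : Q.map (fun ω => (Y ω, Z 0 ω)) = Q'.map (fun ω => (Y' ω, Z' 0 ω)) := by
    refine Measure.ext_of_Ioi_prod_Ioi fun a b => ?_
    have hms := (measurableSet_Ioi (a := a)).prod (measurableSet_Ioi (a := b))
    rw [Measure.map_apply h.measurable_head hms, Measure.map_apply h'.measurable_head hms]
    have h1 := (h.survival a b).trans (h'.survival a b).symm
    exact (ENNReal.toReal_eq_toReal_iff' (measure_ne_top _ _) (measure_ne_top _ _)).1 h1
  rw [(indepFun_iff_map_prod_eq_prod_map_map h.measurable_head.aemeasurable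
      h.measurable_tail.aemeasurable).1 h.indep_pair,
    (indepFun_iff_map_prod_eq_prod_map_map h'.measurable_head.aemeasurable
      h'.measurable_tail.aemeasurable).1 h'.indep_pair, h.map_tail, h'.map_tail, hpair]

/-- The Gaussian coordinates in the space of the values of the driving variables. -/
def driverCoord : ℕ → (ℝ × ℝ) × (ℕ → ℝ) → ℝ
  | 0, q => q.1.2
  | k + 1, q => q.2 k

theorem measurable_driverCoord (k : ℕ) : Measurable (driverCoord k) := by
  cases k with
  | zero => exact measurable_fst.snd
  | succ k => exact (measurable_pi_apply k).comp measurable_snd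

theorem measurable_forwardTail {E : Type*} [MeasurableSpace E] (m : ℝ) {U : E → ℝ} {W : ℕ → E → ℝ}
    (hU : Measurable U) (hW : ∀ k, Measurable (W k)) (k : ℕ) : Measurable (forwardTail m U W k) :=
  (hU.const_mul _).prodMk ((hU.const_mul _).mul (hW k))

/-- Since the defining properties determine the law of the drivers, a statement about laws proved
for one realisation holds for all. -/
theorem IsTailDriver.map_forwardTail_eq (h : IsTailDriver Q α v Y Z)
    (h' : IsTailDriver Q' α v Y' Z') (m : ℝ) :
    Q.map (fun ω k => forwardTail m Y Z k ω) = Q'.map (fun ω k => forwardTail m Y' Z' k ω) := by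
  have hm : Measurable fun (q : (ℝ × ℝ) × (ℕ → ℝ)) k =>
      forwardTail m (fun q => q.1.1) driverCoord k q :=
    measurable_pi_lambda _ (measurable_forwardTail m measurable_fst.fst measurable_driverCoord)
  have h1 := congrArg (Measure.map fun (q : (ℝ × ℝ) × (ℕ → ℝ)) k =>
    forwardTail m (fun q => q.1.1) driverCoord k q) (h.map_eq h')
  rw [Measure.map_map hm (h.measurable_head.prodMk h.measurable_tail),
    Measure.map_map hm (h'.measurable_head.prodMk h'.measurable_tail)] at h1
  convert h1 using 2 <;>
  · funext ω k
    cases k <;> rfl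

end Driver

/-! ### A realisation of the driving variables on the limit space -/

/-- The limit measure conditioned on a large value at time `0`. -/
noncomputable def tailMeasure (m α v : ℝ) : Measure LimitSpace :=
  (limitMeasure (2 * α / 3) v)[|{p | 1 < ‖ limitProcess m α 0 p‖}]

theorem limitMeasure_one_lt {m α : ℝ} (v : ℝ) (hm : 0 < m) (hα : 0 < α) :
    limitMeasure (2 * α / 3) v {p | 1 < ‖ limitProcess m α 0 p‖} = gaussMoment v (2 * α / 3) := by
  rw [limitMeasure_lt_norm hm hα one_pos, Real.one_rpow, ENNReal.ofReal_one, one_mul]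

theorem isProbabilityMeasure_tailMeasure {m α : ℝ} (v : ℝ) (hm : 0 < m) (hα : 0 < α)
    (hα2 : α ≤ 3) : IsProbabilityMeasure (tailMeasure m α v) := by
  refine cond_isProbabilityMeasure_of_finite ?_ ?_
  · rw [limitMeasure_one_lt v hm hα]
    exact (one_pos.trans_le (one_le_gaussMoment _ (by positivity))).ne'
  · rw [limitMeasure_one_lt v hm hα]
    exact gaussMoment_ne_top v (by linarith)

theorem genMass_zero (m α : ℝ) : genMass m α 0 = 1 := by
  simp [genMass]

theorem genScale_zero (m : ℝ) : genScale m 0 = 1 := by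
  simp [genScale]

theorem setOf_one_lt_norm_limitProcess_zero (m α : ℝ) :
    {p : LimitSpace | 1 < ‖ limitProcess m α 0 p‖} =
      Set.Iic (1 : ℝ) ×ˢ {p : ℝ × (ℤ → ℝ) | 1 < |p.1| * max 1 |p.2 0|} := by
  ext p
  change 1 < ‖_‖ ↔ p.1 ≤ 1 ∧ 1 < |p.2.1| * max 1 |p.2.2 0|
  by_cases hp : p.1 ≤ 1
  · rw [limitProcess_of_le (by rwa [genMass_zero]), spine, genScale_zero, mul_one,
      norm_smul_one_pair]
    exact (and_iff_right hp).symm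
  · rw [limitProcess_of_not_le (by rwa [genMass_zero]), norm_zero]
    exact iff_of_false (by norm_num) fun h => hp h.1

/-- A large value at time 0 amounts to u ≤ 1 together with a condition on (r, z_0), so u contributes
total mass 1 and disappears. -/
theorem tailMeasure_snd {m α : ℝ} (v : ℝ) (hm : 0 < m) (hα : 0 < α) (E : Set (ℝ × (ℤ → ℝ))) :
    tailMeasure m α v {p | p.2 ∈ E} = (gaussMoment v (2 * α / 3))⁻¹ *
      ((powerMeasure (2 * α / 3)).prod (gaussSeq v)) ({p | 1 < |p.1| * max 1 |p.2 0|} ∩ E) := by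
  have h1 : {p : LimitSpace | 1 < ‖ limitProcess m α 0 p‖} ∩ {p | p.2 ∈ E} =
      Set.Iic (1 : ℝ) ×ˢ ({p : ℝ × (ℤ → ℝ) | 1 < |p.1| * max 1 |p.2 0|} ∩ E) := by
    rw [setOf_one_lt_norm_limitProcess_zero]
    ext p
    exact and_assoc
  rw [tailMeasure, cond_apply (measurableSet_lt measurable_const
    (measurable_limitProcess m α 0).norm), limitMeasure_one_lt v hm hα, h1, limitMeasure,
    Measure.prod_prod, volume_restrict_Iic, ENNReal.ofReal_one, one_mul]

/-- Conditioning at time 0 involves r and z_0 only, so it biases this pair but leaves z_k, k ≥ 1,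
independent of it and Gaussian. -/
theorem powerMeasure_prod_inter_tail {β v : ℝ} {s : Set (ℝ × ℝ)} (hs : MeasurableSet s)
    {t : Set (ℕ → ℝ)} (ht : MeasurableSet t) :
    ((powerMeasure β).prod (gaussSeq v))
        ({p | (p.1, p.2 0) ∈ s} ∩ {p | (fun k : ℕ => p.2 ((k : ℤ) + 1)) ∈ t}) =
      ((powerMeasure β).prod (gaussSeq v)) {p | (p.1, p.2 0) ∈ s} *
        gaussSeq v {z | (fun k : ℕ => z ((k : ℤ) + 1)) ∈ t} := by
  have hS : Measurable fun p : ℝ × (ℤ → ℝ) => (p.1, p.2 0) :=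
    measurable_fst.prodMk ((measurable_pi_apply 0).comp measurable_snd)
  have hT : Measurable fun z : ℤ → ℝ => fun k : ℕ => z ((k : ℤ) + 1) :=
    measurable_pi_lambda _ fun k => measurable_pi_apply _
  have hms : MeasurableSet {p : ℝ × (ℤ → ℝ) | (p.1, p.2 0) ∈ s} := hS hs
  have hmt : MeasurableSet {p : ℝ × (ℤ → ℝ) | (fun k : ℕ => p.2 ((k : ℤ) + 1)) ∈ t} :=
    (hT.comp measurable_snd) ht
  have hind : IndepFun (fun (z : ℤ → ℝ) (_ : Unit) => z 0)
      (fun (z : ℤ → ℝ) (k : ℕ) => z ((k : ℤ) + 1)) (gaussSeq v) :=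
    iIndepFun.indepFun_subfamilies (iIndepFun_gaussSeq v) (fun i => measurable_pi_apply i)
      (g := fun _ : Unit => (0 : ℤ)) (g' := fun k : ℕ => (k : ℤ) + 1) fun _ b => by omega
  rw [Measure.prod_apply (hms.inter hmt), Measure.prod_apply hms,
    ← lintegral_mul_const _ (measurable_measure_prodMk_left hms)]
  refine lintegral_congr fun r => ?_
  have h1 : MeasurableSet {w : Unit → ℝ | (r, w ()) ∈ s} :=
    (measurable_const.prodMk (measurable_pi_apply ())) hs
  exact hind.measure_inter_preimage_eq_mul _ _ h1 ht

theorem measurableSet_one_lt_abs_mul_max :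
    MeasurableSet {q : ℝ × ℝ | 1 < |q.1| * max 1 |q.2|} :=
  measurableSet_lt measurable_const
    (measurable_fst.norm.mul (measurable_const.max measurable_snd.norm))

theorem tailMeasure_inter_tail {m α : ℝ} (v : ℝ) (hm : 0 < m) (hα : 0 < α) {s : Set (ℝ × ℝ)}
    (hs : MeasurableSet s) {t : Set (ℕ → ℝ)} (ht : MeasurableSet t) :
    tailMeasure m α v ({p | (p.2.1, p.2.2 0) ∈ s} ∩ {p | (fun k : ℕ => p.2.2 ((k : ℤ) + 1)) ∈ t}) =
      tailMeasure m α v {p | (p.2.1, p.2.2 0) ∈ s} *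
        gaussSeq v {z | (fun k : ℕ => z ((k : ℤ) + 1)) ∈ t} := by
  have h1 := tailMeasure_snd (m := m) v hm hα ({p | (p.1, p.2 0) ∈ s} ∩
    {p | (fun k : ℕ => p.2 ((k : ℤ) + 1)) ∈ t})
  have h2 := tailMeasure_snd (m := m) v hm hα {p | (p.1, p.2 0) ∈ s}
  have h3 := powerMeasure_prod_inter_tail (β := 2 * α / 3) (v := v)
    (measurableSet_one_lt_abs_mul_max.inter hs) ht
  rw [← Set.inter_assoc] at h1
  rw [show tailMeasure m α v ({p | (p.2.1, p.2.2 0) ∈ s} ∩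
    {p | (fun k : ℕ => p.2.2 ((k : ℤ) + 1)) ∈ t}) = _ from h1, show tailMeasure m α v {p | (p.2.1, p.2.2 0) ∈ s} = _ from h2, mul_assoc]
  exact congrArg _ h3

/-- For fixed z with z_0 > v₀, the conditions r (1 ∨ |z_0|) > 1 and r > y say that r exceeds max(y,
(1 ∨ |z_0|)⁻¹), whose power-law mass is the integrand. -/
theorem tailMeasure_survival {m α : ℝ} (v : ℝ) (hm : 0 < m) (hα : 0 < α) (y v₀ : ℝ) :
    tailMeasure m α v {p | y < p.2.1 ∧ v₀ < p.2.2 0} = (gaussMoment v (2 * α / 3))⁻¹ *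
      ∫⁻ z, ENNReal.ofReal ((max y (max 1 |z|)⁻¹) ^ (-(2 * α / 3)) *
        (Set.Ioi v₀).indicator 1 z) ∂gaussianReal 0 v.toNNReal := by
  have hβ : 0 < 2 * α / 3 := by positivity
  have hms : MeasurableSet {p : ℝ × (ℤ → ℝ) | y < p.1 ∧ v₀ < p.2 0} :=
    (measurableSet_lt measurable_const measurable_fst).inter
      (measurableSet_lt measurable_const ((measurable_pi_apply 0).comp measurable_snd))
  have hms2 : MeasurableSet {p : ℝ × (ℤ → ℝ) | 1 < p.1 * max 1 |p.2 0| ∧ y < p.1 ∧ v₀ < p.2 0} :=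
    (measurableSet_lt measurable_const (measurable_fst.mul (measurable_const.max
      ((measurable_pi_apply 0).comp measurable_snd).norm))).inter hms
  have hmf : Measurable fun z : ℝ => ENNReal.ofReal ((max y (max 1 |z|)⁻¹) ^ (-(2 * α / 3)) *
      (Set.Ioi v₀).indicator 1 z) :=
    (((measurable_const.max (measurable_const.max measurable_norm).inv).pow_const _).mul
      (measurable_one.indicator measurableSet_Ioi)).ennreal_ofReal
  have h1 := tailMeasure_snd (m := m) v hm hα {p | y < p.1 ∧ v₀ < p.2 0}
  rw [show tailMeasure m α v {p | y < p.2.1 ∧ v₀ < p.2.2 0} = _ from h1, ← map_eval_gaussSeq v 0, lintegral_map hmf (measurable_pi_apply 0)]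
  congr 1
  have h2 : ((powerMeasure (2 * α / 3)).prod (gaussSeq v))
      ({p | 1 < |p.1| * max 1 |p.2 0|} ∩ {p | y < p.1 ∧ v₀ < p.2 0}) =
      ((powerMeasure (2 * α / 3)).prod (gaussSeq v))
      {p | 1 < p.1 * max 1 |p.2 0| ∧ y < p.1 ∧ v₀ < p.2 0} := by
    refine measure_congr ?_
    filter_upwards [Measure.quasiMeasurePreserving_fst.ae (ae_pos_powerMeasure (2 * α / 3))]
      with p hp
    refine propext ?_
    change (1 < |p.1| * _ ∧ _) ↔ (1 < p.1 * _ ∧ _)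
    rw [abs_of_pos hp]
    rfl
  rw [h2, Measure.prod_apply_symm hms2]
  refine lintegral_congr fun z => ?_
  have hM : 0 < max 1 |z 0| := lt_max_of_lt_left one_pos
  by_cases hz : v₀ < z 0
  · rw [Set.indicator_of_mem (show z 0 ∈ Set.Ioi v₀ from hz), Pi.one_apply, mul_one,
      ← powerMeasure_Ioi hβ (lt_max_of_lt_right (inv_pos.2 hM))]
    congr 1
    ext r
    change (1 < r * _ ∧ y < r ∧ _) ↔ max y _ < r
    rw [max_lt_iff, inv_lt_iff_one_lt_mul₀ hM]
    tauto
  · rw [Set.indicator_of_notMem (show z 0 ∉ Set.Ioi v₀ from hz), mul_zero, ENNReal.ofReal_zero]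
    have h3 : (fun r : ℝ => (r, z)) ⁻¹'
        {p : ℝ × (ℤ → ℝ) | 1 < p.1 * max 1 |p.2 0| ∧ y < p.1 ∧ v₀ < p.2 0} = ∅ :=
      Set.eq_empty_of_forall_notMem fun r hr => hz hr.2.2
    rw [h3, measure_empty]

theorem isTailDriver_tailMeasure {m α : ℝ} (v : ℝ) (hm : 0 < m) (hα : 0 < α) (hα2 : α ≤ 3) :
    IsTailDriver (tailMeasure m α v) α v (fun p => p.2.1) (fun k p => p.2.2 (k : ℤ)) := by
  have hP := isProbabilityMeasure_tailMeasure v hm hα hα2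
  have hZ : ∀ k : ℤ, Measurable fun p : LimitSpace => p.2.2 k := fun k =>
    (measurable_pi_apply k).comp (measurable_snd.comp measurable_snd)
  have hT : Measurable fun (z : ℤ → ℝ) (k : ℕ) => z ((k : ℤ) + 1) :=
    measurable_pi_lambda _ fun k => measurable_pi_apply _
  have hT' : Measurable fun (p : LimitSpace) (k : ℕ) => p.2.2 ((k : ℤ) + 1) :=
    measurable_pi_lambda _ fun k => hZ _
  have hlaw : ∀ t : Set (ℕ → ℝ), MeasurableSet t →
      tailMeasure m α v {p | (fun k : ℕ => p.2.2 ((k : ℤ) + 1)) ∈ t} =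
        gaussSeq v {z | (fun k : ℕ => z ((k : ℤ) + 1)) ∈ t} := by
    intro t ht
    have h := tailMeasure_inter_tail (m := m) v hm hα MeasurableSet.univ ht
    simpa using h
  have hmap : (tailMeasure m α v).map (fun (p : LimitSpace) (k : ℕ) => p.2.2 ((k : ℤ) + 1)) =
      (gaussSeq v).map fun (z : ℤ → ℝ) (k : ℕ) => z ((k : ℤ) + 1) := by
    ext t ht
    rw [Measure.map_apply hT' ht, Measure.map_apply hT ht]
    exact hlaw t ht
  have hgauss : ∀ k : ℕ, (tailMeasure m α v).map (fun p => p.2.2 ((k : ℤ) + 1)) =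
      gaussianReal 0 v.toNNReal := by
    intro k
    have h := congrArg (Measure.map fun w : ℕ → ℝ => w k) hmap
    rw [Measure.map_map (measurable_pi_apply k) hT', Measure.map_map (measurable_pi_apply k) hT] at h
    exact h.trans (map_eval_gaussSeq v _)
  refine ⟨measurable_snd.fst, fun k => hZ k, fun y v₀ => ?_, fun k hk => ?_, ?_, ?_⟩
  · change (tailMeasure m α v).real {p | y < p.2.1 ∧ v₀ < p.2.2 0} = _
    rw [Measure.real, tailMeasure_survival v hm hα, ENNReal.toReal_mul, ENNReal.toReal_inv,
      integral_eq_lintegral_of_nonneg_ae, integral_eq_lintegral_of_nonneg_ae]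
    · exact (div_eq_inv_mul _ _).symm
    · exact Eventually.of_forall fun z => by positivity
    · exact (measurable_max_one_abs_rpow _).aestronglyMeasurable
    · refine Eventually.of_forall fun z => mul_nonneg ?_ (Set.indicator_nonneg (fun _ _ => ?_) _)
      · positivity
      · exact zero_le_one
    · exact (((measurable_const.max (measurable_const.max measurable_norm).inv).pow_const _).mul
        (measurable_one.indicator measurableSet_Ioi)).aestronglyMeasurable
  · obtain ⟨k, rfl⟩ := Nat.exists_eq_add_of_le' hk
    have h := hgauss k
    push_cast
    exact h
  · have h1 : iIndepFun (fun (k : ℕ) (p : LimitSpace) => p.2.2 ((k : ℤ) + 1))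
        (tailMeasure m α v) := by
      rw [iIndepFun_iff_map_fun_eq_infinitePi_map fun k => hZ _, hmap,
        (iIndepFun_iff_map_fun_eq_infinitePi_map fun k => measurable_pi_apply _).1
          ((iIndepFun_gaussSeq v).precomp (g := fun k : ℕ => (k : ℤ) + 1) fun a b h => by
            simpa using h)]
      congr 1
      funext k
      rw [hgauss k, map_eval_gaussSeq]
    simpa using h1
  · rw [indepFun_iff_measure_inter_preimage_eq_mul]
    intro s t hs ht
    have h := tailMeasure_inter_tail (m := m) v hm hα hs ht
    rw [← hlaw t ht] at h
    exact h

/-- A large value at time 0 forces u ≤ 1 = `genMass m α 0`, and the thresholds increase, so no time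
k ≥ 0 is cut off. -/
theorem ae_limitProcess_eq_forwardTail {m α : ℝ} (v : ℝ) (hm : 0 < m) (hm1 : m ≤ 1) (hα : 0 ≤ α) :
    ∀ᵐ p ∂tailMeasure m α v, ∀ k : ℕ, limitProcess m α k p =
      forwardTail m (fun p : LimitSpace => p.2.1) (fun k p => p.2.2 (k : ℤ)) k p := by
  have hms : MeasurableSet {p : LimitSpace | 1 < ‖ limitProcess m α 0 p‖} :=
    measurableSet_lt measurable_const (measurable_limitProcess m α 0).norm
  filter_upwards [ae_cond_mem hms] with p hp k
  replace hp : p ∈ {p : LimitSpace | 1 < ‖ limitProcess m α 0 p‖} := hp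
  rw [setOf_one_lt_norm_limitProcess_zero] at hp
  have h1 : p.1 ≤ genMass m α k := by
    refine (show p.1 ≤ 1 from hp.1).trans ?_
    rw [← genMass_zero m α]
    exact genMass_mono hm hm1 hα (Int.natCast_nonneg k)
  rw [limitProcess_of_le h1, spine, forwardTail, genScale, Prod.smul_mk, smul_eq_mul, smul_eq_mul,
    mul_one, mul_comm p.2.1]
  simp

section Stationary

variable {Ω : Type*} [MeasurableSpace Ω] {P : Measure Ω} [IsProbabilityMeasure P]
    {A : ℤ → ℕ → Ω → ℕ} {B : ℤ → Ω → ℕ} {X : ℤ → Ω → ℕ}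

theorem IsStationaryGWI.isTailProcess (hX : IsStationaryGWI P A B X) {α : ℝ}
    (hA : MemLp (fun ω => (A 0 0 ω : ℝ)) 2 P) (hμ : offspringMean P A ∈ Set.Ioo (0 : ℝ) 1)
    (hα : α ∈ Set.Ioo (1 : ℝ) 2) (hB : RegVar (tailFn P (B 0)) α) :
    IsTailProcess P (pairProcess P A B X) (2 * α / 3)
      (tailMeasure (offspringMean P A) α (offspringVar P A))
      (limitProcess (offspringMean P A) α) where
  measurable := measurable_limitProcess _ _
  pareto _ hy := cond_limitMeasure_pareto hμ.1 (by linarith [hα.1]) (by linarith [hα.2]) hy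
  tendsto := hX.condFidiTendsto hA hμ hα hB

/-- By uniqueness in law, any drivers give the law of the two-sided tail process restricted to k ≥
0, so both requirements are inherited from it. -/
theorem IsStationaryGWI.isForwardTailProcess (hX : IsStationaryGWI P A B X) {α : ℝ}
    (hA : MemLp (fun ω => (A 0 0 ω : ℝ)) 2 P) (hμ : offspringMean P A ∈ Set.Ioo (0 : ℝ) 1)
    (hα : α ∈ Set.Ioo (1 : ℝ) 2) (hB : RegVar (tailFn P (B 0)) α)
    {Ω' : Type*} [MeasurableSpace Ω'] {Q : Measure Ω'} [IsProbabilityMeasure Q] {Y : Ω' → ℝ}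
    {Z : ℕ → Ω' → ℝ} (h : IsTailDriver Q α (offspringVar P A) Y Z) :
    IsForwardTailProcess P (pairProcess P A B X) (2 * α / 3) Q
      (forwardTail (offspringMean P A) Y Z) := by
  have hα0 : 0 < α := by linarith [hα.1]
  have hα3 : α ≤ 3 := by linarith [hα.2]
  have hP := isProbabilityMeasure_tailMeasure (offspringVar P A) hμ.1 hα0 hα3
  have hF : ∀ k, Measurable (forwardTail (offspringMean P A) Y Z k) :=
    measurable_forwardTail _ h.measurable_Y h.measurable_Z
  have hL : ∀ k : ℕ, Measurable (limitProcess (offspringMean P A) α k) := fun k =>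
    measurable_limitProcess _ _ _
  have hlaw : Q.map (fun ω k => forwardTail (offspringMean P A) Y Z k ω) =
      (tailMeasure (offspringMean P A) α (offspringVar P A)).map
        fun p (k : ℕ) => limitProcess (offspringMean P A) α k p := by
    rw [h.map_forwardTail_eq (isTailDriver_tailMeasure (offspringVar P A) hμ.1 hα0 hα3)]
    refine Measure.map_congr ?_
    filter_upwards [ae_limitProcess_eq_forwardTail (offspringVar P A) hμ.1 hμ.2.le hα0.le] with p hp
    funext k
    exact (hp k).symm
  have htail := hX.isTailProcess hA hμ hα hB
  refine ⟨hF, fun y hy => ?_, fun I => ?_⟩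
  · rw [← htail.pareto y hy]
    have hms : MeasurableSet {w : ℕ → ℝ × ℝ | y < ‖w 0‖} :=
      measurableSet_lt measurable_const (measurable_pi_apply 0).norm
    have h1 := congrArg (fun ρ : Measure (ℕ → ℝ × ℝ) => ρ.real {w | y < ‖w 0‖}) hlaw
    simp only [Measure.real, Measure.map_apply (measurable_pi_lambda _ hF) hms,
      Measure.map_apply (measurable_pi_lambda _ hL) hms] at h1
    exact h1
  · let J : Finset ℤ := I.map Nat.castEmbedding
    have h1 := htail.tendsto J
    let r : (J → ℝ × ℝ) → I → ℝ × ℝ := fun w i =>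
      w ⟨(i : ℕ), Finset.mem_map_of_mem Nat.castEmbedding i.2⟩
    have hr : Continuous r := by fun_prop
    have h2 := h1.map hr
    simp only [Measure.map_map hr.measurable (hX.measurable_scaled _ _),
      Measure.map_map hr.measurable (measurable_limitProcess_pi _ α _)] at h2
    have hR : Measurable fun (w : ℕ → ℝ × ℝ) (i : I) => w i :=
      measurable_pi_lambda _ fun i => measurable_pi_apply _
    have h3 := congrArg (Measure.map fun (w : ℕ → ℝ × ℝ) (i : I) => w i) hlaw
    rw [Measure.map_map hR (measurable_pi_lambda _ hF),
      Measure.map_map hR (measurable_pi_lambda _ hL)] at h3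
    rw [show Q.map (fun ω' (k : I) => forwardTail (offspringMean P A) Y Z k ω') = _ from h3]
    exact h2

end Stationary

end GWTail

theorem theoremE3 {Ω : Type*} [MeasurableSpace Ω] (P : Measure Ω) [IsProbabilityMeasure P]
    (A : ℤ → ℕ → Ω → ℕ) (B : ℤ → Ω → ℕ) (X : ℤ → Ω → ℕ) (α : ℝ)
    (hX : IsStationaryGWI P A B X)
    (hA : MemLp (fun ω => (A 0 0 ω : ℝ)) 2 P)
    (hμ : offspringMean P A ∈ Set.Ioo (0 : ℝ) 1)
    (hσ : 0 < offspringVar P A)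
    (hα : α ∈ Set.Ioo (1 : ℝ) 2)
    (hB : ∀ q : ℝ, 0 < q →
      Tendsto (fun x : ℝ => P.real {ω | q * x < (B 0 ω : ℝ)} / P.real {ω | x < (B 0 ω : ℝ)})
        atTop (𝓝 (q ^ (-α)))) :
    -- the limit variables exist
    (∃ (Ω' : Type) (_ : MeasurableSpace Ω') (Q : Measure Ω') (Y : Ω' → ℝ) (Z : ℕ → Ω' → ℝ),
      IsProbabilityMeasure Q ∧ IsTailDriver Q α (offspringVar P A) Y Z) ∧
    -- convergence to them, and the forward tail process
    (∀ {Ω' : Type*} [MeasurableSpace Ω'] (Q : Measure Ω') [IsProbabilityMeasure Q]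
      (Y : Ω' → ℝ) (Z : ℕ → Ω' → ℝ), IsTailDriver Q α (offspringVar P A) Y Z →
      CondFidiTendsto P (fun k : ℕ => pairProcess P A B X (k : ℤ))
        (fun x => {ω | x < max ((X 0 ω : ℝ) ^ (3 / 2 : ℝ))
          ((X 0 ω : ℝ) * |innovation P A B X 1 ω|)})
        Q (forwardTail (offspringMean P A) Y Z) ∧
      IsForwardTailProcess P (pairProcess P A B X) (2 * α / 3)
        Q (forwardTail (offspringMean P A) Y Z)) ∧
    -- stationarity and joint regular variation
    IsStronglyStationary P (pairProcess P A B X) ∧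
    IsJointlyRegularlyVarying P (pairProcess P A B X) (2 * α / 3) ∧
    -- the whole tail process
    (∃ (Ω' : Type) (_ : MeasurableSpace Ω') (Q : Measure Ω') (T : ℤ → Ω' → ℝ × ℝ),
      IsProbabilityMeasure Q ∧ IsTailProcess P (pairProcess P A B X) (2 * α / 3) Q T) := by
  have hα0 : 0 < α := by linarith [hα.1]
  have hα3 : α ≤ 3 := by linarith [hα.2]
  have hB' : RegVar (tailFn P (B 0)) α := hB
  have hP := isProbabilityMeasure_tailMeasure (offspringVar P A) hμ.1 hα0 hα3
  refine ⟨⟨LimitSpace, inferInstance, _, _, _, hP,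
    isTailDriver_tailMeasure (offspringVar P A) hμ.1 hα0 hα3⟩, ?_,
    hX.isStronglyStationary_pairProcess, hX.isJointlyRegularlyVarying hA hμ hα hB',
    ⟨LimitSpace, inferInstance, _, _, hP, hX.isTailProcess hA hμ hα hB'⟩⟩
  intro Ω' _ Q _ Y Z h
  have hF := hX.isForwardTailProcess hA hμ hα hB' h
  refine ⟨?_, hF⟩
  have h1 := hF.tendsto
  simp only [norm_pairProcess, zero_add] at h1
  exact h1
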